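/- Let $\vec A=(A_1,A_2,A_3)$ be a real vector field on $\mathbb R^3$ with $A_j\in L^2_{loc}(\mathbb R^3)$, and suppose that $\vec B=\operatorname{curl}\vec A$ (in the sense of distributions) satisfies $|\vec B|\in L^{3/2}(\mathbb R^3)$. Let $\sigma_1,\sigma_2,\sigma_3$ be the Pauli matrices and let $\mathcal H=[L^2(\mathbb R^3)]^2$ (values in $\mathbb C^2$), with inner product $(\cdot,\cdot)$ and norm $\|\cdot\|$. For $\varphi,\psi\in[C_0^\infty(\mathbb R^3)]^2$ put $$p_A[\varphi,\psi]=\Bigl(\sum_{j}\sigma_j(\tfrac1i\partial_j+A_j)\varphi,\ \sum_{j}\sigma_j(\tfrac1i\partial_j+A_j)\psi\Bigr),\qquad b[\varphi,\psi]=(|\vec B|\varphi,\psi),\qquad p=p_A+b .$$ Let $\mathbb P_A$ (the Pauli operator) and $\mathbb P=\mathbb P_A+|\vec B|$ be the non-negative self-adjoint operators in $\mathcal H$ associated with the closures of the forms $p_A$ and $p$, and let $\mathbb P^{1/2}$ be the non-negative self-adjoint square root of $\mathbb P$. Let $\mathbb H^1_B$ be the completion of $\mathcal D(\mathbb P^{1/2})$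 with respect to the norm $\|\mathbb P^{1/2}\varphi\|$. Theorem 3.1. The following objects exist: * the non-negative self-adjoint square root $\mathbb P^{1/2}$; * a continuous linear map $\mathbb H^1_B\to[L^6(\mathbb R^3)]^2$ extending the identity map on $\mathcal D(\mathbb P^{1/2})$; this map is injective, and through it $\mathbb H^1_B$ is regarded as a space of functions; * a bounded self-adjoint operator $\mathcal B$ on $\mathbb H^1_B$ with $(\mathcal Bu,u)_{\mathbb H^1_B}=\int_{\mathbb R^3}|\vec B|\,|u|^2\,dx$ for all $u\in\mathbb H^1_B$; * a unitary map $U:\mathcal H\to\mathbb H^1_B$ with $U\,\mathbb P^{1/2}\varphi=\varphi$ for all $\varphi\in\mathcal D(\mathbb P^{1/2})$, i.e. the unitary extension of $\mathbb P^{-1/2}$; * the bounded operator $\mathcal S=|\vec B|^{1/2}U:\mathcal H\to\mathcal H$. The operator $\mathcal S$ is compact and, with $F=1-\mathcal S\mathcal S^*$ and $\operatorname{nul}$ denoting the dimension of the kernel, $$\operatorname{nul}\mathbb P_A=\dim\{u\in\mathbb H^1_B\cap\mathcal H:\ \mathcal Bu=u\}\ \le\ \operatorname{nul}F .$$ -/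

import Mathlib

open MeasureTheory Filter Topology
open scoped ENNReal Distributions InnerProductSpace InnerProduct

noncomputable section

namespace ZeroModes

/-! ### Spaces -/

/-- Physical space `ℝ³`. -/
abbrev R3 : Type := EuclideanSpace ℝ (Fin 3)

/-- The spin space `ℂ²` with its Euclidean norm. -/
abbrev C2 : Type := EuclideanSpace ℂ (Fin 2)

/-- The Hilbert space `[L²(ℝ³)]²`. -/
abbrev L2Spinor : Type := Lp C2 2 (volume : Measure R3)

instance factOneLeSix : Fact ((1 : ℝ≥0∞) ≤ 6) := ⟨by norm_num⟩

/-- The Banach space `[L⁶(ℝ³)]²`. -/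
abbrev L6Spinor : Type := Lp C2 6 (volume : Measure R3)

/-- The test spinors `[C₀^∞(ℝ³)]²`. -/
abbrev TestSpinor : Type := 𝓓((⊤ : TopologicalSpace.Opens R3), C2)

/-- The `j`-th standard basis vector of `ℝ³`. -/
def basisVec (j : Fin 3) : R3 := EuclideanSpace.single j 1

/-! ### Magnetic potential and magnetic field -/

/-- `A_j ∈ L²_loc(ℝ³)` for all `j`. -/
def IsL2Loc (A : R3 → R3) : Prop :=
  ∀ K : Set R3, IsCompact K → MemLp A 2 (volume.restrict K)

/-- `|B| ∈ L^{3/2}(ℝ³)`. -/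
def IsL32 (B : R3 → R3) : Prop := MemLp B (3 / 2) (volume : Measure R3)

/-- `curl A = B` in the sense of distributions; indices are read modulo `3`, so the `l`-th
component of the curl is `∂_{l+1} A_{l+2} - ∂_{l+2} A_{l+1}`. -/
def IsWeakCurl (A B : R3 → R3) : Prop :=
  ∀ (η : 𝓓((⊤ : TopologicalSpace.Opens R3), ℝ)) (l : Fin 3),
    ∫ x, B x l * η x =
      - ∫ x, (A x (l + 2) * fderiv ℝ η x (basisVec (l + 1))
            - A x (l + 1) * fderiv ℝ η x (basisVec (l + 2)))

/-- The Pauli matrices `σ₁, σ₂, σ₃` (indexed by `0, 1, 2`). -/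
def pauli : Fin 3 → Matrix (Fin 2) (Fin 2) ℂ :=
  ![!![0, 1; 1, 0], !![0, -Complex.I; Complex.I, 0], !![1, 0; 0, -1]]

/-- `σ · ((1/i)∇ + A) φ`, as a function. -/
def weylDiracFun (A : R3 → R3) (φ : R3 → C2) (x : R3) : C2 :=
  ∑ j : Fin 3, Matrix.toEuclideanCLM (n := Fin 2) (𝕜 := ℂ) (pauli j)
    ((1 / Complex.I) • fderiv ℝ φ x (basisVec j) + ((A x j : ℝ) : ℂ) • φ x)

/-! ### The operators are well defined on test spinors -/

theorem memLp_testSpinor (φ : TestSpinor) (p : ℝ≥0∞) :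
    MemLp φ p (volume : Measure R3) :=
  φ.continuous.memLp_of_hasCompactSupport φ.hasCompactSupport

theorem memLp_smul_of_locally {g : R3 → ℂ}
    (hg : ∀ K : Set R3, IsCompact K → MemLp g 2 (volume.restrict K)) (φ : TestSpinor) :
    MemLp (fun x => g x • φ x) 2 (volume : Measure R3) := by
  have hK : IsCompact (tsupport φ) := φ.hasCompactSupport
  have hind : (fun x => g x • φ x) = (tsupport φ).indicator (fun x => g x • φ x) := by
    symm
    rw [Set.indicator_eq_self]
    intro x hx
    apply subset_tsupport
    intro h0
    exact hx (by simp [h0])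
  rw [hind, memLp_indicator_iff_restrict (isClosed_tsupport _).measurableSet]
  obtain ⟨C, hC⟩ := φ.continuous.bounded_above_of_compact_support φ.hasCompactSupport
  refine (hg _ hK).of_le_mul (c := C)
    ((hg _ hK).aestronglyMeasurable.smul φ.continuous.aestronglyMeasurable)
    (Eventually.of_forall fun x => ?_)
  rw [norm_smul, mul_comm]
  exact mul_le_mul_of_nonneg_right (hC x) (norm_nonneg _)

theorem memLp_fderiv_testSpinor (φ : TestSpinor) (v : R3) :
    MemLp (fun x => fderiv ℝ φ x v) 2 (volume : Measure R3) := by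
  have hc : Continuous (fun x => fderiv ℝ φ x v) :=
    (φ.contDiff.continuous_fderiv (by simp)).clm_apply continuous_const
  exact hc.memLp_of_hasCompactSupport (φ.hasCompactSupport.fderiv_apply (𝕜 := ℝ) v)

theorem memLp_weylDiracFun {A : R3 → R3} (hA : IsL2Loc A) (φ : TestSpinor) :
    MemLp (weylDiracFun A φ) 2 (volume : Measure R3) := by
  unfold weylDiracFun
  refine memLp_finsetSum _ fun j _ => ?_
  have h2 : MemLp (fun x => ((A x j : ℝ) : ℂ) • φ x) 2 (volume : Measure R3) := by
    refine memLp_smul_of_locally (fun K hK => ?_) φ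
    have hm : AEStronglyMeasurable (fun x => ((A x j : ℝ) : ℂ)) (volume.restrict K) :=
      (Complex.continuous_ofReal.comp (EuclideanSpace.proj (𝕜 := ℝ) j).continuous
        ).comp_aestronglyMeasurable (hA K hK).aestronglyMeasurable
    refine (hA K hK).of_le hm (Eventually.of_forall fun x => ?_)
    rw [Complex.norm_real]
    exact PiLp.norm_apply_le (A x) j
  exact ContinuousLinearMap.comp_memLp' _
    (((memLp_fderiv_testSpinor φ (basisVec j)).const_smul (1 / Complex.I)).add h2)

theorem memLp_sqrt_smul {B : R3 → R3} (hB : IsL32 B) (φ : TestSpinor) :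
    MemLp (fun x => ((Real.sqrt ‖B x‖ : ℝ) : ℂ) • φ x) 2 (volume : Measure R3) := by
  refine memLp_smul_of_locally (fun K hK => ?_) φ
  have hm : AEStronglyMeasurable (fun x => ((Real.sqrt ‖B x‖ : ℝ) : ℂ)) (volume.restrict K) :=
    ((Complex.continuous_ofReal.comp Real.continuous_sqrt).comp
      continuous_norm).comp_aestronglyMeasurable hB.aestronglyMeasurable.restrict
  have : IsFiniteMeasure (volume.restrict K : Measure R3) :=
    ⟨by rw [Measure.restrict_apply_univ]; exact hK.measure_lt_top⟩
  have h1 : MemLp B 1 (volume.restrict K) :=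
    (hB.restrict K).mono_exponent (by
      rw [ENNReal.le_div_iff_mul_le (by simp) (by simp)]; norm_num)
  rw [memLp_two_iff_integrable_sq_norm hm]
  refine (memLp_one_iff_integrable.1 h1).norm.congr (Eventually.of_forall fun x => ?_)
  simp [Complex.norm_real, abs_of_nonneg (Real.sqrt_nonneg _), Real.sq_sqrt (norm_nonneg _)]

/-- The inclusion `[C₀^∞(ℝ³)]² → [L²(ℝ³)]²`. -/
def testToL2 : TestSpinor →ₗ[ℂ] L2Spinor where
  toFun φ := (memLp_testSpinor φ 2).toLp φ
  map_add' _ _ := rfl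
  map_smul' _ _ := rfl

/-- The map `φ ↦ σ · ((1/i)∇ + A) φ` from `[C₀^∞(ℝ³)]²` to `[L²(ℝ³)]²`. -/
def weylDirac {A : R3 → R3} (hA : IsL2Loc A) : TestSpinor →ₗ[ℂ] L2Spinor where
  toFun φ := (memLp_weylDiracFun hA φ).toLp (weylDiracFun A φ)
  map_add' φ ψ := by
    rw [← MemLp.toLp_add]
    congr 1
    funext x
    have hφ : DifferentiableAt ℝ φ x := (φ.contDiff.differentiable (by simp)) x
    have hψ : DifferentiableAt ℝ ψ x := (ψ.contDiff.differentiable (by simp)) x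
    have hd : fderiv ℝ (⇑(φ + ψ)) x = fderiv ℝ φ x + fderiv ℝ ψ x := fderiv_add hφ hψ
    have hv : (φ + ψ) x = φ x + ψ x := rfl
    simp only [weylDiracFun, Pi.add_apply, hd, hv, ← Finset.sum_add_distrib, ← map_add,
      add_apply, smul_add]
    refine Finset.sum_congr rfl fun j _ => congrArg _ ?_
    abel
  map_smul' c φ := by
    rw [RingHom.id_apply, ← MemLp.toLp_const_smul]
    congr 1
    funext x
    have hφ : DifferentiableAt ℝ φ x := (φ.contDiff.differentiable (by simp)) x
    have hd : fderiv ℝ (⇑(c • φ)) x = c • fderiv ℝ φ x := fderiv_const_smul hφ c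
    have hv : (c • φ) x = c • φ x := rfl
    simp only [weylDiracFun, Pi.smul_apply, hd, hv, Finset.smul_sum, ← map_smul,
      smul_apply, smul_add]
    refine Finset.sum_congr rfl fun j _ => congrArg _ ?_
    rw [smul_comm c, smul_comm c]

/-- Multiplication by `|B|^{1/2}` from `[C₀^∞(ℝ³)]²` to `[L²(ℝ³)]²`. -/
def sqrtFieldMul {B : R3 → R3} (hB : IsL32 B) : TestSpinor →ₗ[ℂ] L2Spinor where
  toFun φ := (memLp_sqrt_smul hB φ).toLp _
  map_add' φ ψ := by
    rw [← MemLp.toLp_add]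
    congr 1
    funext x
    exact smul_add _ (φ x) (ψ x)
  map_smul' c φ := by
    rw [RingHom.id_apply, ← MemLp.toLp_const_smul]
    congr 1
    funext x
    exact smul_comm _ c (φ x)

/-! ### Sesquilinear forms on the test spinors and their associated operators

Inner products and forms are conjugate-linear in the first argument. -/

/-- Sesquilinear forms on `[C₀^∞(ℝ³)]²`. -/
abbrev TestForm : Type := TestSpinor →ₗ⋆[ℂ] TestSpinor →ₗ[ℂ] ℂ

/-- The form `p_A[φ, ψ] = (σ · ((1/i)∇ + A) φ, σ · ((1/i)∇ + A) ψ)`. -/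
def pauliForm {A : R3 → R3} (hA : IsL2Loc A) : TestForm :=
  LinearMap.mk₂'ₛₗ (starRingEnd ℂ) (RingHom.id ℂ) (fun φ ψ => ⟪weylDirac hA φ, weylDirac hA ψ⟫_ℂ)
    (by simp [inner_add_left]) (by simp [inner_smul_left]) (by simp [inner_add_right])
    (by simp [inner_smul_right])

/-- The form `b[φ, ψ] = (|B| φ, ψ) = (|B|^{1/2} φ, |B|^{1/2} ψ)`. -/
def fieldForm {B : R3 → R3} (hB : IsL32 B) : TestForm :=
  LinearMap.mk₂'ₛₗ (starRingEnd ℂ) (RingHom.id ℂ) (fun φ ψ => ⟪sqrtFieldMul hB φ, sqrtFieldMul hB ψ⟫_ℂ)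
    (by simp [inner_add_left]) (by simp [inner_smul_left]) (by simp [inner_add_right])
    (by simp [inner_smul_right])

theorem pauliForm_nonneg {A : R3 → R3} (hA : IsL2Loc A) (φ : TestSpinor) :
    0 ≤ (pauliForm hA φ φ).re :=
  inner_self_nonneg (𝕜 := ℂ) (x := weylDirac hA φ)

theorem fieldForm_nonneg {B : R3 → R3} (hB : IsL32 B) (φ : TestSpinor) :
    0 ≤ (fieldForm hB φ φ).re :=
  inner_self_nonneg (𝕜 := ℂ) (x := sqrtFieldMul hB φ)

theorem sumForm_nonneg {A B : R3 → R3} (hA : IsL2Loc A) (hB : IsL32 B) (φ : TestSpinor) :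
    0 ≤ ((pauliForm hA + fieldForm hB) φ φ).re :=
  add_nonneg (pauliForm_nonneg hA φ) (fieldForm_nonneg hB φ)

/-- Form convergence: `φ n → u` in `L²` and `a[φ m - φ n] → 0` as `m, n → ∞`. The elements `u` for
which such a sequence exists form the domain of the closure of `a`, and the value of the closure at
`(v, u)` is the limit of `a (ψ n) (φ n)` for any such sequences for `v` and `u`. -/
def FormConverges (a : TestForm) (φ : ℕ → TestSpinor) (u : L2Spinor) : Prop :=
  Tendsto (fun n => testToL2 (φ n)) atTop (𝓝 u) ∧
    Tendsto (fun mn : ℕ × ℕ => (a (φ mn.1 - φ mn.2) (φ mn.1 - φ mn.2)).re) atTop (𝓝 0)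

theorem FormConverges.add {a : TestForm} (ha : ∀ φ, 0 ≤ (a φ φ).re) {φ φ' : ℕ → TestSpinor}
    {u u' : L2Spinor} (h : FormConverges a φ u) (h' : FormConverges a φ' u') :
    FormConverges a (φ + φ') (u + u') := by
  refine ⟨?_, ?_⟩
  · simpa using h.1.add h'.1
  · have hlim := (h.2.const_mul 2).add (h'.2.const_mul 2)
    rw [mul_zero, add_zero] at hlim
    refine squeeze_zero (fun _ => ha _) (fun mn => ?_) hlim
    have e : (φ + φ') mn.1 - (φ + φ') mn.2 = (φ mn.1 - φ mn.2) + (φ' mn.1 - φ' mn.2) := by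
      simp only [Pi.add_apply]; abel
    rw [e]
    have key : ∀ x y : TestSpinor, (a (x + y) (x + y)).re ≤ 2 * (a x x).re + 2 * (a y y).re := by
      intro x y
      have h0 := ha (x - y)
      simp only [map_add, map_sub, LinearMap.add_apply, LinearMap.sub_apply, Complex.add_re,
        Complex.sub_re] at h0 ⊢
      linarith
    exact key _ _

theorem FormConverges.smul {a : TestForm} (c : ℂ) {φ : ℕ → TestSpinor}
    {u : L2Spinor} (h : FormConverges a φ u) :
    FormConverges a (fun n => c • φ n) (c • u) := by
  refine ⟨by simpa using h.1.const_smul c, ?_⟩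
  have := h.2.const_mul (‖c‖ ^ 2)
  rw [mul_zero] at this
  refine this.congr fun mn => ?_
  rw [← smul_sub]
  generalize φ mn.1 - φ mn.2 = x
  have e : a (c • x) (c • x) = (starRingEnd ℂ c * c) * a x x := by
    rw [map_smul, LinearMap.map_smulₛₗ₂, smul_eq_mul, smul_eq_mul]
    ring
  rw [e, Complex.conj_mul', ← Complex.ofReal_pow, Complex.re_ofReal_mul]

/-- The graph of the operator associated with the closure of a non-negative form `a`: it consists
of the pairs `(u, w)` such that `u` is in the domain of the closed form and
`a[v, u] = (v, w)` for all `v` in the domain of the closed form. -/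
def formOperatorGraph (a : TestForm) (ha : ∀ φ, 0 ≤ (a φ φ).re) :
    Submodule ℂ (L2Spinor × L2Spinor) where
  carrier := {uw | ∃ φ, FormConverges a φ uw.1 ∧ ∀ ψ v, FormConverges a ψ v →
    Tendsto (fun n => a (ψ n) (φ n)) atTop (𝓝 ⟪v, uw.2⟫_ℂ)}
  zero_mem' := ⟨0, by simp [FormConverges], by simp⟩
  add_mem' := by
    rintro ⟨u, w⟩ ⟨u', w'⟩ ⟨φ, h1, h2⟩ ⟨φ', h1', h2'⟩
    refine ⟨φ + φ', h1.add ha h1', fun ψ v hv => ?_⟩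
    simpa [inner_add_right] using (h2 ψ v hv).add (h2' ψ v hv)
  smul_mem' := by
    rintro c ⟨u, w⟩ ⟨φ, h1, h2⟩
    refine ⟨fun n => c • φ n, h1.smul c, fun ψ v hv => ?_⟩
    simpa [inner_smul_right] using (h2 ψ v hv).const_mul c

/-- The (unbounded) operator in `[L²(ℝ³)]²` associated with the closure of a non-negative closable
form on `[C₀^∞(ℝ³)]²`. Since `[C₀^∞(ℝ³)]²` is dense in `[L²(ℝ³)]²`, the graph above is single-valued
for every closable form; the two forms used below are closable. -/
def formOperator (a : TestForm) (ha : ∀ φ, 0 ≤ (a φ φ).re) : L2Spinor →ₗ.[ℂ] L2Spinor :=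
  (formOperatorGraph a ha).toLinearPMap

/-- The Pauli operator `ℙ_A`. -/
def pauliOperator {A : R3 → R3} (hA : IsL2Loc A) : L2Spinor →ₗ.[ℂ] L2Spinor :=
  formOperator (pauliForm hA) (pauliForm_nonneg hA)

/-- The operator `ℙ = ℙ_A + |B|`, associated with the form `p = p_A + b`. -/
def pauliPlusField {A B : R3 → R3} (hA : IsL2Loc A) (hB : IsL32 B) : L2Spinor →ₗ.[ℂ] L2Spinor :=
  formOperator (pauliForm hA + fieldForm hB) (sumForm_nonneg hA hB)

/-- The nullity of an unbounded operator: the dimension of its kernel, as a cardinal. -/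
def nullity (T : L2Spinor →ₗ.[ℂ] L2Spinor) : Cardinal :=
  Module.rank ℂ (LinearMap.ker T.toFun)

/-- `R = T^{1/2}`: `R` is self-adjoint and non-negative, and `R ∘ R = T`, domains included. -/
structure IsNonnegSqrt (R T : L2Spinor →ₗ.[ℂ] L2Spinor) : Prop where
  selfAdjoint : IsSelfAdjoint R
  nonneg : ∀ u : R.domain, 0 ≤ (⟪(u : L2Spinor), R u⟫_ℂ).re
  sq : ∀ u w, (u, w) ∈ T.graph ↔ ∃ v, (u, v) ∈ R.graph ∧ (v, w) ∈ R.graph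

/-! ### The space `ℍ¹_B` -/

/-- The domain of `R`, equipped with the (semi)norm `‖R u‖`. -/
def NormedDomain (R : L2Spinor →ₗ.[ℂ] L2Spinor) : Type := R.domain

instance (R : L2Spinor →ₗ.[ℂ] L2Spinor) : AddCommGroup (NormedDomain R) :=
  inferInstanceAs (AddCommGroup R.domain)

instance (R : L2Spinor →ₗ.[ℂ] L2Spinor) : Module ℂ (NormedDomain R) :=
  inferInstanceAs (Module ℂ R.domain)

/-- An element of the normed domain of `R`, as an element of `[L²(ℝ³)]²`. -/
def NormedDomain.val {R : L2Spinor →ₗ.[ℂ] L2Spinor} : NormedDomain R →ₗ[ℂ] L2Spinor :=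
  R.domain.subtype

/-- The operator `R` on its normed domain. -/
def NormedDomain.apply {R : L2Spinor →ₗ.[ℂ] L2Spinor} : NormedDomain R →ₗ[ℂ] L2Spinor :=
  R.toFun

instance (R : L2Spinor →ₗ.[ℂ] L2Spinor) : SeminormedAddCommGroup (NormedDomain R) :=
  SeminormedAddCommGroup.induced (NormedDomain R) L2Spinor (NormedDomain.apply (R := R))

instance (R : L2Spinor →ₗ.[ℂ] L2Spinor) : InnerProductSpace ℂ (NormedDomain R) where
  inner u v := ⟪u.apply, v.apply⟫_ℂ
  norm_smul_le c u := by
    change ‖NormedDomain.apply (c • u)‖ ≤ ‖c‖ * ‖NormedDomain.apply u‖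
    rw [map_smul, norm_smul]
  norm_sq_eq_re_inner u := norm_sq_eq_re_inner (𝕜 := ℂ) (NormedDomain.apply u)
  conj_inner_symm u v := inner_conj_symm (NormedDomain.apply u) (NormedDomain.apply v)
  add_left u v w := by simp [inner_add_left]
  smul_left u v c := by simp [inner_smul_left]

/-- The completion of the domain of `R` with respect to the norm `‖R u‖`. For `R = ℙ^{1/2}` this is
the space `ℍ¹_B`. -/
abbrev H1 (R : L2Spinor →ₗ.[ℂ] L2Spinor) : Type := UniformSpace.Completion (NormedDomain R)

/-- The canonical map from the domain of `R` to the completion. -/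
def toH1 {R : L2Spinor →ₗ.[ℂ] L2Spinor} (u : NormedDomain R) : H1 R := u

/-! ### The Birman-Schwinger operator -/

/-- The objects entering the Birman-Schwinger construction for the pair `A`, `B`, each given by the
property that defines it:
* `R = ℙ^{1/2}`;
* `J : ℍ¹_B → [L⁶(ℝ³)]²` is the continuous extension of the identity map of the domain of
  `ℙ^{1/2}`; it realizes the elements of `ℍ¹_B` as functions;
* `𝓑` is the bounded self-adjoint operator on `ℍ¹_B` with `(𝓑 u, u)_{ℍ¹_B} = b[u] = ∫ |B| |u|²`;
* `U : [L²(ℝ³)]² → ℍ¹_B` is the unitary extension of `ℙ^{-1/2}`, that is `U (ℙ^{1/2} u) = u`;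
* `S = |B|^{1/2} U`. -/
structure IsBirmanSchwinger {A B : R3 → R3} (hA : IsL2Loc A) (hB : IsL32 B)
    (R : L2Spinor →ₗ.[ℂ] L2Spinor) (J : H1 R →L[ℂ] L6Spinor) (𝓑 : H1 R →L[ℂ] H1 R)
    (U : L2Spinor ≃ₗᵢ[ℂ] H1 R) (S : L2Spinor →L[ℂ] L2Spinor) : Prop where
  sqrt : IsNonnegSqrt R (pauliPlusField hA hB)
  embed : ∀ u : NormedDomain R, J (toH1 u) =ᵐ[volume] u.val
  selfAdjoint : IsSelfAdjoint 𝓑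
  form : ∀ u : H1 R, ⟪𝓑 u, u⟫_ℂ = ((∫ x, ‖B x‖ * ‖J u x‖ ^ 2 : ℝ) : ℂ)
  unitary : ∀ u : NormedDomain R, U u.apply = toH1 u
  factor : ∀ f : L2Spinor, S f =ᵐ[volume] fun x => ((Real.sqrt ‖B x‖ : ℝ) : ℂ) • J (U f) x

/-- The space `{u ∈ ℍ¹_B ∩ [L²(ℝ³)]² : 𝓑 u = u}`. -/
def fixedSpace {R : L2Spinor →ₗ.[ℂ] L2Spinor} (J : H1 R →L[ℂ] L6Spinor)
    (𝓑 : H1 R →L[ℂ] H1 R) : Submodule ℂ (H1 R) where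
  carrier := {u | 𝓑 u = u ∧ MemLp (J u) 2 (volume : Measure R3)}
  zero_mem' := by
    refine ⟨map_zero _, ?_⟩
    rw [map_zero]
    exact (MemLp.zero (p := 2)).ae_eq (Lp.coeFn_zero C2 6 volume).symm
  add_mem' := by
    rintro u v ⟨hu, hu'⟩ ⟨hv, hv'⟩
    refine ⟨by rw [map_add, hu, hv], ?_⟩
    rw [map_add]
    exact (hu'.add hv').ae_eq (Lp.coeFn_add (J u) (J v)).symm
  smul_mem' := by
    rintro c u ⟨hu, hu'⟩
    refine ⟨by rw [map_smul, hu], ?_⟩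
    rw [map_smul]
    exact (hu'.const_smul c).ae_eq (Lp.coeFn_smul c (J u)).symm

/-- `F = 1 - S S*`. -/
def birmanSchwingerF (S : L2Spinor →L[ℂ] L2Spinor) : L2Spinor →L[ℂ] L2Spinor :=
  1 - S ∘L ContinuousLinearMap.adjoint S

end ZeroModes

end

/-! ### Square roots of non-negative self-adjoint operators, via the resolvent -/

section AbstractOperators

variable {H V K : Type*} [NormedAddCommGroup H] [InnerProductSpace ℂ H] [CompleteSpace H]
  [NormedAddCommGroup V] [InnerProductSpace ℂ V] [CompleteSpace V]
  [NormedAddCommGroup K] [InnerProductSpace ℂ K]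

/-! Write D for σ·(p + A), with p = (1/i)∇, and M for multiplication by |B|^{1/2}. The Pauli algebra
gives ‖Dφ‖² = ‖(p + A)φ‖² + (σ·B φ, φ) (`normSq_weylDirac`). Since σ·B ≥ -|B| pointwise, the form
‖Dφ‖² + ‖Mφ‖² dominates ‖(p + A)φ‖² (`sum_normSq_momentum_le`). The diamagnetic and Sobolev
inequalities then bound the L⁶ norm of φ by the form norm (`exists_norm_testToL6_le`). Hence ℍ¹_B
maps to L⁶, and |B|^{1/2} ∈ L³ makes M bounded from ℍ¹_B to L² by Hölder. The operators are 𝓑 = M*M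
and S = MU, so that SS* = MM*.

D extends to ℍ¹_B with ⟪u, v⟫ = ⟪Du, Dv⟫ + ⟪Mu, Mv⟫ (`inner_H1_eq`), so 𝓑u = u exactly when Du = 0.
The kernel of ℙ_A is the kernel of the L²-closure of D, and the equality of dimensions says that the
two meanings of "Du = 0, u ∈ L²" agree. If v lies in the kernel of the closure, the bound
`exists_energy_le` upgrades convergence in the graph norm of D to convergence in ℍ¹_B. Conversely,
an element of ℍ¹_B is approximated by test spinors only in L⁶, and cutoffs whose gradients tend
uniformly to zero bring it into the closure, because u ∈ L² (`exists_formMap_eq_zero`). The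
inequality holds because M maps ker(1 - M*M) injectively into ker(1 - MM*).

For compactness, |B|^{1/2} is approximated in L³ by smooth V of compact support. The functions Vφ
with φ in the energy ball have gradients bounded in L¹ and are bounded in L⁶, so small translations
move them little in L² and averages over small cubes approximate them uniformly from one
finite-dimensional space.

The square root is built from the form domain: with ι its inclusion in L², the resolvent of the form
operator at -1 is C = ιι*, and R has the graph {(C^{1/2}x, (1 - C)^{1/2}x)}.
`formDomain_eq_domain_sqrt` identifies the domain of any non-negative square root with the form
domain, so that everything can be checked on test spinors. -/

omit [CompleteSpace H] in
theorem inner_of_nonneg {Q : H →L[ℂ] H} (hQ : 0 ≤ Q) (x y : H) : ⟪Q x, y⟫_ℂ = ⟪x, Q y⟫_ℂ :=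
  (ContinuousLinearMap.nonneg_iff_isPositive Q).1 hQ |>.isSymmetric x y

/-- A bounded operator `C` with `0 ≤ C ≤ 1` and trivial kernel is the resolvent `(1 + R²)⁻¹` of a
non-negative self-adjoint operator `R`. -/
theorem exists_selfAdjoint_sq_resolvent (C : H →L[ℂ] H) (hC : 0 ≤ C) (hC1 : C ≤ 1)
    (hinj : Function.Injective C) :
    ∃ R : H →ₗ.[ℂ] H, IsSelfAdjoint R ∧ (∀ u : R.domain, 0 ≤ (⟪(u : H), R u⟫_ℂ).re) ∧
      ∀ u w, (∃ v, (u, v) ∈ R.graph ∧ (v, w) ∈ R.graph) ↔ ∃ z, u = C z ∧ w = z - C z := by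
  set Q := CFC.sqrt C with hQdef
  set W := CFC.sqrt (1 - C) with hWdef
  have hQ : 0 ≤ Q := CFC.sqrt_nonneg C
  have hW : 0 ≤ W := CFC.sqrt_nonneg _
  have hC1' : 0 ≤ 1 - C := sub_nonneg.2 hC1
  have hQQ : ∀ x, Q (Q x) = C x := fun x =>
    DFunLike.congr_fun (CFC.sqrt_mul_sqrt_self C hC) x
  have hWW : ∀ x, W (W x) = x - C x := fun x =>
    DFunLike.congr_fun (CFC.sqrt_mul_sqrt_self (1 - C) hC1') x
  have hcomm : Commute Q W := by
    have h1 : Commute C (1 - C) := (Commute.one_right C).sub_right (Commute.refl C)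
    have h2 : Commute Q (1 - C) := h1.cfcₙ_nnreal _
    exact (h2.symm.cfcₙ_nnreal _).symm
  have hQW : ∀ x, Q (W x) = W (Q x) := fun x => DFunLike.congr_fun hcomm.eq x
  have hQinj : ∀ x, Q x = 0 → x = 0 := by
    intro x hx
    apply hinj
    rw [← hQQ, hx, map_zero, map_zero]
  -- C = (1 + R²)⁻¹ forces Q = (1 + R²)^{-1/2} and W = R(1 + R²)^{-1/2}. The graph of R is therefore
  -- the set of pairs (Qx, Wx).
  let g : Submodule ℂ (H × H) := LinearMap.range ((Q : H →ₗ[ℂ] H).prod (W : H →ₗ[ℂ] H))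
  have hmem : ∀ p : H × H, p ∈ g ↔ ∃ x, Q x = p.1 ∧ W x = p.2 := by
    rintro ⟨a, b⟩
    simp [g, LinearMap.mem_range, Prod.ext_iff]
  have hg : ∀ p ∈ g, p.1 = 0 → p.2 = 0 := by
    intro p hp h0
    obtain ⟨x, h1, h2⟩ := (hmem p).1 hp
    rw [← h2, hQinj x (h1.trans h0), map_zero]
  have hgraph : g.toLinearPMap.graph = g := Submodule.toLinearPMap_graph_eq g hg
  have hdense : Dense (g.toLinearPMap.domain : Set H) := by
    rw [Submodule.dense_iff_topologicalClosure_eq_top,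
      Submodule.topologicalClosure_eq_top_iff, Submodule.eq_bot_iff]
    intro x hx
    apply hQinj
    have : ⟪Q (Q x), x⟫_ℂ = 0 := by
      apply (Submodule.mem_orthogonal _ _).1 hx
      rw [LinearPMap.mem_domain_iff]
      exact ⟨W (Q x), by rw [hgraph, hmem]; exact ⟨Q x, rfl, rfl⟩⟩
    rwa [inner_of_nonneg hQ, inner_self_eq_zero] at this
  refine ⟨g.toLinearPMap, ?_, ?_, ?_⟩
  · rw [LinearPMap.isSelfAdjoint_def]
    apply LinearPMap.eq_of_eq_graph
    rw [LinearPMap.adjoint_graph_eq_graph_adjoint hdense, hgraph]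
    ext ⟨u, w⟩
    rw [Submodule.mem_adjoint_iff, hmem]
    constructor
    · intro h
      have key : Q w = W u := by
        refine ext_inner_left ℂ fun x => ?_
        have := h (Q x) (W x) ((hmem _).2 ⟨x, rfl, rfl⟩)
        rw [← inner_of_nonneg hQ, ← inner_of_nonneg hW]
        exact (sub_eq_zero.1 this).symm
      -- From u = Qx and w = Wx the parameter is recovered as x = Qu + Ww, because Q² + W² = 1.
      refine ⟨Q u + W w, ?_, ?_⟩
      · rw [map_add, hQQ, hQW, key, hWW]; simp
      · rw [map_add, hWW, ← hQW, ← key, hQQ]; simp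
    · rintro ⟨y, rfl, rfl⟩ a b hab
      obtain ⟨x, rfl, rfl⟩ := (hmem (a, b)).1 hab
      simp only
      rw [inner_of_nonneg hW, inner_of_nonneg hQ, hQW, sub_self]
  · intro u
    obtain ⟨x, h1, h2⟩ := (hmem (u, g.toLinearPMap u)).1 (hgraph.le (LinearPMap.mem_graph _ u))
    simp only at h1 h2
    rw [← h1, ← h2, inner_of_nonneg hQ]
    have := (ContinuousLinearMap.nonneg_iff_isPositive _).1 (hcomm.mul_nonneg hQ hW)
    simpa using this.re_inner_nonneg_right x
  · intro u w
    rw [hgraph]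
    constructor
    · rintro ⟨v, h1, h2⟩
      obtain ⟨x, rfl, rfl⟩ := (hmem (u, v)).1 h1
      obtain ⟨y, h3, rfl⟩ := (hmem (W x, w)).1 h2
      simp only at h3
      have : C (Q x + W y) = Q x := by
        rw [← hQQ, map_add, hQW, h3, hWW, hQQ]; simp
      -- The sum of Cz and z - Cz is z, so z can only be u + w.
      refine ⟨Q x + W y, this.symm, ?_⟩
      rw [this]; simp
    · rintro ⟨z, rfl, rfl⟩
      refine ⟨W (Q z), (hmem _).2 ⟨Q z, hQQ z, rfl⟩, (hmem _).2 ⟨W z, hQW z, hWW z⟩⟩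

/-- Adding ⟪ι v', ι v⟫ to the form equation turns it into ⟪v', v⟫ = ⟪ι v', u + w⟫, that is v = ι†(u
+ w). So ιι† is the resolvent of the form operator at -1, with z = u + w. -/
theorem mem_formGraph_iff_resolvent {ι : V →L[ℂ] H} {τ : V →L[ℂ] K}
    (hV : ∀ v w, ⟪v, w⟫_ℂ = ⟪ι v, ι w⟫_ℂ + ⟪τ v, τ w⟫_ℂ) (u w : H) :
    (∃ v, ι v = u ∧ ∀ v', ⟪τ v', τ v⟫_ℂ = ⟪ι v', w⟫_ℂ) ↔
      ∃ z, u = (ι ∘L ι†) z ∧ w = z - (ι ∘L ι†) z := by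
  constructor
  · rintro ⟨v, rfl, h⟩
    have : (ι†) (ι v + w) = v := by
      refine ext_inner_left ℂ fun v' => ?_
      rw [ContinuousLinearMap.adjoint_inner_right, inner_add_right, hV, h]
    refine ⟨ι v + w, ?_, ?_⟩ <;> simp only [ContinuousLinearMap.comp_apply, this]
    simp
  · rintro ⟨z, rfl, rfl⟩
    refine ⟨(ι†) z, rfl, fun v' => ?_⟩
    have := hV v' ((ι†) z)
    rw [ContinuousLinearMap.adjoint_inner_right] at this
    rw [inner_sub_right, this]
    simp

/-- The resolvent ιι† is a contraction because the norm of V dominates that of H, and it is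
injective because ι has dense range; the previous construction applies to it. -/
theorem exists_selfAdjoint_sq_form {ι : V →L[ℂ] H} {τ : V →L[ℂ] K}
    (hV : ∀ v w, ⟪v, w⟫_ℂ = ⟪ι v, ι w⟫_ℂ + ⟪τ v, τ w⟫_ℂ) (hd : DenseRange ι) :
    ∃ R : H →ₗ.[ℂ] H, IsSelfAdjoint R ∧ (∀ u : R.domain, 0 ≤ (⟪(u : H), R u⟫_ℂ).re) ∧
      ∀ u w, (∃ v, (u, v) ∈ R.graph ∧ (v, w) ∈ R.graph) ↔
        ∃ v, ι v = u ∧ ∀ v', ⟪τ v', τ v⟫_ℂ = ⟪ι v', w⟫_ℂ := by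
  have hι : ∀ v, ‖ι v‖ ≤ ‖v‖ := by
    intro v
    have h := congrArg Complex.re (hV v v)
    rw [Complex.add_re] at h
    have h1 := norm_sq_eq_re_inner (𝕜 := ℂ) v
    have h2 := norm_sq_eq_re_inner (𝕜 := ℂ) (ι v)
    have h3 := norm_sq_eq_re_inner (𝕜 := ℂ) (τ v)
    simp only [RCLike.re_to_complex] at h1 h2 h3
    refine abs_le_of_sq_le_sq' ?_ (norm_nonneg _) |>.2
    nlinarith [sq_nonneg ‖τ v‖]
  have hι1 : ‖ι†‖ ≤ 1 := by
    rw [LinearIsometryEquiv.norm_map]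
    exact ι.opNorm_le_bound zero_le_one (by simpa using hι)
  have hker : ∀ z, (ι†) z = 0 → z = 0 := by
    intro z hz
    refine hd.eq_zero_of_inner_right ℂ ?_
    intro v
    rw [← ContinuousLinearMap.adjoint_inner_right, hz, inner_zero_right]
  have hinner : ∀ z, ⟪(ι ∘L ι†) z, z⟫_ℂ = ((‖(ι†) z‖ ^ 2 : ℝ) : ℂ) := by
    intro z
    rw [ContinuousLinearMap.comp_apply, ← ContinuousLinearMap.adjoint_inner_right,
      inner_self_eq_norm_sq_to_K]
    simp
  have hC : 0 ≤ ι ∘L ι† := by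
    rw [ContinuousLinearMap.nonneg_iff_isPositive]
    exact ContinuousLinearMap.isPositive_self_comp_adjoint ι
  have hC1 : ι ∘L ι† ≤ 1 := by
    rw [ContinuousLinearMap.le_def, ContinuousLinearMap.isPositive_def']
    refine ⟨(IsSelfAdjoint.one _).sub
      (ContinuousLinearMap.isPositive_self_comp_adjoint ι).isSelfAdjoint, fun z => ?_⟩
    rw [ContinuousLinearMap.reApplyInnerSelf_apply, sub_apply, inner_sub_left, map_sub, hinner]
    have h1 := norm_sq_eq_re_inner (𝕜 := ℂ) z
    have h2 : ‖(ι†) z‖ ≤ ‖z‖ := by simpa using (ι†).le_of_opNorm_le hι1 z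
    simp only [one_apply_eq_self, RCLike.re_to_complex, Complex.ofReal_re] at h1 ⊢
    rw [← h1]
    nlinarith [norm_nonneg ((ι†) z), norm_nonneg z]
  have hCi : Function.Injective (ι ∘L ι†) := by
    rw [injective_iff_map_eq_zero]
    intro z hz
    have := hinner z
    rw [hz, inner_zero_left] at this
    apply hker
    have h5 : ‖(ι†) z‖ ^ 2 = 0 := by exact_mod_cast this.symm
    simpa using h5
  obtain ⟨R, h1, h2, h3⟩ := exists_selfAdjoint_sq_resolvent (ι ∘L ι†) hC hC1 hCi
  exact ⟨R, h1, h2, fun u w => by rw [h3, mem_formGraph_iff_resolvent hV]⟩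

/-- If `R² = τ*τ` as forms, then the domain of `R` is the form domain and `‖R u‖ = ‖τ u‖`. -/
theorem formDomain_eq_domain_sqrt {ι : V →L[ℂ] H} {τ : V →L[ℂ] K}
    (hV : ∀ v w, ⟪v, w⟫_ℂ = ⟪ι v, ι w⟫_ℂ + ⟪τ v, τ w⟫_ℂ) (hinj : Function.Injective ι)
    {R : H →ₗ.[ℂ] H} (hR : IsSelfAdjoint R)
    (hsq : ∀ u w, (∃ v, (u, v) ∈ R.graph ∧ (v, w) ∈ R.graph) ↔
        ∃ v, ι v = u ∧ ∀ v', ⟪τ v', τ v⟫_ℂ = ⟪ι v', w⟫_ℂ) :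
    (∀ v, ∃ w, (ι v, w) ∈ R.graph ∧ ‖w‖ = ‖τ v‖) ∧ ∀ x ∈ R.domain, ∃ v, ι v = x := by
  have hsymm : ∀ a a' b b', (a, a') ∈ R.graph → (b, b') ∈ R.graph → ⟪a', b⟫_ℂ = ⟪a, b'⟫_ℂ := by
    intro a a' b b' ha hb
    have hb2 : (b, b') ∈ R.graph.adjoint := by
      rw [← LinearPMap.adjoint_graph_eq_graph_adjoint hR.dense_domain,
        LinearPMap.isSelfAdjoint_def.1 hR]
      exact hb
    exact sub_eq_zero.1 ((Submodule.mem_adjoint_iff _ _).1 hb2 a a' ha)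
  -- The vectors ιι†z form the domain of R². There ‖R·‖² is the quadratic form of R², which gives
  -- the norm equality; density of the range of ι† and closedness of R extend it to the whole form
  -- domain.
  have hres : ∀ z, ∃ w, (ι ((ι†) z), w) ∈ R.graph ∧ (w, z - ι ((ι†) z)) ∈ R.graph := by
    intro z
    rw [hsq, mem_formGraph_iff_resolvent hV]
    exact ⟨z, rfl, rfl⟩
  choose ρ hρ1 hρ2 using hres
  have hρnorm : ∀ z, ‖ρ z‖ = ‖τ ((ι†) z)‖ := by
    intro z
    have h1 := hsymm _ _ _ _ (hρ1 z) (hρ2 z)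
    have h2 := hV ((ι†) z) ((ι†) z)
    rw [ContinuousLinearMap.adjoint_inner_right] at h2
    have h3 : ⟪ρ z, ρ z⟫_ℂ = ⟪τ ((ι†) z), τ ((ι†) z)⟫_ℂ := by
      rw [h1, inner_sub_right, h2]; simp
    rw [inner_self_eq_norm_sq_to_K, inner_self_eq_norm_sq_to_K] at h3
    have h4 : ‖ρ z‖ ^ 2 = ‖τ ((ι†) z)‖ ^ 2 := by exact_mod_cast h3
    exact (sq_eq_sq₀ (norm_nonneg _) (norm_nonneg _)).1 h4
  have hρsub : ∀ z z', ρ z - ρ z' = ρ (z - z') := by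
    intro z z'
    have h1 := R.graph.sub_mem (hρ1 z) (hρ1 z')
    have h2 := hρ1 (z - z')
    rw [Prod.mk_sub_mk] at h1
    rw [map_sub, map_sub] at h2
    exact LinearPMap.mem_graph_snd_inj R h1 h2 rfl
  have hdense : DenseRange (ι†) := by
    have h1 := (LinearMap.range (ι† : H →ₗ[ℂ] V)).dense_iff_topologicalClosure_eq_top
    have : Dense ((LinearMap.range (ι† : H →ₗ[ℂ] V) : Submodule ℂ V) : Set V) := by
      rw [h1, Submodule.topologicalClosure_eq_top_iff, Submodule.eq_bot_iff]
      intro v hv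
      apply hinj
      rw [map_zero, ← inner_self_eq_zero (𝕜 := ℂ), ← ContinuousLinearMap.adjoint_inner_left]
      exact (Submodule.mem_orthogonal _ _).1 hv _ ⟨ι v, rfl⟩
    exact this
  have hfirst : ∀ v, ∃ w, (ι v, w) ∈ R.graph ∧ ‖w‖ = ‖τ v‖ := by
    intro v
    obtain ⟨s, hs, hlim⟩ := mem_closure_iff_seq_limit.1 (hdense v)
    choose z hz using hs
    obtain rfl : (fun n => (ι†) (z n)) = s := funext hz
    have hτ : Tendsto (fun n => τ ((ι†) (z n))) atTop (𝓝 (τ v)) := (τ.continuous.tendsto v).comp hlim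
    have hc : CauchySeq (fun n => ρ (z n)) := by
      rw [Metric.cauchySeq_iff]
      intro ε hε
      obtain ⟨N, hN⟩ := Metric.cauchySeq_iff.1 hτ.cauchySeq ε hε
      refine ⟨N, fun m hm n hn => ?_⟩
      have := hN m hm n hn
      rwa [dist_eq_norm, hρsub, hρnorm, map_sub, map_sub, ← dist_eq_norm]
    obtain ⟨w, hw⟩ := cauchySeq_tendsto_of_complete hc
    refine ⟨w, ?_, ?_⟩
    · refine hR.isClosed.mem_of_tendsto
        ((((ι.continuous.tendsto v).comp hlim)).prodMk_nhds hw) (Eventually.of_forall fun n => hρ1 (z n))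
    · refine tendsto_nhds_unique hw.norm ?_
      simpa only [hρnorm] using hτ.norm
  refine ⟨hfirst, ?_⟩
  choose r hr1 hr2 using hfirst
  let rL : V →ₗ[ℂ] H :=
    { toFun := r
      map_add' := fun a b => by
        have h1 := R.graph.add_mem (hr1 a) (hr1 b)
        rw [Prod.mk_add_mk] at h1
        exact LinearPMap.mem_graph_snd_inj R (hr1 (a + b)) h1 (map_add ι a b)
      map_smul' := fun c a => by
        have h1 := R.graph.smul_mem c (hr1 a)
        rw [Prod.smul_mk] at h1
        exact LinearPMap.mem_graph_snd_inj R (hr1 (c • a)) h1 (map_smul ι c a) }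
  let rC : V →L[ℂ] H := rL.mkContinuous ‖τ‖ fun v => by
    change ‖r v‖ ≤ _
    rw [hr2]; exact τ.le_opNorm v
  intro x hx
  obtain ⟨x', hx'⟩ := LinearPMap.mem_domain_iff.1 hx
  -- With rC = R ∘ ι the inner product of V is ⟪ι·, ι·⟫ + ⟪rC·, rC·⟫, so a preimage v of x must
  -- equal ι†ιv + rC†rCv = ι†x + rC†Rx.
  refine ⟨(ι†) x + (rC†) x', ?_⟩
  refine ext_inner_left ℂ fun z => ?_
  rw [← ContinuousLinearMap.adjoint_inner_left, inner_add_right,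
    ContinuousLinearMap.adjoint_inner_right, ContinuousLinearMap.adjoint_inner_right]
  have h1 : rC ((ι†) z) = ρ z := LinearPMap.mem_graph_snd_inj R (hr1 _) (hρ1 z) rfl
  rw [h1, ← hsymm _ _ _ _ (hρ2 z) hx', inner_sub_left]
  simp

end AbstractOperators

/-! ### Algebra of the Pauli matrices -/

noncomputable section
namespace ZeroModes

/-- The Pauli matrices as operators on `ℂ²`. -/
def spin (j : Fin 3) : C2 →L[ℂ] C2 := Matrix.toEuclideanCLM (n := Fin 2) (𝕜 := ℂ) (pauli j)

theorem spin_apply (j : Fin 3) (v : C2) (i : Fin 2) :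
    spin j v i = pauli j i 0 * v 0 + pauli j i 1 * v 1 := by
  rw [spin, Matrix.ofLp_toEuclideanCLM, Matrix.mulVec, dotProduct, Fin.sum_univ_two]

@[simp] theorem spin_zero_apply_zero (v : C2) : spin 0 v 0 = v 1 := by
  simp [spin_apply, pauli]
@[simp] theorem spin_zero_apply_one (v : C2) : spin 0 v 1 = v 0 := by
  simp [spin_apply, pauli]
@[simp] theorem spin_one_apply_zero (v : C2) : spin 1 v 0 = -Complex.I * v 1 := by
  simp [spin_apply, pauli]
@[simp] theorem spin_one_apply_one (v : C2) : spin 1 v 1 = Complex.I * v 0 := by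
  simp [spin_apply, pauli]
@[simp] theorem spin_two_apply_zero (v : C2) : spin 2 v 0 = v 0 := by
  simp [spin_apply, pauli]
@[simp] theorem spin_two_apply_one (v : C2) : spin 2 v 1 = - v 1 := by
  simp [spin_apply, pauli]

theorem inner_C2 (v w : C2) :
    ⟪v, w⟫_ℂ = (starRingEnd ℂ) (v 0) * w 0 + (starRingEnd ℂ) (v 1) * w 1 := by
  simp [PiLp.inner_apply, Fin.sum_univ_two, mul_comm]

theorem normSq_C2 (v : C2) :
    ‖v‖ ^ 2 = ((v 0).re ^ 2 + (v 0).im ^ 2) + ((v 1).re ^ 2 + (v 1).im ^ 2) := by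
  rw [EuclideanSpace.norm_sq_eq, Fin.sum_univ_two, ← Complex.normSq_eq_norm_sq,
    ← Complex.normSq_eq_norm_sq, Complex.normSq_apply, Complex.normSq_apply]
  ring

theorem spin_symm (j : Fin 3) (v w : C2) : ⟪spin j v, w⟫_ℂ = ⟪v, spin j w⟫_ℂ := by
  fin_cases j <;> simp [inner_C2] <;> ring

theorem norm_spin (j : Fin 3) (v : C2) : ‖spin j v‖ = ‖v‖ := by
  rw [← sq_eq_sq₀ (norm_nonneg _) (norm_nonneg _), normSq_C2, normSq_C2]
  fin_cases j <;> simp <;> ring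

/-- The pointwise Lichnerowicz identity. -/
theorem normSq_sum_spin (d : Fin 3 → C2) (p : C2) (a : Fin 3 → ℝ) :
    ‖∑ j, spin j ((1 / Complex.I) • d j + ((a j : ℝ) : ℂ) • p)‖ ^ 2 =
      ∑ j, ‖(1 / Complex.I) • d j + ((a j : ℝ) : ℂ) • p‖ ^ 2
      - ∑ l, (a (l + 2) * (2 * (⟪p, spin l (d (l + 1))⟫_ℂ).re)
          - a (l + 1) * (2 * (⟪p, spin l (d (l + 2))⟫_ℂ).re))
      + ∑ l, ((Complex.I * ⟪d (l + 1), spin l (d (l + 2))⟫_ℂ).re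
          - (Complex.I * ⟪d (l + 2), spin l (d (l + 1))⟫_ℂ).re) := by
  have e1 : (0 : Fin 3) + 1 = 1 := rfl
  have e2 : (0 : Fin 3) + 2 = 2 := rfl
  have e3 : (1 : Fin 3) + 1 = 2 := rfl
  have e4 : (1 : Fin 3) + 2 = 0 := rfl
  have e5 : (2 : Fin 3) + 1 = 0 := rfl
  have e6 : (2 : Fin 3) + 2 = 1 := rfl
  simp only [Fin.sum_univ_three, e1, e2, e3, e4, e5, e6, inner_C2, normSq_C2]
  simp
  ring

/-- The spin vector (⟪p, σ_l p⟫)_l has length exactly |p|², as for the Hopf map. -/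
theorem sum_sq_inner_spin (p : C2) : ∑ l, (⟪p, spin l p⟫_ℂ).re ^ 2 = (‖p‖ ^ 2) ^ 2 := by
  simp only [Fin.sum_univ_three, inner_C2, normSq_C2]
  simp
  ring

/-- Cauchy–Schwarz against the spin vector. The constant 1 is what lets the added potential |B|
absorb the term σ·B completely. -/
theorem abs_sum_mul_inner_spin_le (b : R3) (p : C2) :
    |∑ l, b l * (⟪p, spin l p⟫_ℂ).re| ≤ ‖b‖ * ‖p‖ ^ 2 := by
  apply abs_le_of_sq_le_sq _ (by positivity)
  refine (Finset.sum_mul_sq_le_sq_mul_sq _ _ _).trans_eq ?_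
  rw [sum_sq_inner_spin, mul_pow, EuclideanSpace.norm_sq_eq b]
  simp

/-! ### The magnetic identity -/

theorem normSq_toLp_two {F : Type*} [NormedAddCommGroup F] {f : R3 → F}
    (hf : MemLp f 2 (volume : Measure R3)) : ‖hf.toLp f‖ ^ 2 = ∫ x, ‖f x‖ ^ 2 := by
  rw [Lp.norm_toLp, hf.eLpNorm_eq_integral_rpow_norm two_ne_zero (by simp),
    ENNReal.toReal_ofReal (by positivity)]
  simp only [ENNReal.toReal_ofNat, Real.rpow_two]
  rw [← one_div, ← Real.sqrt_eq_rpow, Real.sq_sqrt (by positivity)]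

theorem integrable_inner_of_memLp {f g : R3 → C2} (hf : MemLp f 2 (volume : Measure R3))
    (hg : MemLp g 2 (volume : Measure R3)) : Integrable fun x => ⟪f x, g x⟫_ℂ := by
  refine (L2.integrable_inner (𝕜 := ℂ) (hf.toLp f) (hg.toLp g)).congr ?_
  filter_upwards [hf.coeFn_toLp, hg.coeFn_toLp] with x h1 h2
  rw [h1, h2]

theorem IsL2Loc.locallyIntegrable {A : R3 → R3} (hA : IsL2Loc A) (j : Fin 3) :
    LocallyIntegrable (fun x => A x j) volume := by
  rw [locallyIntegrable_iff]
  intro K hK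
  have : IsFiniteMeasure (volume.restrict K : Measure R3) :=
    ⟨by rw [Measure.restrict_apply_univ]; exact hK.measure_lt_top⟩
  have h1 : Integrable A (volume.restrict K) := (hA K hK).integrable (by norm_num)
  exact (EuclideanSpace.proj (𝕜 := ℝ) j).integrable_comp h1

theorem IsL32.locallyIntegrable {B : R3 → R3} (hB : IsL32 B) (j : Fin 3) :
    LocallyIntegrable (fun x => B x j) volume := by
  have h1 : LocallyIntegrable B volume := MemLp.locallyIntegrable hB (by
    rw [ENNReal.le_div_iff_mul_le (by simp) (by simp)]; norm_num)
  rw [locallyIntegrable_iff] at h1 ⊢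
  intro K hK
  exact (EuclideanSpace.proj (𝕜 := ℝ) j).integrable_comp (h1 K hK)

theorem integral_fderiv_eq_zero {h : R3 → ℂ} (hc : ContDiff ℝ 1 h) (hs : HasCompactSupport h)
    (v : R3) : ∫ x, fderiv ℝ h x v = 0 := by
  have hd : Continuous fun x => fderiv ℝ h x v :=
    (hc.continuous_fderiv one_ne_zero).clm_apply continuous_const
  have := integral_smul_fderiv_eq_neg_fderiv_smul_of_integrable (μ := (volume : Measure R3))
    (𝕜 := ℝ) (f := fun _ => (1 : ℝ)) (g := h) (v := v) (by simp)
    (by simpa using hd.integrable_of_hasCompactSupport (hs.fderiv_apply (𝕜 := ℝ) v))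
    (by simpa using hc.continuous.integrable_of_hasCompactSupport hs)
    (by simp) (fun x _ => hc.differentiable one_ne_zero x)
  simpa using this

theorem integrable_inner_of_compactSupport {f g : R3 → C2} (hf : Continuous f) (hg : Continuous g)
    (hs : HasCompactSupport g) : Integrable fun x => ⟪f x, g x⟫_ℂ := by
  refine (hf.inner hg).integrable_of_hasCompactSupport ?_
  exact hs.mono' (fun x hx => subset_tsupport _ fun h => hx (by simp [h]))

theorem integral_inner_fderiv {f g : R3 → C2} (hf : ContDiff ℝ 1 f) (hg : ContDiff ℝ 1 g)
    (hs : HasCompactSupport g) (v : R3) :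
    ∫ x, ⟪f x, fderiv ℝ g x v⟫_ℂ = - ∫ x, ⟪fderiv ℝ f x v, g x⟫_ℂ := by
  have h0 := integral_fderiv_eq_zero (hf.inner ℂ hg)
    (hs.mono' (fun x hx => subset_tsupport _ fun h => hx (by simp [h]))) v
  have hf' : Continuous fun x => fderiv ℝ f x v :=
    (hf.continuous_fderiv one_ne_zero).clm_apply continuous_const
  have hg' : Continuous fun x => fderiv ℝ g x v :=
    (hg.continuous_fderiv one_ne_zero).clm_apply continuous_const
  simp_rw [fun x => fderiv_inner_apply ℂ (hf.differentiable one_ne_zero x)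
    (hg.differentiable one_ne_zero x) v] at h0
  rw [integral_add (integrable_inner_of_compactSupport hf.continuous hg'
    (hs.fderiv_apply (𝕜 := ℝ) v)) (integrable_inner_of_compactSupport hf' hg.continuous hs)] at h0
  exact eq_neg_of_add_eq_zero_left h0

/-- The partial derivative of a test spinor. -/
def partialD (φ : TestSpinor) (j : Fin 3) (x : R3) : C2 := fderiv ℝ φ x (basisVec j)

theorem contDiff_partialD (φ : TestSpinor) (j : Fin 3) : ContDiff ℝ 1 (partialD φ j) :=
  ((φ.contDiff.fderiv_right (m := 1) (by norm_cast)).clm_apply contDiff_const)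

theorem hasCompactSupport_partialD (φ : TestSpinor) (j : Fin 3) :
    HasCompactSupport (partialD φ j) :=
  φ.hasCompactSupport.fderiv_apply (𝕜 := ℝ) _

theorem TestSpinor.contDiff_one (φ : TestSpinor) : ContDiff ℝ 1 φ :=
  φ.contDiff.of_le (by norm_cast)

theorem fderiv_partialD_comm (φ : TestSpinor) (j k : Fin 3) (x : R3) :
    fderiv ℝ (partialD φ k) x (basisVec j) = fderiv ℝ (partialD φ j) x (basisVec k) := by
  have h2 : ContDiff ℝ 2 φ := φ.contDiff.of_le (by norm_cast)
  have hd : DifferentiableAt ℝ (fderiv ℝ φ) x :=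
    (h2.fderiv_right (m := 1) (by norm_num)).differentiable one_ne_zero x
  have hs : IsSymmSndFDerivAt ℝ φ x := h2.contDiffAt.isSymmSndFDerivAt (by simp)
  have e : ∀ k j, fderiv ℝ (partialD φ k) x (basisVec j)
      = fderiv ℝ (fderiv ℝ φ) x (basisVec j) (basisVec k) := by
    intro k j
    unfold partialD
    rw [fderiv_clm_apply hd (differentiableAt_const _)]
    simp
  rw [e, e, hs.eq]

theorem fderiv_spin_comp {g : R3 → C2} (hg : ContDiff ℝ 1 g) (l : Fin 3) (x v : R3) :
    fderiv ℝ (fun y => spin l (g y)) x v = spin l (fderiv ℝ g x v) := by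
  have := ((spin l).restrictScalars ℝ).hasFDerivAt.comp x
    (hg.differentiable one_ne_zero x).hasFDerivAt
  change HasFDerivAt (fun y => spin l (g y)) _ x at this
  rw [this.fderiv]
  rfl

theorem contDiff_spin_comp {g : R3 → C2} {n : WithTop ℕ∞} (hg : ContDiff ℝ n g) (l : Fin 3) :
    ContDiff ℝ n (fun y => spin l (g y)) :=
  ((spin l).restrictScalars ℝ).contDiff.comp hg

theorem hasCompactSupport_spin_comp {g : R3 → C2} (hg : HasCompactSupport g) (l : Fin 3) :
    HasCompactSupport (fun y => spin l (g y)) :=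
  hg.comp_left (map_zero (spin l))

/-- Both sides equal -∫⟪φ, σ_l ∂_j∂_k φ⟫, since second derivatives commute. This removes the terms
of the Lichnerowicz identity that are quadratic in ∇φ and antisymmetric. -/
theorem integral_nullLagrangian (φ : TestSpinor) (j k l : Fin 3) :
    ∫ x, ⟪partialD φ j x, spin l (partialD φ k x)⟫_ℂ =
      ∫ x, ⟪partialD φ k x, spin l (partialD φ j x)⟫_ℂ := by
  have key : ∀ j k, ∫ x, ⟪partialD φ j x, spin l (partialD φ k x)⟫_ℂ =
      - ∫ x, ⟪φ x, spin l (fderiv ℝ (partialD φ k) x (basisVec j))⟫_ℂ := by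
    intro j k
    have h := integral_inner_fderiv φ.contDiff_one (contDiff_spin_comp (contDiff_partialD φ k) l)
      (hasCompactSupport_spin_comp (hasCompactSupport_partialD φ k) l) (basisVec j)
    simp_rw [fderiv_spin_comp (contDiff_partialD φ k)] at h
    rw [h, neg_neg]
    rfl
  rw [key, key]
  simp_rw [fderiv_partialD_comm φ j k]

/-- The spin density `⟨φ, σ_l φ⟩`. -/
def spinDensity (φ : TestSpinor) (l : Fin 3) : 𝓓((⊤ : TopologicalSpace.Opens R3), ℝ) where
  toFun x := (⟪φ x, spin l (φ x)⟫_ℂ).re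
  contDiff' := Complex.reCLM.contDiff.comp (φ.contDiff.inner ℂ (contDiff_spin_comp φ.contDiff l))
  hasCompactSupport' := φ.hasCompactSupport.mono'
    (fun x hx => subset_tsupport _ fun h => hx (by simp [h]))
  tsupport_subset' := fun _ _ => trivial

/-- As σ_l is symmetric, the two product-rule terms are conjugate. The terms of `normSq_sum_spin`
linear in A thereby become derivatives of a test function, to which `IsWeakCurl` applies. -/
theorem fderiv_spinDensity (φ : TestSpinor) (l j : Fin 3) (x : R3) :
    fderiv ℝ (spinDensity φ l) x (basisVec j) = 2 * (⟪φ x, spin l (partialD φ j x)⟫_ℂ).re := by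
  have hs := contDiff_spin_comp φ.contDiff_one l
  have h1 : DifferentiableAt ℝ (fun y => ⟪φ y, spin l (φ y)⟫_ℂ) x :=
    (φ.contDiff_one.inner ℂ hs).differentiable one_ne_zero x
  have h2 := Complex.reCLM.hasFDerivAt.comp x h1.hasFDerivAt
  change HasFDerivAt (fun y => spinDensity φ l y) _ x at h2
  rw [show (⇑(spinDensity φ l)) = fun y => spinDensity φ l y from rfl, h2.fderiv,
    ContinuousLinearMap.comp_apply, fderiv_inner_apply ℂ (φ.contDiff_one.differentiable one_ne_zero x)
    (hs.differentiable one_ne_zero x), fderiv_spin_comp φ.contDiff_one,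
    Complex.reCLM_apply, Complex.add_re]
  have h3 : (⟪fderiv ℝ φ x (basisVec j), spin l (φ x)⟫_ℂ).re
      = (⟪φ x, spin l (fderiv ℝ φ x (basisVec j))⟫_ℂ).re := by
    rw [← inner_conj_symm, Complex.conj_re, spin_symm]
  rw [h3, partialD]
  ring

/-- The components `(1/i) ∂_j + A_j` of the magnetic momentum. -/
def momentum (A : R3 → R3) (φ : TestSpinor) (j : Fin 3) (x : R3) : C2 :=
  (1 / Complex.I) • partialD φ j x + ((A x j : ℝ) : ℂ) • φ x

theorem memLp_component_smul {A : R3 → R3} (hA : IsL2Loc A) (φ : TestSpinor) (j : Fin 3) :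
    MemLp (fun x => ((A x j : ℝ) : ℂ) • φ x) 2 (volume : Measure R3) := by
  refine memLp_smul_of_locally (fun K hK => ?_) φ
  have hm : AEStronglyMeasurable (fun x => ((A x j : ℝ) : ℂ)) (volume.restrict K) :=
    (Complex.continuous_ofReal.comp (EuclideanSpace.proj (𝕜 := ℝ) j).continuous
      ).comp_aestronglyMeasurable (hA K hK).aestronglyMeasurable
  refine (hA K hK).of_le hm (Eventually.of_forall fun x => ?_)
  rw [Complex.norm_real]
  exact PiLp.norm_apply_le (A x) j

theorem memLp_momentum {A : R3 → R3} (hA : IsL2Loc A) (φ : TestSpinor) (j : Fin 3) :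
    MemLp (momentum A φ j) 2 (volume : Measure R3) :=
  ((memLp_fderiv_testSpinor φ (basisVec j)).const_smul (1 / Complex.I)).add
    (memLp_component_smul hA φ j)

theorem integrable_curlTerm {A : R3 → R3} (hA : IsL2Loc A)
    (η : 𝓓((⊤ : TopologicalSpace.Opens R3), ℝ)) (i : Fin 3) (v : R3) :
    Integrable fun x => A x i * fderiv ℝ η x v := by
  have hc : Continuous (fun x => fderiv ℝ η x v) :=
    (η.contDiff.continuous_fderiv (by simp)).clm_apply continuous_const
  have := (hA.locallyIntegrable i).integrable_smul_right_of_hasCompactSupport hc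
    (η.hasCompactSupport.fderiv_apply (𝕜 := ℝ) v)
  simpa [mul_comm] using this

theorem integrable_field_mul {B : R3 → R3} (hB : IsL32 B)
    (η : 𝓓((⊤ : TopologicalSpace.Opens R3), ℝ)) (i : Fin 3) :
    Integrable fun x => B x i * η x := by
  have := (hB.locallyIntegrable i).integrable_smul_right_of_hasCompactSupport η.continuous
    η.hasCompactSupport
  simpa [mul_comm] using this

/-- The integrated Lichnerowicz identity `‖σ·(p + A)φ‖² = ‖(p + A)φ‖² + (σ·B φ, φ)`. -/
theorem normSq_weylDirac {A B : R3 → R3} (hA : IsL2Loc A) (hB : IsL32 B) (hcurl : IsWeakCurl A B)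
    (φ : TestSpinor) :
    ‖weylDirac hA φ‖ ^ 2 = (∑ j, ∫ x, ‖momentum A φ j x‖ ^ 2)
      + ∫ x, ∑ l, B x l * (⟪φ x, spin l (φ x)⟫_ℂ).re := by
  have e1 : ‖weylDirac hA φ‖ ^ 2 = ∫ x, ‖weylDiracFun A φ x‖ ^ 2 :=
    normSq_toLp_two (memLp_weylDiracFun hA φ)
  have hpt : ∀ x, ‖weylDiracFun A φ x‖ ^ 2 = ∑ j, ‖momentum A φ j x‖ ^ 2
      - ∑ l, (A x (l + 2) * fderiv ℝ (spinDensity φ l) x (basisVec (l + 1))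
          - A x (l + 1) * fderiv ℝ (spinDensity φ l) x (basisVec (l + 2)))
      + ∑ l, ((Complex.I * ⟪partialD φ (l + 1) x, spin l (partialD φ (l + 2) x)⟫_ℂ).re
          - (Complex.I * ⟪partialD φ (l + 2) x, spin l (partialD φ (l + 1) x)⟫_ℂ).re) := by
    intro x
    simp_rw [fderiv_spinDensity]
    exact normSq_sum_spin (fun j => partialD φ j x) (φ x) (fun j => A x j)
  have i1 : ∀ j, Integrable fun x => ‖momentum A φ j x‖ ^ 2 := fun j =>
    (memLp_momentum hA φ j).integrable_norm_pow two_ne_zero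
  have i2 : ∀ l : Fin 3, Integrable fun x =>
      A x (l + 2) * fderiv ℝ (spinDensity φ l) x (basisVec (l + 1))
          - A x (l + 1) * fderiv ℝ (spinDensity φ l) x (basisVec (l + 2)) := fun l =>
    (integrable_curlTerm hA _ _ _).sub (integrable_curlTerm hA _ _ _)
  have i3 : ∀ j k l, Integrable fun x =>
      (Complex.I * ⟪partialD φ j x, spin l (partialD φ k x)⟫_ℂ) := fun j k l =>
    (integrable_inner_of_compactSupport (contDiff_partialD φ j).continuous
      (contDiff_spin_comp (contDiff_partialD φ k) l).continuous
      (hasCompactSupport_spin_comp (hasCompactSupport_partialD φ k) l)).const_mul _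
  have i3' : ∀ j k l, Integrable fun x =>
      (Complex.I * ⟪partialD φ j x, spin l (partialD φ k x)⟫_ℂ).re := fun j k l => (i3 j k l).re
  have i4 : ∀ l : Fin 3, Integrable fun x =>
      (Complex.I * ⟪partialD φ (l + 1) x, spin l (partialD φ (l + 2) x)⟫_ℂ).re
          - (Complex.I * ⟪partialD φ (l + 2) x, spin l (partialD φ (l + 1) x)⟫_ℂ).re := fun l =>
    (i3' _ _ l).sub (i3' _ _ l)
  have e3 : ∀ j k l, ∫ x, (Complex.I * ⟪partialD φ j x, spin l (partialD φ k x)⟫_ℂ).re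
      = (Complex.I * ∫ x, ⟪partialD φ j x, spin l (partialD φ k x)⟫_ℂ).re := by
    intro j k l
    rw [← integral_const_mul]
    exact integral_re (i3 j k l)
  rw [e1]
  simp_rw [hpt]
  rw [integral_add, integral_sub, integral_finsetSum _ fun j _ => i1 j,
    integral_finsetSum _ fun l _ => i2 l, integral_finsetSum _ fun l _ => i4 l, integral_finsetSum _ fun l _ => ?_]
  · have e4 : ∀ l : Fin 3, ∫ x, ((Complex.I * ⟪partialD φ (l + 1) x, spin l (partialD φ (l + 2) x)⟫_ℂ).re
          - (Complex.I * ⟪partialD φ (l + 2) x, spin l (partialD φ (l + 1) x)⟫_ℂ).re) = 0 := by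
      intro l
      rw [integral_sub (i3' _ _ l) (i3' _ _ l), e3, e3, integral_nullLagrangian, sub_self]
    -- The distributional curl is tested, component by component, against the spin density.
    have e5 : ∀ l : Fin 3, ∫ x, B x l * (⟪φ x, spin l (φ x)⟫_ℂ).re = _ :=
      fun l => hcurl (spinDensity φ l) l
    simp_rw [e4, e5, Finset.sum_neg_distrib]
    simp
    ring
  · exact integrable_field_mul hB (spinDensity φ l) l
  · exact integrable_finsetSum _ fun j _ => i1 j
  · exact integrable_finsetSum _ fun l _ => i2 l
  · exact (integrable_finsetSum _ fun j _ => i1 j).sub (integrable_finsetSum _ fun l _ => i2 l)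
  · exact integrable_finsetSum _ fun l _ => i4 l

/-- The term (σ·B φ, φ) is at least -∫|B||φ|², and b compensates this loss exactly. -/
theorem sum_normSq_momentum_le {A B : R3 → R3} (hA : IsL2Loc A) (hB : IsL32 B)
    (hcurl : IsWeakCurl A B) (φ : TestSpinor) :
    ∑ j, ∫ x, ‖momentum A φ j x‖ ^ 2 ≤ ‖weylDirac hA φ‖ ^ 2 + ‖sqrtFieldMul hB φ‖ ^ 2 := by
  have e2 : ‖sqrtFieldMul hB φ‖ ^ 2 = ∫ x, ‖B x‖ * ‖φ x‖ ^ 2 := by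
    have := normSq_toLp_two (memLp_sqrt_smul hB φ)
    simp only [norm_smul, mul_pow, Complex.norm_real, Real.norm_eq_abs, sq_abs,
      Real.sq_sqrt (norm_nonneg _)] at this
    exact this
  have hi : Integrable fun x => ‖B x‖ * ‖φ x‖ ^ 2 := by
    have := (memLp_sqrt_smul hB φ).integrable_norm_pow two_ne_zero
    simpa only [norm_smul, mul_pow, Complex.norm_real, Real.norm_eq_abs, sq_abs,
      Real.sq_sqrt (norm_nonneg _)] using this
  have hlow : -‖sqrtFieldMul hB φ‖ ^ 2 ≤ ∫ x, ∑ l, B x l * (⟪φ x, spin l (φ x)⟫_ℂ).re := by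
    rw [e2, ← integral_neg]
    refine integral_mono hi.neg
      (integrable_finsetSum _ fun l _ => integrable_field_mul hB (spinDensity φ l) l) fun x => ?_
    exact (abs_le.1 (abs_sum_mul_inner_spin_le (B x) (φ x))).1
  have := normSq_weylDirac hA hB hcurl φ
  linarith

/-- The Weyl-Dirac operator is symmetric on test spinors. -/
theorem inner_weylDirac_comm {A : R3 → R3} (hA : IsL2Loc A) (φ ψ : TestSpinor) :
    ⟪weylDirac hA ψ, testToL2 φ⟫_ℂ = ⟪testToL2 ψ, weylDirac hA φ⟫_ℂ := by
  have e1 : ⟪weylDirac hA ψ, testToL2 φ⟫_ℂ = ∫ x, ⟪weylDiracFun A ψ x, φ x⟫_ℂ := by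
    rw [L2.inner_def]
    refine integral_congr_ae ?_
    filter_upwards [(memLp_weylDiracFun hA ψ).coeFn_toLp, (memLp_testSpinor φ 2).coeFn_toLp]
      with x h1 h2
    exact congrArg₂ _ h1 h2
  have e2 : ⟪testToL2 ψ, weylDirac hA φ⟫_ℂ = ∫ x, ⟪ψ x, weylDiracFun A φ x⟫_ℂ := by
    rw [L2.inner_def]
    refine integral_congr_ae ?_
    filter_upwards [(memLp_weylDiracFun hA φ).coeFn_toLp, (memLp_testSpinor ψ 2).coeFn_toLp]
      with x h1 h2
    exact congrArg₂ _ h2 h1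
  have i1 : Integrable fun x => ⟪weylDiracFun A ψ x, φ x⟫_ℂ :=
    integrable_inner_of_memLp (memLp_weylDiracFun hA ψ) (memLp_testSpinor φ 2)
  have i2 : Integrable fun x => ⟪ψ x, weylDiracFun A φ x⟫_ℂ :=
    integrable_inner_of_memLp (memLp_testSpinor ψ 2) (memLp_weylDiracFun hA φ)
  rw [e1, e2, ← sub_eq_zero, ← integral_sub i1 i2]
  have hpt : ∀ x, ⟪weylDiracFun A ψ x, φ x⟫_ℂ - ⟪ψ x, weylDiracFun A φ x⟫_ℂ =
      ∑ j, (Complex.I * ⟪partialD ψ j x, spin j (φ x)⟫_ℂ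
        + Complex.I * ⟪ψ x, spin j (partialD φ j x)⟫_ℂ) := by
    intro x
    change ⟪∑ j, spin j ((1 / Complex.I) • partialD ψ j x + ((A x j : ℝ) : ℂ) • ψ x), φ x⟫_ℂ
      - ⟪ψ x, ∑ j, spin j ((1 / Complex.I) • partialD φ j x + ((A x j : ℝ) : ℂ) • φ x)⟫_ℂ = _
    rw [sum_inner, inner_sum, ← Finset.sum_sub_distrib]
    refine Finset.sum_congr rfl fun j _ => ?_
    rw [spin_symm, inner_add_left, map_add, inner_add_right, inner_smul_left, inner_smul_left,
      map_smul, map_smul, inner_smul_right, inner_smul_right]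
    simp
  have j1 : ∀ j, Integrable fun x => Complex.I * ⟪partialD ψ j x, spin j (φ x)⟫_ℂ := fun j =>
    (integrable_inner_of_compactSupport (contDiff_partialD ψ j).continuous
      (contDiff_spin_comp φ.contDiff_one j).continuous
      (hasCompactSupport_spin_comp φ.hasCompactSupport j)).const_mul _
  have j2 : ∀ j, Integrable fun x => Complex.I * ⟪ψ x, spin j (partialD φ j x)⟫_ℂ := fun j =>
    (integrable_inner_of_compactSupport ψ.continuous
      (contDiff_spin_comp (contDiff_partialD φ j) j).continuous
      (hasCompactSupport_spin_comp (hasCompactSupport_partialD φ j) j)).const_mul _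
  have j3 : ∀ j, Integrable fun x => (Complex.I * ⟪partialD ψ j x, spin j (φ x)⟫_ℂ
      + Complex.I * ⟪ψ x, spin j (partialD φ j x)⟫_ℂ) := fun j => (j1 j).add (j2 j)
  simp_rw [hpt]
  rw [integral_finsetSum _ fun j _ => j3 j]
  refine Finset.sum_eq_zero fun j _ => ?_
  have h := integral_inner_fderiv ψ.contDiff_one (contDiff_spin_comp φ.contDiff_one j)
    (hasCompactSupport_spin_comp φ.hasCompactSupport j) (basisVec j)
  simp_rw [fderiv_spin_comp φ.contDiff_one] at h
  rw [integral_add (j1 j) (j2 j), integral_const_mul, integral_const_mul]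
  change ∫ x, ⟪ψ x, spin j (partialD φ j x)⟫_ℂ = - ∫ x, ⟪partialD ψ j x, spin j (φ x)⟫_ℂ at h
  rw [h]
  ring

theorem inner_sqrtFieldMul_comm {B : R3 → R3} (hB : IsL32 B) (φ ψ : TestSpinor) :
    ⟪sqrtFieldMul hB ψ, testToL2 φ⟫_ℂ = ⟪testToL2 ψ, sqrtFieldMul hB φ⟫_ℂ := by
  rw [L2.inner_def, L2.inner_def]
  refine integral_congr_ae ?_
  filter_upwards [(memLp_sqrt_smul hB ψ).coeFn_toLp, (memLp_testSpinor φ 2).coeFn_toLp,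
    (memLp_sqrt_smul hB φ).coeFn_toLp, (memLp_testSpinor ψ 2).coeFn_toLp] with x h1 h2 h3 h4
  refine (congrArg₂ _ h1 h2).trans (Eq.trans ?_ (congrArg₂ _ h4 h3).symm)
  rw [inner_smul_left, inner_smul_right, Complex.conj_ofReal]

/-! ### The Sobolev inequality for the magnetic form -/

/-- The square root of the quadratic form `p = p_A + b`. -/
def energy {A B : R3 → R3} (hA : IsL2Loc A) (hB : IsL32 B) (φ : TestSpinor) : ℝ :=
  √(‖weylDirac hA φ‖ ^ 2 + ‖sqrtFieldMul hB φ‖ ^ 2)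

theorem energy_nonneg {A B : R3 → R3} (hA : IsL2Loc A) (hB : IsL32 B) (φ : TestSpinor) :
    0 ≤ energy hA hB φ := Real.sqrt_nonneg _

/-- The smooth approximation `√(|φ|² + δ²) - δ` of `|φ|`. -/
def smoothAbs (δ : ℝ) (φ : TestSpinor) (x : R3) : ℝ := √((⟪φ x, φ x⟫_ℂ).re + δ ^ 2) - δ

theorem smoothAbs_pos {δ : ℝ} (hδ : 0 < δ) (φ : TestSpinor) (x : R3) :
    0 < (⟪φ x, φ x⟫_ℂ).re + δ ^ 2 :=
  add_pos_of_nonneg_of_pos (inner_self_nonneg (𝕜 := ℂ) (x := φ x)) (by positivity)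

theorem contDiff_smoothAbs {δ : ℝ} (hδ : 0 < δ) (φ : TestSpinor) :
    ContDiff ℝ 1 (smoothAbs δ φ) := by
  unfold smoothAbs
  refine ContDiff.sub (ContDiff.sqrt (ContDiff.add ?_ contDiff_const)
    fun x => (smoothAbs_pos hδ φ x).ne') contDiff_const
  exact Complex.reCLM.contDiff.comp (φ.contDiff_one.inner ℂ φ.contDiff_one)

theorem hasCompactSupport_smoothAbs {δ : ℝ} (hδ : 0 < δ) (φ : TestSpinor) :
    HasCompactSupport (smoothAbs δ φ) := by
  refine φ.hasCompactSupport.mono' fun x hx => subset_tsupport _ fun h => hx ?_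
  simp [smoothAbs, h, Real.sqrt_sq hδ.le]

theorem partialD_eq_momentum (A : R3 → R3) (φ : TestSpinor) (j : Fin 3) (x : R3) :
    partialD φ j x = Complex.I • momentum A φ j x - (Complex.I * (A x j : ℂ)) • φ x := by
  rw [momentum, smul_add, smul_smul, smul_smul]
  simp

/-- The diamagnetic inequality: A_j contributes only an imaginary part to ⟪φ, ∂_jφ⟫, so ∂_jφ may be
replaced by i times the momentum. What remains is multiplied by a factor |φ|/√(|φ|² + δ²) ≤ 1. -/
theorem abs_fderiv_smoothAbs_le {δ : ℝ} (hδ : 0 < δ) (A : R3 → R3) (φ : TestSpinor) (j : Fin 3)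
    (x : R3) : |fderiv ℝ (smoothAbs δ φ) x (basisVec j)| ≤ ‖momentum A φ j x‖ := by
  have hpos := smoothAbs_pos hδ φ x
  have h1 : DifferentiableAt ℝ (fun y => ⟪φ y, φ y⟫_ℂ) x :=
    (φ.contDiff_one.inner ℂ φ.contDiff_one).differentiable one_ne_zero x
  have h2 : HasFDerivAt (fun y => (⟪φ y, φ y⟫_ℂ).re + δ ^ 2) _ x :=
    (Complex.reCLM.hasFDerivAt.comp x h1.hasFDerivAt).add_const (δ ^ 2)
  have h3 : HasFDerivAt (smoothAbs δ φ) _ x := (h2.sqrt hpos.ne').sub_const δ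
  have hd := φ.contDiff_one.differentiable one_ne_zero x
  rw [h3.fderiv, smul_apply, ContinuousLinearMap.comp_apply, fderiv_inner_apply ℂ hd hd,
    Complex.reCLM_apply, Complex.add_re]
  change |(1 / (2 * √((⟪φ x, φ x⟫_ℂ).re + δ ^ 2))) •
    ((⟪φ x, partialD φ j x⟫_ℂ).re + (⟪partialD φ j x, φ x⟫_ℂ).re)| ≤ _
  have h4 : (⟪partialD φ j x, φ x⟫_ℂ).re = (⟪φ x, partialD φ j x⟫_ℂ).re := by
    rw [← inner_conj_symm, Complex.conj_re]
  have h5 : (⟪φ x, partialD φ j x⟫_ℂ).re = (⟪φ x, Complex.I • momentum A φ j x⟫_ℂ).re := by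
    rw [partialD_eq_momentum A, inner_sub_right, inner_smul_right (φ x) (φ x),
      inner_self_eq_norm_sq_to_K, Complex.sub_re, sub_eq_self]
    simp [← Complex.ofReal_pow]
  have h6 : |(⟪φ x, partialD φ j x⟫_ℂ).re| ≤ ‖φ x‖ * ‖momentum A φ j x‖ := by
    rw [h5]
    refine (Complex.abs_re_le_norm _).trans ((norm_inner_le_norm _ _).trans_eq ?_)
    rw [norm_smul, Complex.norm_I, one_mul]
  have h7 : ‖φ x‖ ≤ √((⟪φ x, φ x⟫_ℂ).re + δ ^ 2) := by
    apply Real.le_sqrt_of_sq_le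
    have := norm_sq_eq_re_inner (𝕜 := ℂ) (φ x)
    simp only [RCLike.re_to_complex] at this
    rw [this]; nlinarith [sq_nonneg δ]
  have h8 : 0 < √((⟪φ x, φ x⟫_ℂ).re + δ ^ 2) := Real.sqrt_pos.2 hpos
  rw [h4, ← two_mul, smul_eq_mul, abs_mul, abs_mul, abs_of_pos (by positivity : (0:ℝ) < 1 / (2 * _)),
    abs_two, show 1 / (2 * √((⟪φ x, φ x⟫_ℂ).re + δ ^ 2)) * (2 * |(⟪φ x, partialD φ j x⟫_ℂ).re|)
      = |(⟪φ x, partialD φ j x⟫_ℂ).re| / √((⟪φ x, φ x⟫_ℂ).re + δ ^ 2) by field_simp,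
    div_le_iff₀ h8]
  refine h6.trans ?_
  rw [mul_comm]
  exact mul_le_mul_of_nonneg_left h7 (norm_nonneg _)

theorem sum_basisVec (v : R3) : v = ∑ j, v j • basisVec j := by
  have := (EuclideanSpace.basisFun (Fin 3) ℝ).sum_repr v
  simpa [basisVec] using this.symm

theorem norm_le_sqrt_sum_basisVec (L : R3 →L[ℝ] ℝ) : ‖L‖ ^ 2 ≤ ∑ j, |L (basisVec j)| ^ 2 := by
  have h : ‖L‖ ≤ √(∑ j, |L (basisVec j)| ^ 2) := by
    refine L.opNorm_le_bound (Real.sqrt_nonneg _) fun v => ?_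
    have hv : L v = ∑ j, v j * L (basisVec j) := by
      conv_lhs => rw [sum_basisVec v, map_sum]
      simp
    rw [hv, Real.norm_eq_abs]
    apply abs_le_of_sq_le_sq _ (by positivity)
    refine (Finset.sum_mul_sq_le_sq_mul_sq _ _ _).trans_eq ?_
    rw [mul_pow, Real.sq_sqrt (by positivity), EuclideanSpace.norm_sq_eq v]
    simp [mul_comm]
  calc ‖L‖ ^ 2 ≤ √(∑ j, |L (basisVec j)| ^ 2) ^ 2 := by gcongr
    _ = _ := Real.sq_sqrt (by positivity)

theorem eLpNorm_fderiv_smoothAbs_le {A B : R3 → R3} (hA : IsL2Loc A) (hB : IsL32 B)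
    (hcurl : IsWeakCurl A B) {δ : ℝ} (hδ : 0 < δ) (φ : TestSpinor) :
    eLpNorm (fderiv ℝ (smoothAbs δ φ)) 2 (volume : Measure R3)
      ≤ ENNReal.ofReal (energy hA hB φ) := by
  have hm : MemLp (fderiv ℝ (smoothAbs δ φ)) 2 (volume : Measure R3) :=
    ((contDiff_smoothAbs hδ φ).continuous_fderiv one_ne_zero).memLp_of_hasCompactSupport
      ((hasCompactSupport_smoothAbs hδ φ).fderiv (𝕜 := ℝ))
  have i1 : ∀ j, Integrable fun x => ‖momentum A φ j x‖ ^ 2 := fun j =>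
    (memLp_momentum hA φ j).integrable_norm_pow two_ne_zero
  rw [← ENNReal.ofReal_toReal hm.eLpNorm_ne_top]
  apply ENNReal.ofReal_le_ofReal
  rw [← Lp.norm_toLp _ hm]
  refine Real.le_sqrt_of_sq_le ?_
  rw [normSq_toLp_two]
  refine le_trans ?_ (sum_normSq_momentum_le hA hB hcurl φ)
  rw [← integral_finsetSum _ fun j _ => i1 j]
  refine integral_mono (hm.integrable_norm_pow two_ne_zero)
    (integrable_finsetSum _ fun j _ => i1 j) fun x => ?_
  refine (norm_le_sqrt_sum_basisVec _).trans (Finset.sum_le_sum fun j _ => ?_)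
  have := abs_fderiv_smoothAbs_le hδ A φ j x
  gcongr

theorem tendsto_smoothAbs (φ : TestSpinor) (x : R3) :
    Tendsto (fun n : ℕ => smoothAbs (1 / ((n : ℝ) + 1)) φ x) atTop (𝓝 ‖φ x‖) := by
  have h0 : Tendsto (fun n : ℕ => 1 / ((n : ℝ) + 1)) atTop (𝓝 0) :=
    tendsto_one_div_add_atTop_nhds_zero_nat
  have hc : Continuous fun δ : ℝ => √((⟪φ x, φ x⟫_ℂ).re + δ ^ 2) - δ := by fun_prop
  have := (hc.tendsto 0).comp h0
  have e : √((⟪φ x, φ x⟫_ℂ).re + 0 ^ 2) - 0 = ‖φ x‖ := by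
    have := norm_sq_eq_re_inner (𝕜 := ℂ) (φ x)
    simp only [RCLike.re_to_complex] at this
    rw [← this]; simp
  rw [e] at this
  exact this

/-- The inclusion of the test spinors in `[L⁶(ℝ³)]²`. -/
def testToL6 : TestSpinor →ₗ[ℂ] L6Spinor where
  toFun φ := (memLp_testSpinor φ 6).toLp φ
  map_add' _ _ := rfl
  map_smul' _ _ := rfl

/-- Sobolev's inequality in dimension three for the smooth approximations of |φ|, whose gradients
are bounded by the energy uniformly in δ, then Fatou as δ → 0. The constant does not depend on A or
B. -/
theorem exists_norm_testToL6_le :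
    ∃ C : ℝ, 0 < C ∧ ∀ (A B : R3 → R3) (hA : IsL2Loc A) (hB : IsL32 B), IsWeakCurl A B →
      ∀ φ, ‖testToL6 φ‖ ≤ C * energy hA hB φ := by
  obtain ⟨C, hC⟩ : ∃ C : NNReal, ∀ u : R3 → ℝ, ContDiff ℝ 1 u → HasCompactSupport u →
      eLpNorm u 6 (volume : Measure R3) ≤ C * eLpNorm (fderiv ℝ u) 2 (volume : Measure R3) := by
    refine ⟨eLpNormLESNormFDerivOfEqInnerConst (volume : Measure R3) (2 : NNReal),
      fun u h1 h2 => ?_⟩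
    have := eLpNorm_le_eLpNorm_fderiv_of_eq_inner (volume : Measure R3) (p := 2) (p' := 6) h1 h2
      (by norm_num) (by simp) (by simp; norm_num)
    exact_mod_cast this
  -- The added 1 only makes the constant strictly positive, for later divisions.
  refine ⟨C + 1, by positivity, fun A B hA hB hcurl φ => ?_⟩
  have hE := energy_nonneg hA hB φ
  have key : eLpNorm φ 6 (volume : Measure R3) ≤ C * ENNReal.ofReal (energy hA hB φ) := by
    rw [← eLpNorm_norm]
    refine (Lp.eLpNorm_lim_le_liminf_eLpNorm
      (f := fun (n : ℕ) x => smoothAbs (1 / ((n : ℝ) + 1)) φ x)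
      (fun n => (contDiff_smoothAbs (by positivity) φ).continuous.aestronglyMeasurable) _
      (Eventually.of_forall fun x => tendsto_smoothAbs φ x)).trans ?_
    refine (Filter.liminf_le_liminf (Eventually.of_forall fun n => ?_)).trans
      (Filter.liminf_const (C * ENNReal.ofReal (energy hA hB φ))).le
    refine (hC _ (contDiff_smoothAbs (by positivity) φ)
      (hasCompactSupport_smoothAbs (by positivity) φ)).trans ?_
    gcongr
    exact eLpNorm_fderiv_smoothAbs_le hA hB hcurl (by positivity) φ
  have e : ‖testToL6 φ‖ = (eLpNorm φ 6 (volume : Measure R3)).toReal :=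
    Lp.norm_toLp _ (memLp_testSpinor φ 6)
  rw [e]
  refine (ENNReal.toReal_mono (by finiteness) key).trans ?_
  rw [ENNReal.toReal_mul, ENNReal.toReal_ofReal hE, ENNReal.coe_toReal]
  exact mul_le_mul_of_nonneg_right (by simp) hE

/-! ### Multiplication by `L³` functions -/

instance holderTriple_three_six_two : ENNReal.HolderTriple 3 6 2 where
  inv_add_inv_eq_inv := by
    rw [← ENNReal.toReal_eq_toReal_iff' (by simp) (by simp), ENNReal.toReal_add (by simp) (by simp)]
    simp
    norm_num

instance factOneLeThree : Fact ((1 : ℝ≥0∞) ≤ 3) := ⟨by norm_num⟩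

/-- Multiplication by an `L³` function, as an operator from `L⁶` to `L²`. -/
def mulL3 {V : R3 → ℂ} (hV : MemLp V 3 (volume : Measure R3)) : L6Spinor →L[ℂ] L2Spinor :=
  (ContinuousLinearMap.lsmul ℂ ℂ : ℂ →L[ℂ] C2 →L[ℂ] C2).holderL volume 3 6 2 (hV.toLp V)

theorem coeFn_mulL3 {V : R3 → ℂ} (hV : MemLp V 3 (volume : Measure R3)) (u : L6Spinor) :
    mulL3 hV u =ᵐ[volume] fun x => V x • u x := by
  filter_upwards [ContinuousLinearMap.coeFn_holder (r := 2)
    (ContinuousLinearMap.lsmul ℂ ℂ : ℂ →L[ℂ] C2 →L[ℂ] C2) (hV.toLp V) u, hV.coeFn_toLp] with x h1 h2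
  rw [← h2]
  exact h1

theorem norm_mulL3_apply_le {V : R3 → ℂ} (hV : MemLp V 3 (volume : Measure R3)) (u : L6Spinor) :
    ‖mulL3 hV u‖ ≤ (eLpNorm V 3 (volume : Measure R3)).toReal * ‖u‖ := by
  have h := ContinuousLinearMap.norm_holder_apply_apply_le (r := 2)
    (ContinuousLinearMap.lsmul ℂ ℂ : ℂ →L[ℂ] C2 →L[ℂ] C2) (hV.toLp V) u
  have h1 : ‖(ContinuousLinearMap.lsmul ℂ ℂ : ℂ →L[ℂ] C2 →L[ℂ] C2)‖ ≤ 1 :=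
    ContinuousLinearMap.opNorm_lsmul_le
  rw [Lp.norm_toLp] at h
  refine h.trans ?_
  gcongr
  exact mul_le_of_le_one_left ENNReal.toReal_nonneg h1

theorem coeFn_mulL3_testToL6 {V : R3 → ℂ} (hV : MemLp V 3 (volume : Measure R3)) (φ : TestSpinor) :
    mulL3 hV (testToL6 φ) =ᵐ[volume] fun x => V x • φ x := by
  filter_upwards [coeFn_mulL3 hV (testToL6 φ), (memLp_testSpinor φ 6).coeFn_toLp] with x h1 h2
  rw [h1]
  exact congrArg _ h2

/-- This is where the exponent 3/2 matters: |B|^{1/2} lies in L³, the Hölder exponent that carries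
L⁶ into L². -/
theorem memLp_sqrt_norm {B : R3 → R3} (hB : IsL32 B) :
    MemLp (fun x => ((√‖B x‖ : ℝ) : ℂ)) 3 (volume : Measure R3) := by
  have hm : AEStronglyMeasurable (fun x => ((√‖B x‖ : ℝ) : ℂ)) (volume : Measure R3) :=
    ((Complex.continuous_ofReal.comp Real.continuous_sqrt).comp
      continuous_norm).comp_aestronglyMeasurable hB.aestronglyMeasurable
  have h := hB.norm_rpow_div (1 / 2 : ℝ≥0∞)
  have e : (3 / 2 : ℝ≥0∞) / (1 / 2) = 3 := by
    rw [← ENNReal.toReal_eq_toReal_iff' (by simp [ENNReal.div_eq_top]) (by simp)]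
    simp
  rw [e] at h
  refine h.of_le hm (Eventually.of_forall fun x => ?_)
  rw [Complex.norm_real, Real.sqrt_eq_rpow]
  simp

theorem mulL3_sqrt_testToL6 {B : R3 → R3} (hB : IsL32 B) (φ : TestSpinor) :
    mulL3 (memLp_sqrt_norm hB) (testToL6 φ) = sqrtFieldMul hB φ := by
  apply Lp.ext
  filter_upwards [coeFn_mulL3_testToL6 (memLp_sqrt_norm hB) φ, (memLp_sqrt_smul hB φ).coeFn_toLp]
    with x h1 h2
  rw [h1]
  exact h2.symm

/-! ### Translation estimates -/

theorem enorm_translate_sub_le {f : R3 → C2} (hf : ContDiff ℝ 1 f) (x z : R3) :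
    ‖f (x + z) - f x‖ₑ ≤ ∫⁻ t in Set.Ioc (0 : ℝ) 1, ‖fderiv ℝ f (x + t • z)‖ₑ * ‖z‖ₑ := by
  have hd : ∀ t : ℝ, HasDerivAt (fun t : ℝ => f (x + t • z)) (fderiv ℝ f (x + t • z) z) t := by
    intro t
    have h1 : HasDerivAt (fun t : ℝ => x + t • z) z t := by
      simpa using ((hasDerivAt_id t).smul_const z).const_add x
    exact (hf.differentiable one_ne_zero _).hasFDerivAt.comp_hasDerivAt t h1
  have hc : Continuous fun t : ℝ => fderiv ℝ f (x + t • z) z :=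
    ((hf.continuous_fderiv one_ne_zero).comp (by fun_prop)).clm_apply continuous_const
  have hint := intervalIntegral.integral_eq_sub_of_hasDerivAt (a := 0) (b := 1)
    (fun t _ => hd t) (hc.intervalIntegrable _ _)
  simp only [one_smul, zero_smul, add_zero] at hint
  rw [← hint, intervalIntegral.integral_of_le zero_le_one]
  refine (enorm_integral_le_lintegral_enorm _).trans (lintegral_mono fun t => ?_)
  exact ContinuousLinearMap.le_opENorm _ _

/-- Fubini and translation invariance applied to the integral of the derivative along a segment. The
L¹ norm of the gradient is used because A ∈ L²_loc gives no L² bound on the terms A_jφ in the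
gradient of a localized spinor. -/
theorem lintegral_translate_sub_le {f : R3 → C2} (hf : ContDiff ℝ 1 f) (z : R3) :
    ∫⁻ x, ‖f (x + z) - f x‖ₑ ≤ ‖z‖ₑ * ∫⁻ x, ‖fderiv ℝ f x‖ₑ := by
  have hc := hf.continuous_fderiv one_ne_zero
  calc ∫⁻ x, ‖f (x + z) - f x‖ₑ
      ≤ ∫⁻ x, ∫⁻ t in Set.Ioc (0 : ℝ) 1, ‖fderiv ℝ f (x + t • z)‖ₑ * ‖z‖ₑ :=
        lintegral_mono fun x => enorm_translate_sub_le hf x z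
    _ = ∫⁻ t in Set.Ioc (0 : ℝ) 1, ∫⁻ x, ‖fderiv ℝ f (x + t • z)‖ₑ * ‖z‖ₑ := by
        refine lintegral_lintegral_swap (Measurable.aemeasurable ?_)
        refine Measurable.mul_const ?_ _
        exact (hc.comp (by fun_prop : Continuous fun p : R3 × ℝ => p.1 + p.2 • z)).enorm.measurable
    _ = ∫⁻ t in Set.Ioc (0 : ℝ) 1, ‖z‖ₑ * ∫⁻ x, ‖fderiv ℝ f x‖ₑ := by
        refine lintegral_congr fun t => ?_
        rw [lintegral_add_right_eq_self (fun y => ‖fderiv ℝ f y‖ₑ * ‖z‖ₑ) (t • z),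
          lintegral_mul_const _ hc.enorm.measurable, mul_comm]
    _ = _ := by simp

/-- Interpolation of L² between L¹ and L⁶: where |u - v| ≤ r the square is at most r|u - v|,
elsewhere it is at most |u - v|⁶/r⁴. The constant 32 = 2⁵ comes from convexity of the sixth power.
-/
theorem enorm_sub_sq_le {r : ℝ} (hr : 0 < r) (u v : C2) :
    ‖u - v‖ₑ ^ 2 ≤ ENNReal.ofReal r * ‖u - v‖ₑ
      + ENNReal.ofReal (32 / r ^ 4) * (‖u‖ₑ ^ 6 + ‖v‖ₑ ^ 6) := by
  have h : ‖u - v‖ ^ 2 ≤ r * ‖u - v‖ + 32 / r ^ 4 * (‖u‖ ^ 6 + ‖v‖ ^ 6) := by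
    have h1 : ‖u - v‖ ^ 6 ≤ 32 * (‖u‖ ^ 6 + ‖v‖ ^ 6) := by
      calc ‖u - v‖ ^ 6 ≤ (‖u‖ + ‖v‖) ^ 6 := by gcongr; exact norm_sub_le u v
        _ ≤ 2 ^ (6 - 1) * (‖u‖ ^ 6 + ‖v‖ ^ 6) := add_pow_le (norm_nonneg _) (norm_nonneg _) 6
        _ = _ := by norm_num
    have ha0 := norm_nonneg (u - v)
    generalize ‖u - v‖ = a at *
    have h0 : 0 ≤ 32 / r ^ 4 * (‖u‖ ^ 6 + ‖v‖ ^ 6) := by positivity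
    by_cases ha : a ≤ r
    · nlinarith
    · push Not at ha
      have h2 : a ^ 2 ≤ a ^ 6 / r ^ 4 := by
        rw [le_div_iff₀ (by positivity)]
        have : r ^ 4 ≤ a ^ 4 := by gcongr
        nlinarith [sq_nonneg a]
      have : a ^ 6 / r ^ 4 ≤ 32 / r ^ 4 * (‖u‖ ^ 6 + ‖v‖ ^ 6) := by
        rw [div_mul_eq_mul_div]; gcongr
      nlinarith
  simp only [← ofReal_norm]
  rw [← ENNReal.ofReal_pow (norm_nonneg _), ← ENNReal.ofReal_pow (norm_nonneg _),
    ← ENNReal.ofReal_pow (norm_nonneg _), ← ENNReal.ofReal_add (by positivity) (by positivity),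
    ← ENNReal.ofReal_mul hr.le, ← ENNReal.ofReal_mul (by positivity),
    ← ENNReal.ofReal_add (by positivity) (by positivity)]
  exact ENNReal.ofReal_le_ofReal h

theorem lintegral_translate_sub_sq_le {f : R3 → C2} (hf : ContDiff ℝ 1 f) {r : ℝ} (hr : 0 < r)
    (z : R3) :
    ∫⁻ x, ‖f (x + z) - f x‖ₑ ^ 2 ≤ ENNReal.ofReal r * (‖z‖ₑ * ∫⁻ x, ‖fderiv ℝ f x‖ₑ)
      + ENNReal.ofReal (32 / r ^ 4) * (2 * ∫⁻ x, ‖f x‖ₑ ^ 6) := by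
  have hc := hf.continuous
  have hc' : Continuous fun x => f (x + z) := hc.comp (by fun_prop)
  have m1 : Measurable fun x => ‖f (x + z) - f x‖ₑ := (hc'.sub hc).enorm.measurable
  have m2 : Measurable fun x => ‖f x‖ₑ ^ 6 := hc.enorm.measurable.pow_const 6
  have m3 : Measurable fun x => ‖f (x + z)‖ₑ ^ 6 := hc'.enorm.measurable.pow_const 6
  have m4 : Measurable fun x => ‖f (x + z)‖ₑ ^ 6 + ‖f x‖ₑ ^ 6 := m3.add m2
  refine (lintegral_mono fun x => enorm_sub_sq_le hr (f (x + z)) (f x)).trans ?_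
  rw [lintegral_add_left (m1.const_mul _), lintegral_const_mul _ m1,
    lintegral_const_mul _ m4, lintegral_add_left m3,
    lintegral_add_right_eq_self (fun y => ‖f y‖ₑ ^ 6) z, two_mul]
  gcongr
  exact lintegral_translate_sub_le hf z

/-! ### Cubes -/

/-- The index of the half-open cube of side `ε` containing `x`. -/
def cubeIndex (ε : ℝ) (x : R3) : Fin 3 → ℤ := fun j => ⌊x j / ε⌋

/-- The cubes of side `ε` of the grid. -/
def cube (ε : ℝ) (k : Fin 3 → ℤ) : Set R3 := {x | cubeIndex ε x = k}

theorem measurable_cubeIndex (ε : ℝ) : Measurable (cubeIndex ε) := by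
  refine measurable_pi_lambda _ fun j => Int.measurable_floor.comp ?_
  exact ((EuclideanSpace.proj (𝕜 := ℝ) j).continuous.measurable).div_const ε

theorem measurableSet_cube (ε : ℝ) (k : Fin 3 → ℤ) : MeasurableSet (cube ε k) :=
  measurable_cubeIndex ε (measurableSet_singleton k)

theorem volume_cube {ε : ℝ} (hε : 0 < ε) (k : Fin 3 → ℤ) :
    volume (cube ε k) = ENNReal.ofReal ε ^ 3 := by
  have e : cube ε k = (@WithLp.ofLp 2 (Fin 3 → ℝ)) ⁻¹'
      (Set.univ.pi fun j => Set.Ico (k j * ε) (k j * ε + ε)) := by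
    ext x
    simp only [cube, cubeIndex, Set.mem_ofPred_eq, funext_iff, Int.floor_eq_iff, Set.mem_preimage,
      Set.mem_univ_pi, Set.mem_Ico]
    refine forall_congr' fun j => ?_
    rw [le_div_iff₀ hε, div_lt_iff₀ hε, add_one_mul]
  rw [e, (PiLp.volume_preserving_ofLp (Fin 3)).measure_preimage
    (MeasurableSet.univ_pi fun j => measurableSet_Ico).nullMeasurableSet, Real.volume_pi_Ico]
  simp

/-- The open box `|z_j| < ε`. -/
def box (ε : ℝ) : Set R3 := {z | ∀ j, |z j| < ε}

theorem volume_box (ε : ℝ) : volume (box ε) = ENNReal.ofReal (2 * ε) ^ 3 := by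
  have e : box ε = (@WithLp.ofLp 2 (Fin 3 → ℝ)) ⁻¹'
      (Set.univ.pi fun _ => Set.Ioo (-ε) ε) := by
    ext x
    simp [box, abs_lt]
  rw [e, (PiLp.volume_preserving_ofLp (Fin 3)).measure_preimage
    (MeasurableSet.univ_pi fun j => measurableSet_Ioo).nullMeasurableSet, Real.volume_pi_Ioo]
  simp [two_mul]

theorem measurableSet_box (ε : ℝ) : MeasurableSet (box ε) := by
  have e : box ε = (@WithLp.ofLp 2 (Fin 3 → ℝ)) ⁻¹'
      (Set.univ.pi fun _ => Set.Ioo (-ε) ε) := by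
    ext x
    simp [box, abs_lt]
  rw [e]
  exact (PiLp.volume_preserving_ofLp (Fin 3)).measurable
    (MeasurableSet.univ_pi fun j => measurableSet_Ioo)

theorem norm_le_of_mem_box {ε : ℝ} {z : R3} (hz : z ∈ box ε) : ‖z‖ ≤ 2 * ε := by
  have hε : 0 ≤ ε := (abs_nonneg _).trans (hz 0).le
  rw [← sq_le_sq₀ (norm_nonneg _) (by positivity), EuclideanSpace.norm_sq_eq, Fin.sum_univ_three]
  have h : ∀ j, ‖z j‖ ^ 2 ≤ ε ^ 2 := fun j => by
    rw [Real.norm_eq_abs]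
    exact pow_le_pow_left₀ (abs_nonneg _) (hz j).le 2
  nlinarith [h 0, h 1, h 2]

theorem sub_mem_box {ε : ℝ} (hε : 0 < ε) {x y : R3} (h : cubeIndex ε y = cubeIndex ε x) :
    y - x ∈ box ε := by
  intro j
  have h1 := Int.abs_sub_lt_one_of_floor_eq_floor (congrFun h j)
  rw [← sub_div, abs_div, abs_of_pos hε, div_lt_one hε] at h1
  exact h1

theorem finite_cubeIndex_image {ε : ℝ} (hε : 0 < ε) {K : Set R3} (hK : IsCompact K) :
    (cubeIndex ε '' K).Finite := by
  obtain ⟨r, hr⟩ := hK.isBounded.exists_norm_le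
  refine (Set.Finite.pi (fun _ => Set.finite_Icc ⌊-r / ε⌋ ⌊r / ε⌋) :
    (Set.univ.pi fun _ : Fin 3 => Set.Icc ⌊-r / ε⌋ ⌊r / ε⌋).Finite).subset ?_
  rintro _ ⟨x, hx, rfl⟩ j -
  have h1 : |x j| ≤ r := (PiLp.norm_apply_le x j).trans (hr x hx)
  rw [abs_le] at h1
  exact ⟨Int.floor_le_floor (by gcongr; exact h1.1), Int.floor_le_floor (by gcongr; exact h1.2)⟩

/-- Jensen's inequality for the normalized measure on Q. -/
theorem enorm_sub_average_sq_le {f : R3 → C2} (hf : Integrable f) {Q : Set R3}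
    (hQ0 : volume Q ≠ 0) (hQ : volume Q ≠ ∞) (u : C2) :
    ‖u - ⨍ y in Q, f y‖ₑ ^ 2 ≤ (volume Q)⁻¹ * ∫⁻ y in Q, ‖u - f y‖ₑ ^ 2 := by
  set ν : Measure R3 := (volume Q)⁻¹ • volume.restrict Q with hν
  have hp : IsProbabilityMeasure ν :=
    ⟨by rw [hν, Measure.smul_apply, Measure.restrict_apply_univ, smul_eq_mul,
      ENNReal.inv_mul_cancel hQ0 hQ]⟩
  have hfi : Integrable f ν := hf.restrict.smul_measure (by simp [hQ0])
  have e : u - ⨍ y in Q, f y = ∫ y, (u - f y) ∂ν := by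
    rw [integral_sub (integrable_const _) hfi, integral_const, probReal_univ, one_smul, average,
      Measure.restrict_apply_univ]
  have h1 : ‖u - ⨍ y in Q, f y‖ₑ ≤ eLpNorm (fun y => u - f y) 2 ν := by
    rw [e]
    refine (enorm_integral_le_lintegral_enorm _).trans ?_
    rw [← eLpNorm_one_eq_lintegral_enorm]
    exact eLpNorm_le_eLpNorm_of_exponent_le (by norm_num)
      ((integrable_const _).sub hfi).aestronglyMeasurable
  calc ‖u - ⨍ y in Q, f y‖ₑ ^ 2 ≤ eLpNorm (fun y => u - f y) 2 ν ^ 2 := by gcongr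
    _ = ∫⁻ y, ‖u - f y‖ₑ ^ 2 ∂ν := by
      have := eLpNorm_nnreal_pow_eq_lintegral (μ := ν) (f := fun y => u - f y) (p := 2) two_ne_zero
      simpa using this
    _ = _ := by rw [hν, lintegral_smul_measure, smul_eq_mul]

/-- Points of one cube differ by a vector of the box |z_j| < ε, so Fubini bounds the error by an
average of translation errors. The box has eight times the volume of a cube, whence the 8. -/
theorem lintegral_sub_average_cube_le {f : R3 → C2} (hf : Continuous f) (hfi : Integrable f)
    {ε : ℝ} (hε : 0 < ε) {δ : ℝ≥0∞}
    (hδ : ∀ z : R3, ‖z‖ ≤ 2 * ε → ∫⁻ x, ‖f (x + z) - f x‖ₑ ^ 2 ≤ δ) :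
    ∫⁻ x, ‖f x - ⨍ y in cube ε (cubeIndex ε x), f y‖ₑ ^ 2 ≤ 8 * δ := by
  set m : ℝ≥0∞ := ENNReal.ofReal ε ^ 3 with hm
  have hm0 : m ≠ 0 := by simp [hm, hε]
  have hmt : m ≠ ∞ := by simp [hm]
  have hmeas : Measurable fun p : R3 × R3 =>
      (box ε).indicator (fun _ => (1 : ℝ≥0∞)) p.2 * ‖f (p.1 + p.2) - f p.1‖ₑ ^ 2 := by
    refine Measurable.mul ((measurable_const.indicator (measurableSet_box ε)).comp measurable_snd) ?_
    refine Measurable.pow_const (Continuous.measurable ?_) 2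
    exact ((hf.comp (continuous_fst.add continuous_snd)).sub (hf.comp continuous_fst)).enorm
  have step : ∀ x, ‖f x - ⨍ y in cube ε (cubeIndex ε x), f y‖ₑ ^ 2
      ≤ m⁻¹ * ∫⁻ z, (box ε).indicator (fun _ => (1 : ℝ≥0∞)) z * ‖f (x + z) - f x‖ₑ ^ 2 := by
    intro x
    have hv := volume_cube hε (cubeIndex ε x)
    refine (enorm_sub_average_sq_le hfi (by rwa [hv]) (by rwa [hv]) (f x)).trans ?_
    rw [hv]
    refine mul_le_mul_right ?_ _
    rw [← lintegral_add_left_eq_self (fun y =>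
        (box ε).indicator (fun _ => (1 : ℝ≥0∞)) y * ‖f (x + y) - f x‖ₑ ^ 2) (-x),
      ← lintegral_indicator (measurableSet_cube _ _)]
    refine lintegral_mono fun y => ?_
    by_cases hy : y ∈ cube ε (cubeIndex ε x)
    · have hb : -x + y ∈ box ε := by
        rw [neg_add_eq_sub]; exact sub_mem_box hε hy
      rw [Set.indicator_of_mem hy, Set.indicator_of_mem hb, one_mul, add_neg_cancel_left,
        enorm_sub_rev]
    · rw [Set.indicator_of_notMem hy]
      exact zero_le
  calc ∫⁻ x, ‖f x - ⨍ y in cube ε (cubeIndex ε x), f y‖ₑ ^ 2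
      ≤ ∫⁻ x, m⁻¹ * ∫⁻ z, (box ε).indicator (fun _ => (1 : ℝ≥0∞)) z * ‖f (x + z) - f x‖ₑ ^ 2 :=
        lintegral_mono step
    _ = m⁻¹ * ∫⁻ x, ∫⁻ z, (box ε).indicator (fun _ => (1 : ℝ≥0∞)) z * ‖f (x + z) - f x‖ₑ ^ 2 :=
        lintegral_const_mul _ hmeas.lintegral_prod_right'
    _ = m⁻¹ * ∫⁻ z, ∫⁻ x, (box ε).indicator (fun _ => (1 : ℝ≥0∞)) z * ‖f (x + z) - f x‖ₑ ^ 2 := by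
        rw [lintegral_lintegral_swap hmeas.aemeasurable]
    _ ≤ m⁻¹ * ∫⁻ z, (box ε).indicator (fun _ => δ) z := by
        gcongr with z
        by_cases hz : z ∈ box ε
        · simpa [hz] using hδ z (norm_le_of_mem_box hz)
        · simp [hz]
    _ = 8 * δ := by
        rw [lintegral_indicator_const (measurableSet_box ε), volume_box,
          ENNReal.ofReal_mul zero_le_two, mul_pow, ← hm]
        calc m⁻¹ * (δ * (ENNReal.ofReal 2 ^ 3 * m))
            = (m⁻¹ * m) * (ENNReal.ofReal 2 ^ 3 * δ) := by ring
          _ = 8 * δ := by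
            rw [ENNReal.inv_mul_cancel hm0 hmt, one_mul, ENNReal.ofReal_ofNat]
            norm_num

/-- Step functions on finitely many cubes. -/
def stepFun (ε : ℝ) (I : Finset (Fin 3 → ℤ)) (c : I → C2) (x : R3) : C2 :=
  ∑ k : I, (cube ε k).indicator (fun _ => c k) x

theorem memLp_stepFun {ε : ℝ} (hε : 0 < ε) (I : Finset (Fin 3 → ℤ)) (c : I → C2) :
    MemLp (stepFun ε I c) 2 (volume : Measure R3) := by
  refine memLp_finsetSum _ fun k _ => memLp_indicator_const 2 (measurableSet_cube ε k) (c k) ?_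
  right
  rw [volume_cube hε]
  simp

/-- Step functions on finitely many cubes, as a finite-dimensional family in `L²`. -/
def stepMap {ε : ℝ} (hε : 0 < ε) (I : Finset (Fin 3 → ℤ)) : (I → C2) →ₗ[ℂ] L2Spinor where
  toFun c := (memLp_stepFun hε I c).toLp _
  map_add' c d := by
    rw [← MemLp.toLp_add]
    congr 1
    funext x
    simp only [stepFun, Pi.add_apply, ← Finset.sum_add_distrib]
    refine Finset.sum_congr rfl fun k _ => ?_
    by_cases hx : x ∈ cube ε k <;> simp [hx]
  map_smul' a c := by
    rw [RingHom.id_apply, ← MemLp.toLp_const_smul]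
    congr 1
    funext x
    simp only [stepFun, Pi.smul_apply, Finset.smul_sum]
    refine Finset.sum_congr rfl fun k _ => ?_
    by_cases hx : x ∈ cube ε k <;> simp [hx]

/-- On cubes outside the finite index set f vanishes identically, so its average is zero there too.
-/
theorem stepFun_average {f : R3 → C2} {ε : ℝ} {I : Finset (Fin 3 → ℤ)}
    (hI : ∀ x, f x ≠ 0 → cubeIndex ε x ∈ I) (x : R3) :
    stepFun ε I (fun k => ⨍ y in cube ε k, f y) x = ⨍ y in cube ε (cubeIndex ε x), f y := by
  unfold stepFun
  by_cases hx : cubeIndex ε x ∈ I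
  · rw [Finset.sum_eq_single ⟨cubeIndex ε x, hx⟩]
    · rw [Set.indicator_of_mem]; rfl
    · intro k _ hk
      rw [Set.indicator_of_notMem]
      intro h
      exact hk (Subtype.ext h.symm)
    · simp
  · rw [Finset.sum_eq_zero]
    · rw [setAverage_eq, setIntegral_eq_zero_of_forall_eq_zero, smul_zero]
      intro y hy
      by_contra h0
      exact hx (hy ▸ hI y h0)
    · intro k _
      rw [Set.indicator_of_notMem]
      intro h
      exact hx (h ▸ k.2)

/-- The approximating space consists of the step functions on the cubes meeting K. It depends only
on K and ε, not on f, and this uniformity is what yields compactness. -/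
theorem exists_stepMap_dist_le {K : Set R3} (hK : IsCompact K) {ε : ℝ} (hε : 0 < ε) :
    ∃ W : Submodule ℂ L2Spinor, FiniteDimensional ℂ W ∧
      ∀ (f : R3 → C2) (_ : Continuous f) (_ : HasCompactSupport f) (_ : ∀ x, f x ≠ 0 → x ∈ K)
        (h2 : MemLp f 2 (volume : Measure R3)) (δ : ℝ) (_ : 0 ≤ δ)
        (_ : ∀ z : R3, ‖z‖ ≤ 2 * ε → ∫⁻ x, ‖f (x + z) - f x‖ₑ ^ 2 ≤ ENNReal.ofReal δ),
        ∃ w ∈ W, ‖h2.toLp f - w‖ ^ 2 ≤ 8 * δ := by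
  set I := (finite_cubeIndex_image hε hK).toFinset
  refine ⟨LinearMap.range (stepMap hε I), inferInstance, fun f hf hs hfK h2 δ hδ0 hδ => ?_⟩
  refine ⟨_, ⟨fun k => ⨍ y in cube ε k, f y, rfl⟩, ?_⟩
  have hI : ∀ x, f x ≠ 0 → cubeIndex ε x ∈ I := fun x hx => by
    simpa [I] using ⟨x, hfK x hx, rfl⟩
  have key := lintegral_sub_average_cube_le hf (hf.integrable_of_hasCompactSupport hs) hε hδ
  simp_rw [← stepFun_average hI] at key
  change ‖h2.toLp f - (memLp_stepFun hε I _).toLp _‖ ^ 2 ≤ _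
  rw [← MemLp.toLp_sub, Lp.norm_toLp]
  have h3 := eLpNorm_nnreal_pow_eq_lintegral (μ := (volume : Measure R3))
    (f := f - stepFun ε I (fun k => ⨍ y in cube ε k, f y)) (p := 2) two_ne_zero
  have h4 : eLpNorm (f - stepFun ε I (fun k => ⨍ y in cube ε k, f y)) 2 (volume : Measure R3) ^ 2
      ≤ 8 * ENNReal.ofReal δ := by
    refine le_trans (le_of_eq ?_) key
    simpa using h3
  rw [← ENNReal.toReal_pow]
  refine (ENNReal.toReal_mono (by finiteness) h4).trans_eq ?_
  rw [ENNReal.toReal_mul, ENNReal.toReal_ofReal hδ0]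
  simp

/-! ### Local compactness of the form domain -/

theorem lintegral_enorm_mul_enorm_le {F G : Type*} [NormedAddCommGroup F] [NormedAddCommGroup G]
    {a : R3 → F} {b : R3 → G} (ha : AEStronglyMeasurable a (volume : Measure R3))
    (hb : AEStronglyMeasurable b (volume : Measure R3)) :
    ∫⁻ x, ‖a x‖ₑ * ‖b x‖ₑ ≤
      eLpNorm a 2 (volume : Measure R3) * eLpNorm b 2 (volume : Measure R3) := by
  have h := eLpNorm_smul_le_mul_eLpNorm (p := 2) (q := 2) (r := 1) (𝕜 := ℝ) hb.norm ha.norm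
  rw [eLpNorm_norm, eLpNorm_norm, eLpNorm_one_eq_lintegral_enorm] at h
  refine le_trans (le_of_eq ?_) h
  refine lintegral_congr fun x => ?_
  simp

theorem enorm_le_sum_basisVec (L : R3 →L[ℝ] C2) : ‖L‖ₑ ≤ ∑ j, ‖L (basisVec j)‖ₑ := by
  have h : ‖L‖ ≤ ∑ j, ‖L (basisVec j)‖ := by
    refine L.opNorm_le_bound (by positivity) fun v => ?_
    conv_lhs => rw [sum_basisVec v, map_sum]
    rw [Finset.sum_mul]
    refine (norm_sum_le _ _).trans (Finset.sum_le_sum fun j _ => ?_)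
    rw [map_smul, norm_smul, mul_comm]
    exact mul_le_mul_of_nonneg_left (PiLp.norm_apply_le v j) (norm_nonneg _)
  simp only [← ofReal_norm]
  rw [← ENNReal.ofReal_sum_of_nonneg fun _ _ => norm_nonneg _]
  exact ENNReal.ofReal_le_ofReal h

/-- The product of a smooth function and a test spinor. -/
def smoothMul (V : R3 → ℂ) (φ : TestSpinor) (x : R3) : C2 := V x • φ x

theorem fderiv_smoothMul {V : R3 → ℂ} (hV : ContDiff ℝ 1 V) (φ : TestSpinor) (x v : R3) :
    fderiv ℝ (smoothMul V φ) x v = V x • fderiv ℝ φ x v + fderiv ℝ V x v • φ x := by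
  have h1 := (hV.differentiable one_ne_zero x).hasFDerivAt.smul
    (φ.contDiff_one.differentiable one_ne_zero x).hasFDerivAt
  have h2 : HasFDerivAt (smoothMul V φ) _ x := h1
  rw [h2.fderiv]
  simp

/-- Writing ∂_jφ through the momentum and A_jφ makes every term a product of two L² functions. The
indicator of supp V localizes φ, so that its L⁶ norm controls the L² factor. -/
theorem enorm_fderiv_smoothMul_le {V : R3 → ℂ} (hV : ContDiff ℝ 1 V) (A : R3 → R3)
    (φ : TestSpinor) (j : Fin 3) (x : R3) :
    ‖fderiv ℝ (smoothMul V φ) x (basisVec j)‖ₑ ≤ ‖V x‖ₑ * ‖momentum A φ j x‖ₑ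
      + ‖(A x j : ℂ) • V x‖ₑ * ‖(tsupport V).indicator (fun _ => (1 : ℂ)) x • φ x‖ₑ
      + ‖fderiv ℝ V x (basisVec j)‖ₑ * ‖(tsupport V).indicator (fun _ => (1 : ℂ)) x • φ x‖ₑ := by
  rw [fderiv_smoothMul hV]
  change ‖V x • partialD φ j x + _‖ₑ ≤ _
  by_cases hx : x ∈ tsupport V
  · rw [Set.indicator_of_mem hx, one_smul, partialD_eq_momentum A]
    refine (enorm_add_le _ _).trans ?_
    rw [enorm_smul (fderiv ℝ V x (basisVec j))]
    gcongr
    rw [smul_sub]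
    refine (enorm_sub_le).trans ?_
    rw [enorm_smul, enorm_smul, enorm_smul, enorm_smul, enorm_smul, enorm_mul]
    simp only [enorm_eq_nnnorm, Complex.nnnorm_I, ENNReal.coe_one, one_mul]
    rw [← mul_assoc, mul_comm (‖V x‖₊ : ℝ≥0∞) (‖((A x j : ℝ) : ℂ)‖₊)]
  · have h1 : V x = 0 := image_eq_zero_of_notMem_tsupport hx
    have h2 : fderiv ℝ V x = 0 := by
      by_contra h
      exact hx (support_fderiv_subset ℝ h)
    simp [h1, h2]

theorem memLp_indicator_tsupport {F : Type*} [Zero F] {V : R3 → F} (hs : HasCompactSupport V) (p : ℝ≥0∞) :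
    MemLp ((tsupport V).indicator (fun _ => (1 : ℂ))) p (volume : Measure R3) :=
  memLp_indicator_const p (isClosed_tsupport V).measurableSet 1
    (Or.inr (IsCompact.measure_lt_top hs).ne)

theorem memLp_component_smul_of_compactSupport {A : R3 → R3} (hA : IsL2Loc A) {V : R3 → ℂ}
    (hV : Continuous V) (hs : HasCompactSupport V) (j : Fin 3) :
    MemLp (fun x => ((A x j : ℝ) : ℂ) • V x) 2 (volume : Measure R3) := by
  have hind : (fun x => ((A x j : ℝ) : ℂ) • V x)
      = (tsupport V).indicator (fun x => ((A x j : ℝ) : ℂ) • V x) := by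
    symm
    rw [Set.indicator_eq_self]
    intro x hx
    apply subset_tsupport
    intro h0
    exact hx (by simp [h0])
  rw [hind, memLp_indicator_iff_restrict (isClosed_tsupport _).measurableSet]
  obtain ⟨C, hC⟩ := hV.bounded_above_of_compact_support hs
  have hm : AEStronglyMeasurable (fun x => ((A x j : ℝ) : ℂ)) (volume.restrict (tsupport V)) :=
    (Complex.continuous_ofReal.comp (EuclideanSpace.proj (𝕜 := ℝ) j).continuous
      ).comp_aestronglyMeasurable (hA _ hs).aestronglyMeasurable
  refine (hA _ hs).of_le_mul (c := C) (hm.smul hV.aestronglyMeasurable)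
    (Eventually.of_forall fun x => ?_)
  rw [norm_smul, mul_comm, Complex.norm_real]
  exact mul_le_mul (hC x) (PiLp.norm_apply_le (A x) j) (norm_nonneg _)
    ((norm_nonneg _).trans (hC x))

theorem norm_testToL6 (φ : TestSpinor) :
    ‖testToL6 φ‖ = (eLpNorm φ 6 (volume : Measure R3)).toReal :=
  Lp.norm_toLp _ (memLp_testSpinor φ 6)

theorem eLpNorm_mul_testToL6_le {V : R3 → ℂ} (hV : MemLp V 3 (volume : Measure R3))
    (φ : TestSpinor) : eLpNorm (fun x => V x • φ x) 2 (volume : Measure R3) ≤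
      eLpNorm V 3 (volume : Measure R3) * ENNReal.ofReal ‖testToL6 φ‖ := by
  have e : ENNReal.ofReal ‖testToL6 φ‖ = eLpNorm φ 6 (volume : Measure R3) := by
    rw [norm_testToL6,
      ENNReal.ofReal_toReal (memLp_testSpinor φ 6).eLpNorm_ne_top]
  rw [e]
  have h := eLpNorm_smul_le_mul_eLpNorm (p := 3) (q := 6) (r := 2) (memLp_testSpinor φ 6).1 hV.1
  exact h

theorem eLpNorm_momentum_le {A B : R3 → R3} (hA : IsL2Loc A) (hB : IsL32 B)
    (hcurl : IsWeakCurl A B) (φ : TestSpinor) (j : Fin 3) :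
    eLpNorm (momentum A φ j) 2 (volume : Measure R3) ≤ ENNReal.ofReal (energy hA hB φ) := by
  have hm := memLp_momentum hA φ j
  rw [← ENNReal.ofReal_toReal hm.eLpNorm_ne_top, ← Lp.norm_toLp _ hm]
  refine ENNReal.ofReal_le_ofReal (Real.le_sqrt_of_sq_le ?_)
  rw [normSq_toLp_two]
  refine le_trans ?_ (sum_normSq_momentum_le hA hB hcurl φ)
  exact Finset.single_le_sum (f := fun j => ∫ x, ‖momentum A φ j x‖ ^ 2)
    (fun i _ => by positivity) (Finset.mem_univ j)

/-- Cauchy–Schwarz on each of the three products: the momentum is bounded by the energy, and the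
localized φ by Hölder (L³ against L⁶) and Sobolev. -/
theorem exists_lintegral_fderiv_smoothMul_le {A B : R3 → R3} (hA : IsL2Loc A) (hB : IsL32 B)
    (hcurl : IsWeakCurl A B) {V : R3 → ℂ} (hV : ContDiff ℝ 1 V) (hs : HasCompactSupport V) :
    ∃ C : ℝ≥0∞, C ≠ ∞ ∧ ∀ φ, energy hA hB φ ≤ 1 →
      ∫⁻ x, ‖fderiv ℝ (smoothMul V φ) x‖ₑ ≤ C := by
  obtain ⟨S, hS0, hS⟩ := exists_norm_testToL6_le
  set χ := (tsupport V).indicator (fun _ => (1 : ℂ)) with hχ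
  have hχ3 : MemLp χ 3 (volume : Measure R3) := memLp_indicator_tsupport hs 3
  have hV2 : MemLp V 2 (volume : Measure R3) := hV.continuous.memLp_of_hasCompactSupport hs
  have hA2 := fun j => memLp_component_smul_of_compactSupport hA hV.continuous hs j
  have hdV : ∀ j, MemLp (fun x => fderiv ℝ V x (basisVec j)) 2 (volume : Measure R3) := fun j =>
    ((hV.continuous_fderiv one_ne_zero).clm_apply continuous_const).memLp_of_hasCompactSupport
      (hs.fderiv_apply (𝕜 := ℝ) _)
  set X : ℝ≥0∞ := eLpNorm χ 3 (volume : Measure R3) * ENNReal.ofReal S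
  refine ⟨∑ j : Fin 3, (eLpNorm V 2 (volume : Measure R3) * 1
    + eLpNorm (fun x => ((A x j : ℝ) : ℂ) • V x) 2 (volume : Measure R3) * X
    + eLpNorm (fun x => fderiv ℝ V x (basisVec j)) 2 (volume : Measure R3) * X), ?_, ?_⟩
  · have hX : X ≠ ∞ := ENNReal.mul_ne_top hχ3.eLpNorm_ne_top (by simp)
    refine ENNReal.sum_ne_top.2 fun j _ => ENNReal.add_ne_top.2 ⟨ENNReal.add_ne_top.2 ⟨?_, ?_⟩, ?_⟩
    · exact ENNReal.mul_ne_top hV2.eLpNorm_ne_top (by simp)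
    · exact ENNReal.mul_ne_top (hA2 j).eLpNorm_ne_top hX
    · exact ENNReal.mul_ne_top (hdV j).eLpNorm_ne_top hX
  · intro φ hφ
    have hχφ : AEStronglyMeasurable (fun x => χ x • φ x) (volume : Measure R3) :=
      hχ3.1.smul φ.continuous.aestronglyMeasurable
    have hX : eLpNorm (fun x => χ x • φ x) 2 (volume : Measure R3) ≤ X := by
      refine (eLpNorm_mul_testToL6_le hχ3 φ).trans ?_
      refine mul_le_mul_right (ENNReal.ofReal_le_ofReal ?_) _
      exact (hS A B hA hB hcurl φ).trans (mul_le_of_le_one_right hS0.le hφ)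
    have hmj : ∀ j, Measurable fun x => ‖fderiv ℝ (smoothMul V φ) x (basisVec j)‖ₑ := fun j =>
      ((((hV.smul φ.contDiff_one).continuous_fderiv one_ne_zero).clm_apply
        continuous_const).enorm).measurable
    calc ∫⁻ x, ‖fderiv ℝ (smoothMul V φ) x‖ₑ
        ≤ ∫⁻ x, ∑ j, ‖fderiv ℝ (smoothMul V φ) x (basisVec j)‖ₑ :=
          lintegral_mono fun x => enorm_le_sum_basisVec _
      _ = ∑ j, ∫⁻ x, ‖fderiv ℝ (smoothMul V φ) x (basisVec j)‖ₑ :=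
          lintegral_finsetSum _ fun j _ => hmj j
      _ ≤ _ := by
        refine Finset.sum_le_sum fun j _ => ?_
        refine (lintegral_mono fun x => enorm_fderiv_smoothMul_le hV A φ j x).trans ?_
        have n1 : AEMeasurable (fun x => ‖V x‖ₑ * ‖momentum A φ j x‖ₑ) (volume : Measure R3) :=
          hV2.1.enorm.mul (memLp_momentum hA φ j).1.enorm
        have n2 : AEMeasurable (fun x => ‖((A x j : ℝ) : ℂ) • V x‖ₑ * ‖χ x • φ x‖ₑ)
            (volume : Measure R3) := (hA2 j).1.enorm.mul hχφ.enorm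
        have n12 : AEMeasurable (fun x => ‖V x‖ₑ * ‖momentum A φ j x‖ₑ
            + ‖((A x j : ℝ) : ℂ) • V x‖ₑ * ‖χ x • φ x‖ₑ) (volume : Measure R3) := n1.add n2
        rw [← hχ, lintegral_add_left' n12, lintegral_add_left' n1]
        refine add_le_add (add_le_add ?_ ?_) ?_
        · refine (lintegral_enorm_mul_enorm_le hV2.1 (memLp_momentum hA φ j).1).trans ?_
          refine mul_le_mul_right ((eLpNorm_momentum_le hA hB hcurl φ j).trans ?_) _
          simpa using hφ
        · exact (lintegral_enorm_mul_enorm_le (hA2 j).1 hχφ).trans (mul_le_mul_right hX _)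
        · exact (lintegral_enorm_mul_enorm_le (hdV j).1 hχφ).trans (mul_le_mul_right hX _)

theorem lintegral_smoothMul_pow_six_le {V : R3 → ℂ} {c : ℝ} (hc : ∀ x, ‖V x‖ ≤ c)
    (φ : TestSpinor) : ∫⁻ x, ‖smoothMul V φ x‖ₑ ^ 6 ≤ ENNReal.ofReal ((c * ‖testToL6 φ‖) ^ 6) := by
  have hc0 : 0 ≤ c := (norm_nonneg _).trans (hc 0)
  have h6 : ∫⁻ x, ‖φ x‖ₑ ^ 6 = ENNReal.ofReal ‖testToL6 φ‖ ^ 6 := by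
    have := eLpNorm_nnreal_pow_eq_lintegral (μ := (volume : Measure R3)) (f := φ) (p := 6)
      (by norm_num)
    rw [norm_testToL6,
      ENNReal.ofReal_toReal (memLp_testSpinor φ 6).eLpNorm_ne_top]
    simp only [NNReal.coe_ofNat, ENNReal.coe_ofNat, ENNReal.rpow_ofNat] at this
    exact this.symm
  rw [mul_pow, ENNReal.ofReal_mul (by positivity), ENNReal.ofReal_pow (norm_nonneg _), ← h6,
    ← lintegral_const_mul _ (φ.continuous.enorm.measurable.pow_const 6)]
  refine lintegral_mono fun x => ?_
  rw [smoothMul, enorm_smul, mul_pow, ENNReal.ofReal_pow hc0]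
  gcongr
  rw [← ofReal_norm]
  exact ENNReal.ofReal_le_ofReal (hc x)

/-- A Rellich argument: the L¹ gradient bound and the L⁶ bound make the translates of Vφ close in
L², uniformly over the energy ball, so a fixed space of step functions suffices. -/
theorem exists_finiteDimensional_dist_smoothMul_le {A B : R3 → R3} (hA : IsL2Loc A) (hB : IsL32 B)
    (hcurl : IsWeakCurl A B) {V : R3 → ℂ} (hV : ContDiff ℝ 1 V) (hs : HasCompactSupport V)
    (hV3 : MemLp V 3 (volume : Measure R3)) {ε : ℝ} (hε : 0 < ε) :
    ∃ W : Submodule ℂ L2Spinor, FiniteDimensional ℂ W ∧ ∀ φ, energy hA hB φ ≤ 1 →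
      ∃ w ∈ W, ‖mulL3 hV3 (testToL6 φ) - w‖ ≤ ε := by
  obtain ⟨S, hS0, hS⟩ := exists_norm_testToL6_le
  obtain ⟨G, hGt, hG⟩ := exists_lintegral_fderiv_smoothMul_le hA hB hcurl hV hs
  obtain ⟨c, hc⟩ := hV.continuous.bounded_above_of_compact_support hs
  have hc0 : 0 ≤ c := (norm_nonneg _).trans (hc 0)
  set g := G.toReal
  have hg0 : 0 ≤ g := ENNReal.toReal_nonneg
  set a := (c * S) ^ 6 with ha
  have ha0 : 0 ≤ a := by positivity
  -- The division cancels the factor 8 lost by averaging over cubes.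
  set δ := ε ^ 2 / 8 with hδ
  have hδ0 : 0 < δ := by positivity
  -- First r is taken large enough to make the L⁶ part small; the side t of the cubes is chosen
  -- afterwards, depending on r. The g + 1 in t avoids division by zero.
  obtain ⟨r, hr0, hr⟩ : ∃ r : ℝ, 0 < r ∧ 32 / r ^ 4 * (2 * a) ≤ δ / 2 := by
    have h1 : Tendsto (fun r : ℝ => 32 / r ^ 4 * (2 * a)) atTop (𝓝 (0 * (2 * a))) :=
      ((tendsto_const_nhds (x := (32 : ℝ))).div_atTop (tendsto_pow_atTop (by norm_num))).mul_const _
    rw [zero_mul] at h1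
    obtain ⟨r, h2, h3⟩ := ((h1.eventually_le_const (half_pos hδ0)).and
      (eventually_gt_atTop 0)).exists
    exact ⟨r, h3, h2⟩
  set t := δ / (4 * r * (g + 1)) with ht
  have ht0 : 0 < t := by positivity
  have htr : r * (2 * t * g) ≤ δ / 2 := by
    have : r * (2 * t * (g + 1)) = δ / 2 := by rw [ht]; field_simp; norm_num
    have : 0 < r * (2 * t) := by positivity
    nlinarith
  obtain ⟨W, hW, H⟩ := exists_stepMap_dist_le hs ht0
  refine ⟨W, hW, fun φ hφ => ?_⟩
  have hf : ContDiff ℝ 1 (smoothMul V φ) := hV.smul φ.contDiff_one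
  have hfs : HasCompactSupport (smoothMul V φ) := hs.smul_right
  have hf2 : MemLp (smoothMul V φ) 2 (volume : Measure R3) :=
    hf.continuous.memLp_of_hasCompactSupport hfs
  obtain ⟨w, hw, hle⟩ := H (smoothMul V φ) hf.continuous hfs
    (fun x hx => subset_tsupport _ fun h => hx (by simp [smoothMul, h])) hf2 δ hδ0.le fun z hz => by
      refine (lintegral_translate_sub_sq_le hf hr0 z).trans ?_
      have h6 : ∫⁻ x, ‖smoothMul V φ x‖ₑ ^ 6 ≤ ENNReal.ofReal a := by
        refine (lintegral_smoothMul_pow_six_le hc φ).trans (ENNReal.ofReal_le_ofReal ?_)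
        have : ‖testToL6 φ‖ ≤ S :=
          (hS A B hA hB hcurl φ).trans (mul_le_of_le_one_right hS0.le hφ)
        rw [ha]
        gcongr
      have hz' : ‖z‖ₑ ≤ ENNReal.ofReal (2 * t) := by
        rw [← ofReal_norm]; exact ENNReal.ofReal_le_ofReal hz
      have hG' : ∫⁻ x, ‖fderiv ℝ (smoothMul V φ) x‖ₑ ≤ ENNReal.ofReal g := by
        rw [ENNReal.ofReal_toReal hGt]; exact hG φ hφ
      calc _ ≤ ENNReal.ofReal r * (ENNReal.ofReal (2 * t) * ENNReal.ofReal g)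
            + ENNReal.ofReal (32 / r ^ 4) * (ENNReal.ofReal 2 * ENNReal.ofReal a) := by
              rw [ENNReal.ofReal_ofNat]
              gcongr
        _ = ENNReal.ofReal (r * (2 * t * g) + 32 / r ^ 4 * (2 * a)) := by
              rw [ENNReal.ofReal_add (by positivity) (by positivity), ENNReal.ofReal_mul hr0.le,
                ENNReal.ofReal_mul (p := 2 * t) (by positivity),
                ENNReal.ofReal_mul (p := 32 / r ^ 4) (by positivity),
                ENNReal.ofReal_mul (p := 2) (q := a) (by positivity)]
        _ ≤ ENNReal.ofReal δ := ENNReal.ofReal_le_ofReal (by linarith)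
  refine ⟨w, hw, ?_⟩
  have e : mulL3 hV3 (testToL6 φ) = hf2.toLp _ := by
    apply Lp.ext
    filter_upwards [coeFn_mulL3_testToL6 hV3 φ, hf2.coeFn_toLp] with x h1 h2
    rw [h1, h2]
    rfl
  rw [e]
  have : 8 * δ = ε ^ 2 := by rw [hδ]; ring
  rw [this] at hle
  exact (sq_le_sq₀ (norm_nonneg _) hε.le).1 hle

theorem exists_smooth_approx {V : R3 → ℂ} (hV : MemLp V 3 (volume : Measure R3)) {ε : ℝ}
    (hε : 0 < ε) : ∃ (V' : R3 → ℂ) (h' : MemLp V' 3 (volume : Measure R3)), ContDiff ℝ 1 V' ∧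
      HasCompactSupport V' ∧ ∀ u, ‖mulL3 hV u - mulL3 h' u‖ ≤ ε * ‖u‖ := by
  obtain ⟨V', h1, h2, h3⟩ := hV.exist_eLpNorm_sub_le (by simp) (by norm_num) hε
  have h' : MemLp V' 3 (volume : Measure R3) := h2.continuous.memLp_of_hasCompactSupport h1
  refine ⟨V', h', h2.of_le (by norm_cast), h1, fun u => ?_⟩
  have e : mulL3 hV u - mulL3 h' u = mulL3 (hV.sub h') u := by
    apply Lp.ext
    filter_upwards [Lp.coeFn_sub (mulL3 hV u) (mulL3 h' u), coeFn_mulL3 hV u, coeFn_mulL3 h' u,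
      coeFn_mulL3 (hV.sub h') u] with x a1 a2 a3 a4
    rw [a1, Pi.sub_apply, a2, a3, a4, Pi.sub_apply, sub_smul]
  rw [e]
  refine (norm_mulL3_apply_le _ u).trans ?_
  gcongr
  exact ENNReal.toReal_le_of_le_ofReal hε.le h3

/-- By Sobolev the energy ball is bounded in L⁶ by S, so replacing V by a smooth function at L³
distance ε/(2S) costs at most ε/2. -/
theorem exists_finiteDimensional_dist_mulL3_le {A B : R3 → R3} (hA : IsL2Loc A) (hB : IsL32 B)
    (hcurl : IsWeakCurl A B) {V : R3 → ℂ} (hV : MemLp V 3 (volume : Measure R3)) {ε : ℝ}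
    (hε : 0 < ε) :
    ∃ W : Submodule ℂ L2Spinor, FiniteDimensional ℂ W ∧ ∀ φ, energy hA hB φ ≤ 1 →
      ∃ w ∈ W, ‖mulL3 hV (testToL6 φ) - w‖ ≤ ε := by
  obtain ⟨S, hS0, hS⟩ := exists_norm_testToL6_le
  obtain ⟨V', h', h1, h2, h3⟩ := exists_smooth_approx hV (show 0 < ε / (2 * S) by positivity)
  obtain ⟨W, hW, H⟩ := exists_finiteDimensional_dist_smoothMul_le hA hB hcurl h1 h2 h' (half_pos hε)
  refine ⟨W, hW, fun φ hφ => ?_⟩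
  obtain ⟨w, hw, hle⟩ := H φ hφ
  refine ⟨w, hw, ?_⟩
  have h4 : ‖mulL3 hV (testToL6 φ) - mulL3 h' (testToL6 φ)‖ ≤ ε / 2 := by
    refine (h3 _).trans ?_
    have : ‖testToL6 φ‖ ≤ S :=
      (hS A B hA hB hcurl φ).trans (mul_le_of_le_one_right hS0.le hφ)
    calc ε / (2 * S) * ‖testToL6 φ‖ ≤ ε / (2 * S) * S := by gcongr
      _ = ε / 2 := by field_simp
  calc ‖mulL3 hV (testToL6 φ) - w‖
      ≤ ‖mulL3 hV (testToL6 φ) - mulL3 h' (testToL6 φ)‖ + ‖mulL3 h' (testToL6 φ) - w‖ :=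
        norm_sub_le_norm_sub_add_norm_sub _ _ _
    _ ≤ ε := by linarith

/-- A bounded operator into a Hilbert space is compact if the image of the unit ball of a dense
subspace is close to finite-dimensional subspaces. -/
theorem isCompactOperator_of_finiteDimensional_dist {E F : Type*} [NormedAddCommGroup E]
    [NormedSpace ℂ E] [NormedAddCommGroup F] [InnerProductSpace ℂ F] [CompleteSpace F]
    (M : E →L[ℂ] F) (D : Submodule ℂ E) (hD : Dense (D : Set E))
    (h : ∀ ε : ℝ, 0 < ε → ∃ W : Submodule ℂ F, FiniteDimensional ℂ W ∧ ∀ x ∈ D, ‖x‖ ≤ 1 →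
      ∃ w ∈ W, ‖M x - w‖ ≤ ε) : IsCompactOperator M := by
  have key : M ∈ closure {f : E →L[ℂ] F | IsCompactOperator f} := by
    rw [Metric.mem_closure_iff]
    intro ε hε
    obtain ⟨W, hW, H⟩ := h (ε / 2) (half_pos hε)
    -- Projecting onto W gives a finite-rank operator. The projection is the best approximation from
    -- W, hence at least as good as the approximant w rescaled from the unit ball.
    refine ⟨W.starProjection ∘L M, ?_, ?_⟩
    · have := FiniteDimensional.proper ℂ W
      exact (isCompactOperator_of_locallyCompactSpace_rng W.subtypeL).comp_clm
        (W.orthogonalProjectionOnto ∘L M)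
    · rw [dist_eq_norm]
      refine (ContinuousLinearMap.opNorm_le_bound _ (half_pos hε).le fun x => ?_).trans_lt
        (half_lt_self hε)
      refine hD.induction (P := fun x =>
        ‖(M - W.starProjection ∘L M) x‖ ≤ ε / 2 * ‖x‖) ?_ (isClosed_le (by fun_prop) (by fun_prop)) x
      intro x hx
      by_cases hx0 : x = 0
      · simp [hx0]
      have hn : 0 < ‖x‖ := norm_pos_iff.2 hx0
      obtain ⟨w, hw, hle⟩ := H (((‖x‖⁻¹ : ℝ) : ℂ) • x) (D.smul_mem _ hx) (by
        rw [norm_smul, Complex.norm_real, norm_inv, norm_norm, inv_mul_cancel₀ hn.ne'])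
      have h2 : ‖M x - W.starProjection (M x)‖ ≤ ‖M x - (‖x‖ : ℂ) • w‖ := by
        rw [W.starProjection_minimal]
        exact ciInf_le ⟨0, by rintro _ ⟨y, rfl⟩; positivity⟩ (⟨_, W.smul_mem (‖x‖ : ℂ) hw⟩ : W)
      have h3 : M x - (‖x‖ : ℂ) • w = (‖x‖ : ℂ) • (M (((‖x‖⁻¹ : ℝ) : ℂ) • x) - w) := by
        rw [smul_sub, map_smul, smul_smul]
        norm_cast
        rw [mul_inv_cancel₀ hn.ne']
        simp
      change ‖M x - W.starProjection (M x)‖ ≤ _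
      rw [h3, norm_smul, Complex.norm_real, norm_norm] at h2
      nlinarith
  exact isClosed_setOfPred_isCompactOperator.closure_subset key

/-! ### Closures of forms `φ, ψ ↦ ⟪T φ, T ψ⟫` -/

/-- The test spinor given by a smooth function with compact support. -/
def mkTestSpinor (f : R3 → C2) (hf : ContDiff ℝ (⊤ : ℕ∞) f) (hs : HasCompactSupport f) :
    TestSpinor :=
  ⟨f, hf, hs, Set.subset_univ _⟩

theorem denseRange_testToL2 : DenseRange testToL2 := by
  intro u
  rw [Metric.mem_closure_iff]
  intro ε hε
  obtain ⟨f, h1, h2, h3⟩ := (Lp.memLp u).exist_eLpNorm_sub_le (by simp) (by norm_num) (half_pos hε)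
  refine ⟨_, ⟨mkTestSpinor f h2 h1, rfl⟩, ?_⟩
  rw [dist_eq_norm, Lp.norm_def]
  refine (ENNReal.toReal_le_of_le_ofReal (half_pos hε).le ?_).trans_lt (half_lt_self hε)
  refine le_trans (le_of_eq (eLpNorm_congr_ae ?_)) h3
  filter_upwards [Lp.coeFn_sub u (testToL2 (mkTestSpinor f h2 h1)),
    (memLp_testSpinor (mkTestSpinor f h2 h1) 2).coeFn_toLp] with x a1 a2
  rw [a1, Pi.sub_apply, Pi.sub_apply]
  exact congrArg _ a2

section FormSpace

variable {K : Type*} [NormedAddCommGroup K] [InnerProductSpace ℂ K]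

/-- The map `φ ↦ (φ, T φ)`. -/
def graphMap (T : TestSpinor →ₗ[ℂ] K) : TestSpinor →ₗ[ℂ] WithLp 2 (L2Spinor × K) :=
  (WithLp.linearEquiv 2 ℂ (L2Spinor × K)).symm.toLinearMap ∘ₗ testToL2.prod T

/-- The closure of the graph of `T`: the domain of the closure of the form
`φ, ψ ↦ ⟪T φ, T ψ⟫`, equipped with the form norm. -/
def formSpace (T : TestSpinor →ₗ[ℂ] K) : Submodule ℂ (WithLp 2 (L2Spinor × K)) :=
  (LinearMap.range (graphMap T)).topologicalClosure

instance (T : TestSpinor →ₗ[ℂ] K) [CompleteSpace K] : CompleteSpace (formSpace T) :=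
  (Submodule.isClosed_topologicalClosure _).completeSpace_coe

/-- The inclusion of the form domain in `L²`. -/
def formIncl (T : TestSpinor →ₗ[ℂ] K) : formSpace T →L[ℂ] L2Spinor :=
  WithLp.fstL 2 ℂ L2Spinor K ∘L (formSpace T).subtypeL

/-- The closure of `T`. -/
def formMap (T : TestSpinor →ₗ[ℂ] K) : formSpace T →L[ℂ] K :=
  WithLp.sndL 2 ℂ L2Spinor K ∘L (formSpace T).subtypeL

/-- A test spinor as an element of the form domain. -/
def testToForm (T : TestSpinor →ₗ[ℂ] K) : TestSpinor →ₗ[ℂ] formSpace T :=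
  (graphMap T).codRestrict _ fun φ => Submodule.le_topologicalClosure _ ⟨φ, rfl⟩

variable (T : TestSpinor →ₗ[ℂ] K)

theorem inner_formSpace (v w : formSpace T) :
    ⟪v, w⟫_ℂ = ⟪formIncl T v, formIncl T w⟫_ℂ + ⟪formMap T v, formMap T w⟫_ℂ :=
  WithLp.prod_inner_apply (v : WithLp 2 (L2Spinor × K)) w

theorem exists_seq_testToForm (v : formSpace T) :
    ∃ φ : ℕ → TestSpinor, Tendsto (fun n => testToForm T (φ n)) atTop (𝓝 v) := by
  have hv : (v : WithLp 2 (L2Spinor × K)) ∈ closure (LinearMap.range (graphMap T) : Set _) := v.2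
  obtain ⟨x, hx, hlim⟩ := mem_closure_iff_seq_limit.1 hv
  choose φ hφ using hx
  refine ⟨φ, tendsto_subtype_rng.2 ?_⟩
  refine hlim.congr fun n => ?_
  rw [← hφ n]
  rfl

theorem denseRange_formIncl : DenseRange (formIncl T) :=
  denseRange_testToL2.mono (by rintro _ ⟨φ, rfl⟩; exact ⟨testToForm T φ, rfl⟩)

variable {T}

theorem exists_formSpace_of_tendsto {φ : ℕ → TestSpinor} {u : L2Spinor} {k : K}
    (hu : Tendsto (fun n => testToL2 (φ n)) atTop (𝓝 u))
    (hk : Tendsto (fun n => T (φ n)) atTop (𝓝 k)) :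
    ∃ v : formSpace T, formIncl T v = u ∧ formMap T v = k := by
  refine ⟨⟨WithLp.toLp 2 (u, k), ?_⟩, rfl, rfl⟩
  refine mem_closure_of_tendsto (b := atTop) (f := fun n => graphMap T (φ n)) ?_
    (Eventually.of_forall fun n => ⟨φ n, rfl⟩)
  exact ((WithLp.prodContinuousLinearEquiv 2 ℂ L2Spinor K).symm.continuous.tendsto _).comp
    (hu.prodMk_nhds hk)

/-- An operator on the test spinors is closable if its formal adjoint is densely defined. -/
theorem injective_formIncl
    (hT : Dense {e : K | ∃ f : L2Spinor, ∀ φ, ⟪e, T φ⟫_ℂ = ⟪f, testToL2 φ⟫_ℂ}) :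
    Function.Injective (formIncl T) := by
  rw [injective_iff_map_eq_zero]
  intro v hv
  have h0 : formMap T v = 0 := by
    refine hT.eq_zero_of_inner_right (𝕜 := ℂ) fun e he => ?_
    obtain ⟨f, hf⟩ := he
    obtain ⟨φ, hφ⟩ := exists_seq_testToForm T v
    have h1 : Tendsto (fun n => ⟪e, T (φ n)⟫_ℂ) atTop (𝓝 ⟪e, formMap T v⟫_ℂ) :=
      tendsto_const_nhds.inner (((formMap T).continuous.tendsto v).comp hφ)
    have h2 : Tendsto (fun n => ⟪f, testToL2 (φ n)⟫_ℂ) atTop (𝓝 ⟪f, formIncl T v⟫_ℂ) :=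
      tendsto_const_nhds.inner (((formIncl T).continuous.tendsto v).comp hφ)
    rw [hv, inner_zero_right] at h2
    exact tendsto_nhds_unique h1 (h2.congr fun n => (hf _).symm)
  have := inner_formSpace T v v
  rw [hv, h0, inner_zero_right, inner_zero_right, add_zero] at this
  exact (inner_self_eq_zero (𝕜 := ℂ)).1 this

variable [CompleteSpace K] {a : TestForm} {ha : ∀ φ, 0 ≤ (a φ φ).re} (haT : ∀ φ ψ, a φ ψ = ⟪T φ, T ψ⟫_ℂ)

include haT

/-- For a form ⟪Tφ, Tψ⟫, being Cauchy in the form means that Tφ_n is Cauchy. Form convergence is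
thus convergence in the closed graph of T. -/
theorem formConverges_iff {φ : ℕ → TestSpinor} {u : L2Spinor} :
    FormConverges a φ u ↔ ∃ v : formSpace T, formIncl T v = u ∧
      Tendsto (fun n => testToL2 (φ n)) atTop (𝓝 (formIncl T v)) ∧
      Tendsto (fun n => T (φ n)) atTop (𝓝 (formMap T v)) := by
  have hre : ∀ φ, (a φ φ).re = ‖T φ‖ ^ 2 := fun φ => by
    rw [haT, norm_sq_eq_re_inner (𝕜 := ℂ)]
    rfl
  constructor
  · rintro ⟨h1, h2⟩
    have hc : CauchySeq fun n => T (φ n) := by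
      rw [cauchySeq_iff_tendsto, tendsto_uniformity_iff_dist_tendsto_zero,
        ← prod_atTop_atTop_eq]
      rw [← prod_atTop_atTop_eq] at h2
      have := h2.sqrt
      rw [Real.sqrt_zero] at this
      refine this.congr fun mn => ?_
      rw [hre, Real.sqrt_sq (norm_nonneg _), map_sub, dist_eq_norm]
      rfl
    obtain ⟨k, hk⟩ := cauchySeq_tendsto_of_complete hc
    obtain ⟨v, hv1, hv2⟩ := exists_formSpace_of_tendsto h1 hk
    exact ⟨v, hv1, hv1 ▸ h1, hv2 ▸ hk⟩
  · rintro ⟨v, rfl, h1, h2⟩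
    refine ⟨h1, ?_⟩
    have hc := h2.cauchySeq
    rw [cauchySeq_iff_tendsto, tendsto_uniformity_iff_dist_tendsto_zero] at hc
    have := hc.pow 2
    rw [zero_pow two_ne_zero] at this
    refine this.congr fun mn => ?_
    rw [hre, map_sub, ← dist_eq_norm]
    rfl

theorem mem_formOperatorGraph_iff {u w : L2Spinor} : (u, w) ∈ formOperatorGraph a ha ↔
    ∃ v, formIncl T v = u ∧ ∀ v', ⟪formMap T v', formMap T v⟫_ℂ = ⟪formIncl T v', w⟫_ℂ := by
  constructor
  · rintro ⟨φ, h1, h2⟩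
    obtain ⟨v, hv, -, hv2⟩ := (formConverges_iff haT).1 h1
    refine ⟨v, hv, fun v' => ?_⟩
    obtain ⟨ψ, hψ⟩ := exists_seq_testToForm T v'
    have e1 := ((formIncl T).continuous.tendsto v').comp hψ
    have e2 := ((formMap T).continuous.tendsto v').comp hψ
    refine tendsto_nhds_unique (e2.inner hv2) ?_
    exact (h2 ψ _ ((formConverges_iff haT).2 ⟨v', rfl, e1, e2⟩)).congr fun n => haT _ _
  · rintro ⟨v, rfl, h⟩
    obtain ⟨φ, hφ⟩ := exists_seq_testToForm T v
    have e1 := ((formIncl T).continuous.tendsto v).comp hφ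
    have e2 := ((formMap T).continuous.tendsto v).comp hφ
    refine ⟨φ, (formConverges_iff haT).2 ⟨v, rfl, e1, e2⟩, fun ψ x hx => ?_⟩
    obtain ⟨v', rfl, -, h'⟩ := (formConverges_iff haT).1 hx
    rw [← h v']
    exact (h'.inner e2).congr fun n => (haT _ _).symm

/-- Closability of T, in the form of injectivity of the inclusion, makes the graph single-valued: u
= 0 forces v = 0, and then w is orthogonal to a dense set. -/
theorem mem_formOperator_graph_iff (hT : Function.Injective (formIncl T)) {u w : L2Spinor} :
    (u, w) ∈ (formOperator a ha).graph ↔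
      ∃ v, formIncl T v = u ∧ ∀ v', ⟪formMap T v', formMap T v⟫_ℂ = ⟪formIncl T v', w⟫_ℂ := by
  rw [← mem_formOperatorGraph_iff haT (ha := ha), formOperator, Submodule.toLinearPMap_graph_eq]
  rintro ⟨x, y⟩ hx (rfl : x = 0)
  obtain ⟨v, hv, h⟩ := (mem_formOperatorGraph_iff haT).1 hx
  have hv0 : v = 0 := hT (by rw [hv, map_zero])
  refine (denseRange_formIncl T).eq_zero_of_inner_right (𝕜 := ℂ) ?_
  intro v'
  rw [← h v', hv0, map_zero, inner_zero_right]

omit haT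

variable (T) in
theorem exists_selfAdjoint_sq_formMap :
    ∃ R : L2Spinor →ₗ.[ℂ] L2Spinor, IsSelfAdjoint R ∧
      (∀ u : R.domain, 0 ≤ (⟪(u : L2Spinor), R u⟫_ℂ).re) ∧
      ∀ u w, (∃ v, (u, v) ∈ R.graph ∧ (v, w) ∈ R.graph) ↔
        ∃ v, formIncl T v = u ∧ ∀ v', ⟪formMap T v', formMap T v⟫_ℂ = ⟪formIncl T v', w⟫_ℂ :=
  exists_selfAdjoint_sq_form (inner_formSpace T) (denseRange_formIncl T)

theorem formSpace_eq_domain_sqrt (hT : Function.Injective (formIncl T))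
    {R : L2Spinor →ₗ.[ℂ] L2Spinor} (hR : IsSelfAdjoint R)
    (hsq : ∀ u w, (∃ v, (u, v) ∈ R.graph ∧ (v, w) ∈ R.graph) ↔
        ∃ v, formIncl T v = u ∧ ∀ v', ⟪formMap T v', formMap T v⟫_ℂ = ⟪formIncl T v', w⟫_ℂ) :
    (∀ v, ∃ w, (formIncl T v, w) ∈ R.graph ∧ ‖w‖ = ‖formMap T v‖) ∧
      ∀ x ∈ R.domain, ∃ v, formIncl T v = x :=
  formDomain_eq_domain_sqrt (inner_formSpace T) hT hR hsq

end FormSpace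

/-- The kernel of a partially defined operator has the dimension of its image in `L²`. -/
theorem nullity_eq_rank {T : L2Spinor →ₗ.[ℂ] L2Spinor} {N : Submodule ℂ L2Spinor}
    (h : ∀ u, u ∈ N ↔ (u, 0) ∈ T.graph) : nullity T = Module.rank ℂ N := by
  let f : LinearMap.ker T.toFun →ₗ[ℂ] L2Spinor := T.domain.subtype ∘ₗ Submodule.subtype _
  have hf : Function.Injective f := Subtype.val_injective.comp Subtype.val_injective
  have hr : LinearMap.range f = N := by
    ext u
    rw [h, LinearPMap.mem_graph_iff]
    constructor
    · rintro ⟨⟨x, hx⟩, rfl⟩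
      exact ⟨x, rfl, hx⟩
    · rintro ⟨x, hx, h0⟩
      exact ⟨⟨x, h0⟩, hx⟩
  rw [nullity, ← hr]
  exact (LinearEquiv.ofInjective f hf).rank_eq

/-! ### The two forms -/

section PauliForms

variable {A B : R3 → R3} (hA : IsL2Loc A) (hB : IsL32 B)

/-- A symmetric operator is closable: its formal adjoint is defined on the dense set of test
spinors. -/
theorem injective_formIncl_weylDirac : Function.Injective (formIncl (weylDirac hA)) := by
  refine injective_formIncl (denseRange_testToL2.mono ?_)
  rintro _ ⟨ψ, rfl⟩
  exact ⟨weylDirac hA ψ, fun φ => (inner_weylDirac_comm hA φ ψ).symm⟩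

/-- The map `φ ↦ (σ · ((1/i)∇ + A) φ, |B|^{1/2} φ)`. -/
def energyMap : TestSpinor →ₗ[ℂ] WithLp 2 (L2Spinor × L2Spinor) :=
  (WithLp.linearEquiv 2 ℂ (L2Spinor × L2Spinor)).symm.toLinearMap ∘ₗ
    (weylDirac hA).prod (sqrtFieldMul hB)

theorem inner_energyMap (φ ψ : TestSpinor) : ⟪energyMap hA hB φ, energyMap hA hB ψ⟫_ℂ =
    ⟪weylDirac hA φ, weylDirac hA ψ⟫_ℂ + ⟪sqrtFieldMul hB φ, sqrtFieldMul hB ψ⟫_ℂ :=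
  WithLp.prod_inner_apply _ _

theorem norm_energyMap (φ : TestSpinor) : ‖energyMap hA hB φ‖ = energy hA hB φ := by
  rw [energy, eq_comm, Real.sqrt_eq_iff_eq_sq (by positivity) (norm_nonneg _)]
  exact (WithLp.prod_norm_sq_eq_of_L2 (energyMap hA hB φ)).symm

/-- The formal adjoint sends a pair (ψ, χ) of test spinors to Dψ + |B|^{1/2}χ. -/
theorem injective_formIncl_energyMap : Function.Injective (formIncl (energyMap hA hB)) := by
  have hd : DenseRange ((WithLp.prodContinuousLinearEquiv 2 ℂ L2Spinor L2Spinor).symm ∘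
      Prod.map testToL2 testToL2) :=
    (WithLp.prodContinuousLinearEquiv 2 ℂ L2Spinor L2Spinor).symm.surjective.denseRange.comp
      (denseRange_testToL2.prodMap denseRange_testToL2)
      (WithLp.prodContinuousLinearEquiv 2 ℂ L2Spinor L2Spinor).symm.continuous
  refine injective_formIncl (hd.mono ?_)
  rintro _ ⟨⟨ψ, χ⟩, rfl⟩
  refine ⟨weylDirac hA ψ + sqrtFieldMul hB χ, fun φ => ?_⟩
  rw [inner_add_left, inner_weylDirac_comm, inner_sqrtFieldMul_comm]
  exact WithLp.prod_inner_apply _ _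

/-- Testing the form equation with v itself shows that zero modes are annihilated by the first-order
closure, so second-order information is never needed. -/
theorem mem_pauliOperator_graph_iff {u : L2Spinor} : (u, 0) ∈ (pauliOperator hA).graph ↔
    ∃ v, formIncl (weylDirac hA) v = u ∧ formMap (weylDirac hA) v = 0 := by
  rw [pauliOperator, mem_formOperator_graph_iff (T := weylDirac hA) (fun _ _ => rfl)
    (injective_formIncl_weylDirac hA)]
  refine exists_congr fun v => and_congr_right fun _ => ⟨fun h => ?_, fun h v' => ?_⟩
  · have := h v
    rwa [inner_zero_right, inner_self_eq_zero] at this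
  · rw [h, inner_zero_right, inner_zero_right]

theorem mem_pauliPlusField_graph_iff {u w : L2Spinor} : (u, w) ∈ (pauliPlusField hA hB).graph ↔
    ∃ v, formIncl (energyMap hA hB) v = u ∧ ∀ v', ⟪formMap (energyMap hA hB) v',
      formMap (energyMap hA hB) v⟫_ℂ = ⟪formIncl (energyMap hA hB) v', w⟫_ℂ :=
  mem_formOperator_graph_iff (T := energyMap hA hB) (fun φ ψ => (inner_energyMap hA hB φ ψ).symm)
    (injective_formIncl_energyMap hA hB)

theorem exists_isNonnegSqrt : ∃ R, IsNonnegSqrt R (pauliPlusField hA hB) := by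
  obtain ⟨R, h1, h2, h3⟩ := exists_selfAdjoint_sq_formMap (energyMap hA hB)
  exact ⟨R, h1, h2, fun u w => (mem_pauliPlusField_graph_iff hA hB).trans (h3 u w).symm⟩

end PauliForms

/-! ### The domain of the square root and its completion `ℍ¹_B` -/

/-- Linear maps with the same norms have the same inner products. -/
theorem inner_eq_of_norm_eq {E X Y : Type*} [AddCommGroup E] [Module ℂ E] [SeminormedAddCommGroup X]
    [InnerProductSpace ℂ X] [SeminormedAddCommGroup Y] [InnerProductSpace ℂ Y] (f : E →ₗ[ℂ] X)
    (g : E →ₗ[ℂ] Y) (h : ∀ x, ‖f x‖ = ‖g x‖) (x y : E) : ⟪f x, f y⟫_ℂ = ⟪g x, g y⟫_ℂ := by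
  rw [inner_eq_sum_norm_sq_div_four, inner_eq_sum_norm_sq_div_four]
  simp only [← map_smul, ← map_add, ← map_sub, h]

/-- Both convergences imply convergence in measure, where limits are unique almost everywhere. -/
theorem ae_eq_of_tendsto {φ : ℕ → TestSpinor} {u : L2Spinor} {f : L6Spinor}
    (hu : Tendsto (fun n => testToL2 (φ n)) atTop (𝓝 u))
    (hf : Tendsto (fun n => testToL6 (φ n)) atTop (𝓝 f)) : f =ᵐ[volume] u := by
  have h1 : TendstoInMeasure volume (fun n => (φ n : R3 → C2)) atTop u :=
    (tendstoInMeasure_of_tendsto_Lp hu).congr_left fun n => (memLp_testSpinor (φ n) 2).coeFn_toLp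
  have h2 : TendstoInMeasure volume (fun n => (φ n : R3 → C2)) atTop f :=
    (tendstoInMeasure_of_tendsto_Lp hf).congr_left fun n => (memLp_testSpinor (φ n) 6).coeFn_toLp
  exact tendstoInMeasure_ae_unique h2 h1

section SqrtDomain

variable {A B : R3 → R3} {hA : IsL2Loc A} {hB : IsL32 B} {R : L2Spinor →ₗ.[ℂ] L2Spinor}

theorem IsNonnegSqrt.formDomain_eq (hR : IsNonnegSqrt R (pauliPlusField hA hB)) :
    (∀ v, ∃ w, (formIncl (energyMap hA hB) v, w) ∈ R.graph ∧ ‖w‖ = ‖formMap (energyMap hA hB) v‖) ∧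
      ∀ x ∈ R.domain, ∃ v, formIncl (energyMap hA hB) v = x :=
  formSpace_eq_domain_sqrt (injective_formIncl_energyMap hA hB)
    hR.selfAdjoint fun u w => (hR.sq u w).symm.trans (mem_pauliPlusField_graph_iff hA hB)

variable (hR : IsNonnegSqrt R (pauliPlusField hA hB))

/-- The form domain, as the domain of `R`. -/
def formToDomain : formSpace (energyMap hA hB) →ₗ[ℂ] NormedDomain R :=
  LinearMap.codRestrict R.domain (formIncl (energyMap hA hB)).toLinearMap fun v => by
    obtain ⟨w, hw, -⟩ := hR.formDomain_eq.1 v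
    exact R.mem_domain_of_mem_graph hw

theorem norm_formToDomain (v : formSpace (energyMap hA hB)) :
    ‖formToDomain hR v‖ = ‖formMap (energyMap hA hB) v‖ := by
  obtain ⟨w, hw, h⟩ := hR.formDomain_eq.1 v
  rw [← h]
  obtain ⟨y, hy, rfl⟩ := (LinearPMap.mem_graph_iff _).1 hw
  have : formToDomain hR v = y := Subtype.ext hy.symm
  rw [this]
  rfl

theorem surjective_formToDomain : Function.Surjective (formToDomain hR) := by
  intro x
  obtain ⟨v, hv⟩ := hR.formDomain_eq.2 _ x.2
  exact ⟨v, Subtype.ext hv⟩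

/-- Test spinors as elements of the domain of `R`. -/
def testToDomain : TestSpinor →ₗ[ℂ] NormedDomain R :=
  formToDomain hR ∘ₗ testToForm (energyMap hA hB)

theorem norm_testToDomain (φ : TestSpinor) : ‖testToDomain hR φ‖ = energy hA hB φ :=
  (norm_formToDomain hR _).trans (norm_energyMap hA hB φ)

theorem exists_seq_testToDomain (u : NormedDomain R) : ∃ φ : ℕ → TestSpinor,
    Tendsto (fun n => testToL2 (φ n)) atTop (𝓝 u.val) ∧
      Tendsto (fun n => testToDomain hR (φ n)) atTop (𝓝 u) := by
  obtain ⟨v, rfl⟩ := surjective_formToDomain hR u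
  obtain ⟨φ, hφ⟩ := exists_seq_testToForm (energyMap hA hB) v
  refine ⟨φ, ((formIncl (energyMap hA hB)).continuous.tendsto v).comp hφ, ?_⟩
  rw [tendsto_iff_norm_sub_tendsto_zero]
  have := (tendsto_iff_norm_sub_tendsto_zero.1
    (((formMap (energyMap hA hB)).continuous.tendsto v).comp hφ))
  refine this.congr fun n => ?_
  rw [testToDomain, LinearMap.comp_apply, ← map_sub, norm_formToDomain, map_sub]
  rfl

/-- The canonical map from the domain of `R` to the completion, as a linear isometry. -/
def domainToH1 (R : L2Spinor →ₗ.[ℂ] L2Spinor) : NormedDomain R →ₗᵢ[ℂ] H1 R :=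
  UniformSpace.Completion.toComplₗᵢ

theorem denseRange_toH1 : DenseRange (toH1 : NormedDomain R → H1 R) :=
  UniformSpace.Completion.denseRange_coe

/-- Test spinors as elements of `ℍ¹_B`. -/
def testToH1 : TestSpinor →ₗ[ℂ] H1 R := (domainToH1 R).toLinearMap ∘ₗ testToDomain hR

theorem norm_testToH1 (φ : TestSpinor) : ‖testToH1 hR φ‖ = energy hA hB φ :=
  ((domainToH1 R).norm_map _).trans (norm_testToDomain hR φ)

theorem denseRange_testToH1 : DenseRange (testToH1 hR) := by
  refine (denseRange_toH1 (R := R)).comp (g := toH1) (f := testToDomain hR) ?_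
    (domainToH1 R).continuous
  intro u
  obtain ⟨φ, -, hφ⟩ := exists_seq_testToDomain hR u
  exact mem_closure_of_tendsto hφ (Eventually.of_forall fun n => ⟨φ n, rfl⟩)

theorem inner_testToH1 (φ ψ : TestSpinor) : ⟪testToH1 hR φ, testToH1 hR ψ⟫_ℂ =
    ⟪weylDirac hA φ, weylDirac hA ψ⟫_ℂ + ⟪sqrtFieldMul hB φ, sqrtFieldMul hB ψ⟫_ℂ := by
  rw [← inner_energyMap]
  exact inner_eq_of_norm_eq _ _ (fun x => by rw [norm_testToH1, norm_energyMap]) _ _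

/-- The Sobolev inequality on the domain of `R`. -/
theorem exists_memLp_six (hR : IsNonnegSqrt R (pauliPlusField hA hB)) (hcurl : IsWeakCurl A B) : ∃ C : ℝ, 0 < C ∧ ∀ u : NormedDomain R,
    ∃ h : MemLp u.val 6 (volume : Measure R3), ‖h.toLp _‖ ≤ C * ‖u‖ := by
  obtain ⟨C, hC0, hC⟩ := exists_norm_testToL6_le
  refine ⟨C, hC0, fun u => ?_⟩
  obtain ⟨φ, h1, h2⟩ := exists_seq_testToDomain hR u
  have hle : ∀ φ, ‖testToL6 φ‖ ≤ C * ‖testToDomain hR φ‖ := fun φ => by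
    rw [norm_testToDomain]
    exact hC A B hA hB hcurl φ
  have hc : CauchySeq fun n => testToL6 (φ n) := by
    have h3 := h2.cauchySeq
    rw [Metric.cauchySeq_iff'] at h3 ⊢
    intro ε hε
    obtain ⟨N, hN⟩ := h3 (ε / C) (by positivity)
    refine ⟨N, fun n hn => ?_⟩
    have := hN n hn
    rw [dist_eq_norm, ← map_sub] at this ⊢
    rw [lt_div_iff₀' hC0] at this
    exact (hle _).trans_lt this
  obtain ⟨f, hf⟩ := cauchySeq_tendsto_of_complete hc
  have hfu := ae_eq_of_tendsto h1 hf
  have hm : MemLp u.val 6 (volume : Measure R3) := (Lp.memLp f).ae_eq hfu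
  refine ⟨hm, ?_⟩
  have e : hm.toLp _ = f := Lp.ext (hm.coeFn_toLp.trans hfu.symm)
  rw [e]
  exact le_of_tendsto_of_tendsto' hf.norm (h2.norm.const_mul C) fun n => hle _

/-- By self-adjointness the orthogonal complement of the range of R is its kernel, and Ru = 0 forces
u = 0 in L⁶ by the Sobolev inequality. -/
theorem denseRange_apply (hR : IsNonnegSqrt R (pauliPlusField hA hB)) (hcurl : IsWeakCurl A B) :
    DenseRange (NormedDomain.apply : NormedDomain R → L2Spinor) := by
  have hdense : Dense (R.domain : Set L2Spinor) := hR.selfAdjoint.dense_domain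
  have h0 : (LinearMap.range (NormedDomain.apply (R := R)))ᗮ = ⊥ := by
    rw [eq_bot_iff]
    intro w hw
    have hw' : ∀ x : R.domain, ⟪w, R x⟫_ℂ = 0 := fun x =>
      inner_eq_zero_symm.1 (hw (R x) ⟨x, rfl⟩)
    have hadj : LinearPMap.adjoint R = R := LinearPMap.isSelfAdjoint_def.1 hR.selfAdjoint
    have hmem : w ∈ (LinearPMap.adjoint R).domain :=
      LinearPMap.mem_adjoint_domain_of_exists w ⟨0, fun x => by rw [hw', inner_zero_left]⟩
    have hzero : LinearPMap.adjoint R ⟨w, hmem⟩ = 0 :=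
      LinearPMap.adjoint_apply_eq hdense _ fun x => by rw [inner_zero_left]; exact (hw' x).symm
    have hg : (w, (0 : L2Spinor)) ∈ R.graph := by
      rw [← hadj]
      exact (LinearPMap.mem_graph_iff _).2 ⟨⟨w, hmem⟩, rfl, hzero⟩
    obtain ⟨y, rfl, hy⟩ := (LinearPMap.mem_graph_iff _).1 hg
    obtain ⟨C, -, hC⟩ := exists_memLp_six hR hcurl
    obtain ⟨hm, hle⟩ := hC y
    have hn : ‖(show NormedDomain R from y)‖ = 0 := norm_eq_zero.2 hy
    have h6 : hm.toLp _ = 0 := by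
      refine norm_le_zero_iff.1 (hle.trans (le_of_eq ?_))
      rw [mul_eq_zero]
      exact Or.inr hn
    refine Lp.ext ?_
    have h7 : NormedDomain.val (R := R) y =ᵐ[volume] (0 : L6Spinor) := h6 ▸ hm.coeFn_toLp.symm
    exact (h7.trans (Lp.coeFn_zero _ _ _)).trans (Lp.coeFn_zero _ _ _).symm
  have := Submodule.topologicalClosure_eq_top_iff.2 h0
  exact Submodule.dense_iff_topologicalClosure_eq_top.2 this

/-- The unitary extension of `R` to `ℍ¹_B`. -/
theorem exists_unitary (hR : IsNonnegSqrt R (pauliPlusField hA hB)) (hcurl : IsWeakCurl A B) :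
    ∃ U : L2Spinor ≃ₗᵢ[ℂ] H1 R, ∀ u : NormedDomain R, U u.apply = toH1 u := by
  have hd : DenseRange (domainToH1 R).toLinearMap := denseRange_toH1
  have hb : ∀ u, ‖NormedDomain.apply u‖ ≤ 1 * ‖(domainToH1 R).toLinearMap u‖ := fun u => by
    rw [one_mul]
    exact ((domainToH1 R).norm_map u).ge
  -- The isometric extension of R to the completion. Its range is closed, as for any isometry on a
  -- complete space, and dense, hence everything; U is its inverse.
  set W := (NormedDomain.apply (R := R)).extendOfNorm (domainToH1 R).toLinearMap
  have hW : ∀ u, W (toH1 u) = NormedDomain.apply u := fun u =>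
    LinearMap.extendOfNorm_eq hd ⟨1, hb⟩ u
  have hnorm : ∀ x, ‖W x‖ = ‖x‖ := by
    intro x
    refine isClosed_property denseRange_toH1 (p := fun x => ‖W x‖ = ‖x‖)
      (isClosed_eq (by fun_prop) (by fun_prop)) (fun u => ?_) x
    rw [hW]
    exact ((domainToH1 R).norm_map u).symm
  let W' : H1 R →ₗᵢ[ℂ] L2Spinor := ⟨W.toLinearMap, hnorm⟩
  have hsurj : Function.Surjective W' := by
    rw [← Set.range_eq_univ, ← W'.isometry.isClosedEmbedding.isClosed_range.closure_eq]
    refine ((denseRange_apply hR hcurl).mono ?_).closure_eq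
    rintro _ ⟨u, rfl⟩
    exact ⟨toH1 u, hW u⟩
  refine ⟨(LinearIsometryEquiv.ofSurjective W' hsurj).symm, fun u => ?_⟩
  rw [LinearIsometryEquiv.symm_apply_eq]
  exact (hW u).symm

theorem exists_embedding (hR : IsNonnegSqrt R (pauliPlusField hA hB)) (hcurl : IsWeakCurl A B) :
    ∃ J : H1 R →L[ℂ] L6Spinor, ∀ u : NormedDomain R, J (toH1 u) =ᵐ[volume] u.val := by
  obtain ⟨C, -, hC⟩ := exists_memLp_six hR hcurl
  choose hm hle using hC
  let f : NormedDomain R →ₗ[ℂ] L6Spinor :=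
    { toFun := fun u => (hm u).toLp _
      map_add' := fun u v => by
        rw [← MemLp.toLp_add]
        refine MemLp.toLp_congr _ _ ?_
        rw [map_add]
        exact Lp.coeFn_add _ _
      map_smul' := fun c u => by
        rw [RingHom.id_apply, ← MemLp.toLp_const_smul]
        refine MemLp.toLp_congr _ _ ?_
        rw [map_smul]
        exact Lp.coeFn_smul _ _ }
  have hd : DenseRange (domainToH1 R).toLinearMap := denseRange_toH1
  refine ⟨f.extendOfNorm (domainToH1 R).toLinearMap, fun u => ?_⟩
  have h : f.extendOfNorm (domainToH1 R).toLinearMap (toH1 u) = f u :=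
    LinearMap.extendOfNorm_eq hd ⟨C, fun u => (hle u).trans (le_of_eq ?_)⟩ u
  · rw [h]
    exact (hm u).coeFn_toLp
  · exact congrArg _ ((domainToH1 R).norm_map u).symm

end SqrtDomain

/-! ### Existence of the Birman–Schwinger objects -/

/-- `‖|B|^{1/2} u‖² = ∫ |B| |u|²`. -/
theorem inner_mulL3_sqrt_self {B : R3 → R3} (hB : IsL32 B) (u : L6Spinor) :
    ⟪mulL3 (memLp_sqrt_norm hB) u, mulL3 (memLp_sqrt_norm hB) u⟫_ℂ =
      ((∫ x, ‖B x‖ * ‖u x‖ ^ 2 : ℝ) : ℂ) := by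
  rw [L2.inner_def, ← integral_complex_ofReal]
  refine integral_congr_ae ?_
  filter_upwards [coeFn_mulL3 (memLp_sqrt_norm hB) u] with x hx
  rw [hx, inner_self_eq_norm_sq_to_K, norm_smul, Complex.norm_real, Real.norm_eq_abs,
    abs_of_nonneg (Real.sqrt_nonneg _)]
  norm_cast
  rw [mul_pow, Real.sq_sqrt (norm_nonneg _)]
  rfl

theorem exists_isBirmanSchwinger {A B : R3 → R3} (hA : IsL2Loc A) (hB : IsL32 B)
    (hcurl : IsWeakCurl A B) : ∃ R J 𝓑 U S, IsBirmanSchwinger hA hB R J 𝓑 U S := by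
  obtain ⟨R, hR⟩ := exists_isNonnegSqrt hA hB
  obtain ⟨U, hU⟩ := exists_unitary hR hcurl
  obtain ⟨J, hJ⟩ := exists_embedding hR hcurl
  let M : H1 R →L[ℂ] L2Spinor := mulL3 (memLp_sqrt_norm hB) ∘L J
  refine ⟨R, J, (M†) ∘L M, U, M ∘L U.toContinuousLinearEquiv.toContinuousLinearMap, hR, hJ,
    ?_, fun u => ?_, hU, fun f => coeFn_mulL3 _ _⟩
  · rw [ContinuousLinearMap.isSelfAdjoint_iff_isSymmetric]
    exact fun x y => by simp [ContinuousLinearMap.adjoint_inner_left, ContinuousLinearMap.adjoint_inner_right]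
  · rw [ContinuousLinearMap.comp_apply, ContinuousLinearMap.adjoint_inner_left]
    exact inner_mulL3_sqrt_self hB (J u)

/-! ### Multiplication by cutoff functions -/

/-- Dilations of one bump function: V_n(x) = f(x/(n + 1)), so the chain rule yields the gradient
decay. -/
theorem exists_cutoff : ∃ V : ℕ → R3 → ℂ, (∀ n, ContDiff ℝ (⊤ : ℕ∞) (V n)) ∧
    (∀ n, HasCompactSupport (V n)) ∧ (∀ n x, ‖V n x‖ ≤ 1) ∧
    (∃ C : ℝ, ∀ n x j, ‖fderiv ℝ (V n) x (basisVec j)‖ ≤ C / ((n : ℝ) + 1)) ∧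
    ∀ x, Tendsto (fun n => V n x) atTop (𝓝 1) := by
  let f : ContDiffBump (0 : R3) := ⟨1, 2, one_pos, one_lt_two⟩
  let g : R3 → ℂ := fun x => ((f x : ℝ) : ℂ)
  have hg : ContDiff ℝ (⊤ : ℕ∞) g := Complex.ofRealCLM.contDiff.comp f.contDiff
  have hgs : HasCompactSupport g := f.hasCompactSupport.comp_left (g := fun t : ℝ => (t : ℂ)) (by simp)
  obtain ⟨C, hC⟩ := (hg.continuous_fderiv (by simp)).bounded_above_of_compact_support
    (hgs.fderiv (𝕜 := ℝ))
  have hn : ∀ n : ℕ, (0 : ℝ) < (n : ℝ) + 1 := fun n => by positivity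
  refine ⟨fun n x => g (((n : ℝ) + 1)⁻¹ • x), fun n => hg.comp (contDiff_const_smul _),
    fun n => hgs.comp_smul (inv_ne_zero (hn n).ne'), fun n x => ?_, ⟨C, fun n x j => ?_⟩,
    fun x => ?_⟩
  · simp only [g, Complex.norm_real, Real.norm_eq_abs, abs_of_nonneg f.nonneg]
    exact f.le_one
  · rw [fderiv_comp_smul (f := g), smul_apply, norm_smul, norm_inv, Real.norm_of_nonneg (hn n).le,
      div_eq_inv_mul]
    refine mul_le_mul_of_nonneg_left ?_ (by positivity)
    refine ((fderiv ℝ g _).le_opNorm _).trans ?_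
    simpa [basisVec] using hC (((n : ℝ) + 1)⁻¹ • x)
  · refine tendsto_const_nhds.congr' ?_
    obtain ⟨N, hN⟩ := exists_nat_ge ‖x‖
    filter_upwards [eventually_ge_atTop N] with n hle
    have hx : ((n : ℝ) + 1)⁻¹ • x ∈ Metric.closedBall (0 : R3) f.rIn := by
      rw [mem_closedBall_zero_iff, norm_smul, norm_inv, Real.norm_of_nonneg (hn n).le,
        inv_mul_le_iff₀ (hn n)]
      have : (N : ℝ) ≤ n := by exact_mod_cast hle
      change ‖x‖ ≤ ((n : ℝ) + 1) * 1
      linarith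
    simp [g, f.one_of_mem_closedBall hx]

theorem norm_mulL3_apply_le_of_bound {V : R3 → ℂ} (hV : MemLp V 3 (volume : Measure R3)) {c : ℝ}
    (hc : ∀ x, ‖V x‖ ≤ c) {u : L6Spinor} {g : L2Spinor} (hu : u =ᵐ[volume] g) :
    ‖mulL3 hV u‖ ≤ c * ‖g‖ := by
  refine Lp.norm_le_mul_norm_of_ae_le_mul ?_
  filter_upwards [coeFn_mulL3 hV u, hu] with x h1 h2
  rw [h1, h2, norm_smul]
  exact mul_le_mul_of_nonneg_right (hc x) (norm_nonneg _)

theorem testToL6_ae_eq_testToL2 (φ : TestSpinor) : testToL6 φ =ᵐ[volume] testToL2 φ :=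
  (memLp_testSpinor φ 6).coeFn_toLp.trans (memLp_testSpinor φ 2).coeFn_toLp.symm

/-- The product of a test spinor with a smooth function of compact support. -/
def mulTest {V : R3 → ℂ} (hV : ContDiff ℝ (⊤ : ℕ∞) V) (hs : HasCompactSupport V) (φ : TestSpinor) :
    TestSpinor :=
  mkTestSpinor (smoothMul V φ) (hV.smul φ.contDiff) hs.smul_right

section Cutoff

variable {V : R3 → ℂ} (hV : ContDiff ℝ (⊤ : ℕ∞) V) (hs : HasCompactSupport V)

include hV hs in
theorem memLp_fderiv_apply_three (j : Fin 3) :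
    MemLp (fun x => (1 / Complex.I) * fderiv ℝ V x (basisVec j)) 3 (volume : Measure R3) :=
  MemLp.const_mul (((hV.continuous_fderiv (by simp)).clm_apply
    continuous_const).memLp_of_hasCompactSupport (hs.fderiv_apply (𝕜 := ℝ) _)) _

/-- Multiplication by the matrix-valued function `σ · (1/i)∇V`. -/
def gradMul : L6Spinor →L[ℂ] L2Spinor :=
  ∑ j, (spin j).compLpL 2 volume ∘L mulL3 (memLp_fderiv_apply_three hV hs j)

/-- The sup bound on ∇V is paired with the L² norm of u. The L³ norm of ∇V is invariant under
dilation in dimension three, so Hölder with u ∈ L⁶ would give no decay for dilated cutoffs; this is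
where u ∈ L² is needed. -/
theorem norm_gradMul_le {c : ℝ} (hc : ∀ x j, ‖fderiv ℝ V x (basisVec j)‖ ≤ c) {u : L6Spinor}
    {g : L2Spinor} (hu : u =ᵐ[volume] g) : ‖gradMul hV hs u‖ ≤ 3 * (c * ‖g‖) := by
  rw [gradMul, sum_apply]
  refine (norm_sum_le _ _).trans ?_
  rw [show (3 : ℝ) * (c * ‖g‖) = ∑ _j : Fin 3, c * ‖g‖ by simp]
  refine Finset.sum_le_sum fun j _ => ?_
  have h1 : ‖(spin j).compLpL 2 volume (mulL3 (memLp_fderiv_apply_three hV hs j) u)‖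
      ≤ 1 * ‖mulL3 (memLp_fderiv_apply_three hV hs j) u‖ := by
    refine Lp.norm_le_mul_norm_of_ae_le_mul ?_
    filter_upwards [(spin j).coeFn_compLpL (mulL3 (memLp_fderiv_apply_three hV hs j) u)] with x hx
    rw [hx, norm_spin, one_mul]
  rw [one_mul] at h1
  refine h1.trans (norm_mulL3_apply_le_of_bound _ (fun x => ?_) hu)
  rw [norm_mul]
  simpa using hc x j

/-- Multiplication by V commutes with A and with the Pauli matrices, so only the gradient term of
Leibniz' rule survives in the commutator. -/
theorem weylDirac_mulTest {A : R3 → R3} (hA : IsL2Loc A) (φ : TestSpinor) :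
    weylDirac hA (mulTest hV hs φ) - gradMul hV hs (testToL6 φ) =ᵐ[volume]
      fun x => V x • weylDirac hA φ x := by
  have h1 : weylDirac hA (mulTest hV hs φ) =ᵐ[volume] weylDiracFun A (mulTest hV hs φ) :=
    (memLp_weylDiracFun hA _).coeFn_toLp
  have h2 : weylDirac hA φ =ᵐ[volume] weylDiracFun A φ := (memLp_weylDiracFun hA _).coeFn_toLp
  have h3 : gradMul hV hs (testToL6 φ) =ᵐ[volume] fun x =>
      ∑ j, spin j (((1 / Complex.I) * fderiv ℝ V x (basisVec j)) • φ x) := by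
    rw [gradMul, sum_apply]
    refine (Lp.coeFn_finsetSum _ _).trans ?_
    have hj : ∀ j, ∀ᵐ x, (spin j).compLpL 2 volume
        (mulL3 (memLp_fderiv_apply_three hV hs j) (testToL6 φ)) x =
          spin j (((1 / Complex.I) * fderiv ℝ V x (basisVec j)) • φ x) := fun j => by
      filter_upwards [(spin j).coeFn_compLpL (mulL3 (memLp_fderiv_apply_three hV hs j) (testToL6 φ)),
        coeFn_mulL3_testToL6 (memLp_fderiv_apply_three hV hs j) φ] with x a1 a2
      rw [a1, a2]
    filter_upwards [ae_all_iff.2 hj] with x hx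
    rw [Finset.sum_apply]
    exact Finset.sum_congr rfl fun j _ => hx j
  filter_upwards [h1, h2, h3, Lp.coeFn_sub (weylDirac hA (mulTest hV hs φ))
    (gradMul hV hs (testToL6 φ))] with x a1 a2 a3 a4
  rw [a4, Pi.sub_apply, a1, a2, a3, weylDiracFun, weylDiracFun, Finset.smul_sum,
    ← Finset.sum_sub_distrib]
  refine Finset.sum_congr rfl fun j _ => ?_
  have e1 : fderiv ℝ (mulTest hV hs φ) x (basisVec j) =
      V x • fderiv ℝ φ x (basisVec j) + fderiv ℝ V x (basisVec j) • φ x :=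
    fderiv_smoothMul (hV.of_le (by norm_cast)) φ x _
  have e2 : mulTest hV hs φ x = V x • φ x := rfl
  rw [e1, e2, spin, ← map_sub]
  refine Eq.trans (congrArg _ ?_)
    (map_smul (Matrix.toEuclideanCLM (n := Fin 2) (𝕜 := ℂ) (pauli j)) (V x) _)
  simp only [smul_add, smul_smul]
  rw [mul_comm (V x) (1 / Complex.I), mul_comm (V x) ((A x j : ℝ) : ℂ)]
  abel

end Cutoff

/-- A function in `L² ∩ L⁶` which is an `L⁶` limit of test spinors along which
`σ · ((1/i)∇ + A)` tends to zero lies in the kernel of the closure of `σ · ((1/i)∇ + A)`. -/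
theorem exists_formMap_eq_zero {A : R3 → R3} (hA : IsL2Loc A) {φ : ℕ → TestSpinor} {f : L6Spinor}
    {g : L2Spinor} (hf : Tendsto (fun n => testToL6 (φ n)) atTop (𝓝 f))
    (hD : Tendsto (fun n => weylDirac hA (φ n)) atTop (𝓝 0)) (hfg : f =ᵐ[volume] g) :
    ∃ v, formIncl (weylDirac hA) v = g ∧ formMap (weylDirac hA) v = 0 := by
  obtain ⟨V, hV, hs, hV1, ⟨C, hC⟩, hlim⟩ := exists_cutoff
  have h3 : ∀ n, MemLp (V n) 3 (volume : Measure R3) := fun n =>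
    (hV n).continuous.memLp_of_hasCompactSupport (hs n)
  -- For a fixed cutoff, V_n ∈ L³ turns L⁶ convergence into L² convergence, and the part V_n Dφ_m
  -- tends to zero. Hence V_n f is in the closure of D, with image the commutator term alone.
  have key : ∀ n, ∃ v, formIncl (weylDirac hA) v = mulL3 (h3 n) f ∧
      formMap (weylDirac hA) v = gradMul (hV n) (hs n) f := by
    intro n
    refine exists_formSpace_of_tendsto (φ := fun m => mulTest (hV n) (hs n) (φ m)) ?_ ?_
    · refine (((mulL3 (h3 n)).continuous.tendsto f).comp hf).congr fun m => ?_
      refine Lp.ext ((coeFn_mulL3_testToL6 (h3 n) (φ m)).trans ?_)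
      exact (memLp_testSpinor (mulTest (hV n) (hs n) (φ m)) 2).coeFn_toLp.symm
    · have h0 : Tendsto (fun m => weylDirac hA (mulTest (hV n) (hs n) (φ m))
          - gradMul (hV n) (hs n) (testToL6 (φ m))) atTop (𝓝 0) := by
        refine squeeze_zero_norm (fun m => ?_) (tendsto_zero_iff_norm_tendsto_zero.1 hD)
        rw [← one_mul ‖weylDirac hA (φ m)‖]
        refine Lp.norm_le_mul_norm_of_ae_le_mul ?_
        filter_upwards [weylDirac_mulTest (hV n) (hs n) hA (φ m)] with x hx
        rw [hx, norm_smul]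
        exact mul_le_mul_of_nonneg_right (hV1 n x) (norm_nonneg _)
      have := h0.add (((gradMul (hV n) (hs n)).continuous.tendsto f).comp hf)
      rw [zero_add] at this
      exact this.congr fun m => sub_add_cancel _ _
  choose v hv1 hv2 using key
  have l1 : Tendsto (fun n => mulL3 (h3 n) f) atTop (𝓝 g) := by
    rw [tendsto_iff_norm_sub_tendsto_zero]
    have hsq : Tendsto (fun n => ‖mulL3 (h3 n) f - g‖ ^ 2) atTop (𝓝 0) := by
      have hm : ∀ n, MemLp (fun x => V n x • g x - g x) 2 (volume : Measure R3) := fun n =>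
        ((Lp.memLp (mulL3 (h3 n) f)).ae_eq (by
          filter_upwards [coeFn_mulL3 (h3 n) f, hfg] with x a1 a2
          rw [a1, a2])).sub (Lp.memLp g)
      have e : ∀ n, ‖mulL3 (h3 n) f - g‖ ^ 2 = ∫ x, ‖V n x • g x - g x‖ ^ 2 := fun n => by
        rw [← normSq_toLp_two (hm n)]
        congr 2
        apply Lp.ext
        filter_upwards [Lp.coeFn_sub (mulL3 (h3 n) f) g, coeFn_mulL3 (h3 n) f, hfg,
          (hm n).coeFn_toLp] with x a1 a2 a3 a4
        rw [a1, a4, Pi.sub_apply, a2, a3]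
      simp only [e]
      rw [show (0 : ℝ) = ∫ _x : R3, (0 : ℝ) by simp]
      refine tendsto_integral_of_dominated_convergence (fun x => (2 * ‖g x‖) ^ 2)
        (fun n => (hm n).1.norm.pow 2) ?_ (fun n => Eventually.of_forall fun x => ?_)
        (Eventually.of_forall fun x => ?_)
      · simp only [mul_pow]
        exact ((memLp_two_iff_integrable_sq_norm (Lp.memLp g).1).1 (Lp.memLp g)).const_mul _
      · rw [Real.norm_of_nonneg (by positivity)]
        refine pow_le_pow_left₀ (norm_nonneg _) ((norm_sub_le _ _).trans ?_) 2
        rw [norm_smul, two_mul]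
        gcongr
        exact mul_le_of_le_one_left (norm_nonneg _) (hV1 n x)
      · have := ((((hlim x).smul_const (g x)).sub_const (g x)).norm.pow 2)
        simpa using this
    have := hsq.sqrt
    simpa [Real.sqrt_sq (norm_nonneg _)] using this
  -- The commutator is O(1/n) in L². With V_n g → g by dominated convergence, closedness of the
  -- graph concludes.
  have l2 : Tendsto (fun n => gradMul (hV n) (hs n) f) atTop (𝓝 0) := by
    refine squeeze_zero_norm (fun n => norm_gradMul_le (hV n) (hs n) (hC n) hfg) ?_
    have : Tendsto (fun n : ℕ => C / ((n : ℝ) + 1)) atTop (𝓝 0) :=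
      tendsto_const_nhds.div_atTop (tendsto_atTop_add_const_right _ _ tendsto_natCast_atTop_atTop)
    simpa using (this.mul_const ‖g‖).const_mul 3
  refine ⟨⟨WithLp.toLp 2 (g, 0), ?_⟩, rfl, rfl⟩
  refine (Submodule.isClosed_topologicalClosure _).mem_of_tendsto (b := atTop)
    (f := fun n => ((v n : formSpace (weylDirac hA)) : WithLp 2 (L2Spinor × L2Spinor))) ?_
    (Eventually.of_forall fun n => (v n).2)
  have l3 : Tendsto (fun n => (mulL3 (h3 n) f, gradMul (hV n) (hs n) f)) atTop (𝓝 (g, 0)) :=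
    l1.prodMk_nhds l2
  refine (((WithLp.prodContinuousLinearEquiv 2 ℂ L2Spinor L2Spinor).symm.continuous.tendsto
    _).comp l3).congr fun n => ?_
  rw [Function.comp_apply, ← hv1 n, ← hv2 n]
  rfl

/-! ### The Weyl–Dirac operator on `ℍ¹_B` -/

theorem weylDiracFun_eq_zero_of_notMem (A : R3 → R3) (φ : TestSpinor) {x : R3}
    (hx : x ∉ tsupport φ) : weylDiracFun A φ x = 0 := by
  have h1 : φ x = 0 := image_eq_zero_of_notMem_tsupport hx
  have h2 : fderiv ℝ φ x = 0 := by
    by_contra h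
    exact hx (support_fderiv_subset ℝ h)
  simp [weylDiracFun, h1, h2]

/-- Dψ vanishes off supp ψ, so φ may be cut off there; the pairing then becomes continuous in the L⁶
norm of φ and passes to `ℍ¹_B`. -/
theorem inner_weylDirac_mulL3_indicator {A : R3 → R3} (hA : IsL2Loc A) (φ ψ : TestSpinor) :
    ⟪weylDirac hA ψ, mulL3 (memLp_indicator_tsupport ψ.hasCompactSupport 3) (testToL6 φ)⟫_ℂ =
      ⟪testToL2 ψ, weylDirac hA φ⟫_ℂ := by
  rw [← inner_weylDirac_comm, L2.inner_def, L2.inner_def]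
  refine integral_congr_ae ?_
  have h1 : weylDirac hA ψ =ᵐ[volume] weylDiracFun A ψ := (memLp_weylDiracFun hA _).coeFn_toLp
  have h2 : testToL2 φ =ᵐ[volume] φ := (memLp_testSpinor φ 2).coeFn_toLp
  filter_upwards [h1, h2,
    coeFn_mulL3_testToL6 (memLp_indicator_tsupport ψ.hasCompactSupport 3) φ] with x a1 a2 a3
  rw [a1, a2, a3]
  by_cases hx : x ∈ tsupport ψ
  · rw [Set.indicator_of_mem hx, one_smul]
  · rw [weylDiracFun_eq_zero_of_notMem A ψ hx, inner_zero_left, inner_zero_left]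

/-- On the form domain, the field is controlled by `σ · ((1/i)∇ + A)` and the `L²` norm. -/
theorem exists_energy_le {A B : R3 → R3} (hA : IsL2Loc A) (hB : IsL32 B) (hcurl : IsWeakCurl A B) :
    ∃ C : ℝ, ∀ φ, energy hA hB φ ≤ 2 * ‖weylDirac hA φ‖ + C * ‖testToL2 φ‖ := by
  obtain ⟨S, hS0, hS⟩ := exists_norm_testToL6_le
  -- At L³ distance 1/(2S) the difference |B|^{1/2} - V costs at most half the energy, which is
  -- absorbed on the left; the rest is bounded by sup|V| times the L² norm.
  obtain ⟨V, hV, h1, h2, h3⟩ :=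
    exists_smooth_approx (memLp_sqrt_norm hB) (show 0 < 1 / (2 * S) by positivity)
  obtain ⟨c, hc⟩ := h1.continuous.bounded_above_of_compact_support h2
  refine ⟨2 * c, fun φ => ?_⟩
  have e1 : ‖sqrtFieldMul hB φ‖ ≤ energy hA hB φ / 2 + c * ‖testToL2 φ‖ := by
    rw [← mulL3_sqrt_testToL6]
    refine (norm_le_norm_sub_add _ (mulL3 hV (testToL6 φ))).trans (add_le_add ((h3 _).trans ?_)
      (norm_mulL3_apply_le_of_bound hV hc (testToL6_ae_eq_testToL2 φ)))
    calc 1 / (2 * S) * ‖testToL6 φ‖ ≤ 1 / (2 * S) * (S * energy hA hB φ) := by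
          gcongr
          exact hS A B hA hB hcurl φ
      _ = energy hA hB φ / 2 := by field_simp
  have e2 : energy hA hB φ ≤ ‖weylDirac hA φ‖ + ‖sqrtFieldMul hB φ‖ := by
    refine Real.sqrt_le_iff.2 ⟨by positivity, ?_⟩
    nlinarith [mul_nonneg (norm_nonneg (weylDirac hA φ)) (norm_nonneg (sqrtFieldMul hB φ))]
  linarith

section Universal

variable {A B : R3 → R3} {hA : IsL2Loc A} {hB : IsL32 B} {R : L2Spinor →ₗ.[ℂ] L2Spinor}
  (hR : IsNonnegSqrt R (pauliPlusField hA hB))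

theorem norm_weylDirac_le_testToH1 (φ : TestSpinor) :
    ‖weylDirac hA φ‖ ≤ 1 * ‖testToH1 hR φ‖ := by
  rw [one_mul, norm_testToH1]
  exact Real.le_sqrt_of_sq_le (le_add_of_nonneg_right (sq_nonneg _))

/-- The continuous extension of `σ · ((1/i)∇ + A)` to `ℍ¹_B`. -/
def weylH1 : H1 R →L[ℂ] L2Spinor := (weylDirac hA).extendOfNorm (testToH1 hR)

theorem weylH1_testToH1 (φ : TestSpinor) : weylH1 hR (testToH1 hR φ) = weylDirac hA φ :=
  LinearMap.extendOfNorm_eq (denseRange_testToH1 hR) ⟨1, norm_weylDirac_le_testToH1 hR⟩ φ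

theorem exists_seq_testToH1 (u : H1 R) :
    ∃ φ : ℕ → TestSpinor, Tendsto (fun n => testToH1 hR (φ n)) atTop (𝓝 u) := by
  obtain ⟨x, hx, hlim⟩ := mem_closure_iff_seq_limit.1 (denseRange_testToH1 hR u)
  choose φ hφ using hx
  exact ⟨φ, hlim.congr fun n => (hφ n).symm⟩

variable {J : H1 R →L[ℂ] L6Spinor} (hJ : ∀ u : NormedDomain R, J (toH1 u) =ᵐ[volume] u.val)

include hJ

theorem embedding_testToH1 (φ : TestSpinor) : J (testToH1 hR φ) = testToL6 φ :=
  Lp.ext ((hJ (testToDomain hR φ)).trans (testToL6_ae_eq_testToL2 φ).symm)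

theorem mulL3_embedding_testToH1 (φ : TestSpinor) :
    mulL3 (memLp_sqrt_norm hB) (J (testToH1 hR φ)) = sqrtFieldMul hB φ := by
  rw [embedding_testToH1 hR hJ, mulL3_sqrt_testToL6]

/-- On test spinors this is the definition of p = p_A + b; both sides are continuous and test
spinors are dense. -/
theorem inner_H1_eq (u v : H1 R) : ⟪u, v⟫_ℂ = ⟪weylH1 hR u, weylH1 hR v⟫_ℂ +
    ⟪mulL3 (memLp_sqrt_norm hB) (J u), mulL3 (memLp_sqrt_norm hB) (J v)⟫_ℂ := by
  refine (denseRange_testToH1 hR).induction_on₂ ?_ (fun φ ψ => ?_) u v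
  · exact isClosed_eq (by fun_prop) (by fun_prop)
  · rw [inner_testToH1, weylH1_testToH1, weylH1_testToH1, mulL3_embedding_testToH1 hR hJ,
      mulL3_embedding_testToH1 hR hJ]

theorem inner_testToL2_weylH1 (ψ : TestSpinor) (u : H1 R) : ⟪testToL2 ψ, weylH1 hR u⟫_ℂ =
    ⟪weylDirac hA ψ, mulL3 (memLp_indicator_tsupport ψ.hasCompactSupport 3) (J u)⟫_ℂ := by
  refine (denseRange_testToH1 hR).induction_on u ?_ fun φ => ?_
  · exact isClosed_eq (by fun_prop) (by fun_prop)
  · rw [weylH1_testToH1, embedding_testToH1 hR hJ, inner_weylDirac_mulL3_indicator]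

include hR in
-- If u vanishes as a function, then Du = 0 by its weak formulation and |B|^{1/2}u = 0 trivially;
-- these two components make up the whole norm of `ℍ¹_B`.
theorem injective_embedding : Function.Injective J := by
  rw [injective_iff_map_eq_zero]
  intro u hu
  have h1 : weylH1 hR u = 0 := by
    refine denseRange_testToL2.eq_zero_of_inner_right ℂ fun ψ => ?_
    rw [inner_testToL2_weylH1 hR hJ, hu, map_zero, inner_zero_right]
  have := inner_H1_eq hR hJ u u
  rw [h1, hu, map_zero, inner_zero_right, add_zero] at this
  exact (inner_self_eq_zero (𝕜 := ℂ)).1 this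

include hR in
theorem isCompactOperator_mulL3_embedding (hcurl : IsWeakCurl A B) :
    IsCompactOperator (mulL3 (memLp_sqrt_norm hB) ∘L J) := by
  refine isCompactOperator_of_finiteDimensional_dist _ (LinearMap.range (testToH1 hR))
    (denseRange_testToH1 hR) fun ε hε => ?_
  obtain ⟨W, hW, H⟩ := exists_finiteDimensional_dist_mulL3_le hA hB hcurl (memLp_sqrt_norm hB) hε
  refine ⟨W, hW, ?_⟩
  rintro _ ⟨φ, rfl⟩ hφ
  rw [norm_testToH1] at hφ
  obtain ⟨w, hw, hle⟩ := H φ hφ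
  refine ⟨w, hw, ?_⟩
  rwa [ContinuousLinearMap.comp_apply, embedding_testToH1 hR hJ]

/-- By `exists_energy_le` a sequence that is Cauchy in the graph norm of D is Cauchy in `ℍ¹_B`, and
its two limits agree as functions. -/
theorem exists_of_formMap_eq_zero (hcurl : IsWeakCurl A B) {v : formSpace (weylDirac hA)}
    (hv : formMap (weylDirac hA) v = 0) :
    ∃ u : H1 R, weylH1 hR u = 0 ∧ J u =ᵐ[volume] formIncl (weylDirac hA) v := by
  obtain ⟨φ, hφ⟩ := exists_seq_testToForm (weylDirac hA) v
  have h1 : Tendsto (fun n => testToL2 (φ n)) atTop (𝓝 (formIncl (weylDirac hA) v)) :=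
    ((formIncl (weylDirac hA)).continuous.tendsto v).comp hφ
  have h2 : Tendsto (fun n => weylDirac hA (φ n)) atTop (𝓝 (formMap (weylDirac hA) v)) :=
    ((formMap (weylDirac hA)).continuous.tendsto v).comp hφ
  obtain ⟨C, hC⟩ := exists_energy_le hA hB hcurl
  have hc : CauchySeq fun n => testToH1 hR (φ n) := by
    have d1 := h1.cauchySeq
    have d2 := h2.cauchySeq
    rw [cauchySeq_iff_tendsto, tendsto_uniformity_iff_dist_tendsto_zero] at d1 d2 ⊢
    have d3 := (d2.const_mul 2).add (d1.const_mul C)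
    rw [mul_zero, mul_zero, add_zero] at d3
    refine squeeze_zero (fun _ => dist_nonneg) (fun mn => ?_) d3
    have := hC (φ mn.1 - φ mn.2)
    rw [← norm_testToH1 hR, map_sub, map_sub, map_sub, ← dist_eq_norm, ← dist_eq_norm,
      ← dist_eq_norm] at this
    exact this
  obtain ⟨u, hu⟩ := cauchySeq_tendsto_of_complete hc
  refine ⟨u, ?_, ?_⟩
  · rw [← hv]
    refine tendsto_nhds_unique (((weylH1 hR).continuous.tendsto u).comp hu) (h2.congr fun n => ?_)
    exact (weylH1_testToH1 hR (φ n)).symm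
  · refine ae_eq_of_tendsto h1 (((J.continuous.tendsto u).comp hu).congr fun n => ?_)
    exact embedding_testToH1 hR hJ (φ n)

theorem exists_formMap_eq_zero_of_weylH1 {u : H1 R} (hu : weylH1 hR u = 0) {g : L2Spinor}
    (hg : J u =ᵐ[volume] g) :
    ∃ v, formIncl (weylDirac hA) v = g ∧ formMap (weylDirac hA) v = 0 := by
  obtain ⟨φ, hφ⟩ := exists_seq_testToH1 hR u
  refine exists_formMap_eq_zero hA (φ := φ) (f := J u) ?_ ?_ hg
  · exact ((J.continuous.tendsto u).comp hφ).congr fun n => embedding_testToH1 hR hJ (φ n)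
  · rw [← hu]
    exact (((weylH1 hR).continuous.tendsto u).comp hφ).congr fun n => weylH1_testToH1 hR (φ n)

end Universal

/-! ### Fixed points of `𝓑` and zero modes -/

section BirmanSchwinger

variable {A B : R3 → R3} {hA : IsL2Loc A} {hB : IsL32 B} {R : L2Spinor →ₗ.[ℂ] L2Spinor}
  {J : H1 R →L[ℂ] L6Spinor} {𝓑 : H1 R →L[ℂ] H1 R} {U : L2Spinor ≃ₗᵢ[ℂ] H1 R}
  {S : L2Spinor →L[ℂ] L2Spinor} (h : IsBirmanSchwinger hA hB R J 𝓑 U S)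

/-- The elements of the fixed space, as functions in `L²`. -/
def fixedToL2 (J : H1 R →L[ℂ] L6Spinor) (𝓑 : H1 R →L[ℂ] H1 R) :
    fixedSpace J 𝓑 →ₗ[ℂ] L2Spinor where
  toFun u := u.2.2.toLp _
  map_add' u v := by
    rw [← MemLp.toLp_add]
    refine MemLp.toLp_congr _ _ ?_
    rw [Submodule.coe_add, map_add]
    exact Lp.coeFn_add _ _
  map_smul' c u := by
    rw [RingHom.id_apply, ← MemLp.toLp_const_smul]
    refine MemLp.toLp_congr _ _ ?_
    rw [Submodule.coe_smul, map_smul]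
    exact Lp.coeFn_smul _ _

theorem coeFn_fixedToL2 (u : fixedSpace J 𝓑) : fixedToL2 J 𝓑 u =ᵐ[volume] J u :=
  u.2.2.coeFn_toLp

include h

/-- Over ℂ the quadratic form determines the operator, by polarization. -/
theorem IsBirmanSchwinger.fieldOperator_eq :
    𝓑 = ((mulL3 (memLp_sqrt_norm hB) ∘L J)†) ∘L (mulL3 (memLp_sqrt_norm hB) ∘L J) := by
  refine ContinuousLinearMap.coe_injective ((ext_inner_map _ _).1 fun u => ?_)
  have h1 := h.form u
  rw [← inner_mulL3_sqrt_self hB] at h1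
  simpa [ContinuousLinearMap.adjoint_inner_left] using h1

theorem IsBirmanSchwinger.inner_fieldOperator (v u : H1 R) : ⟪v, 𝓑 u⟫_ℂ =
    ⟪mulL3 (memLp_sqrt_norm hB) (J v), mulL3 (memLp_sqrt_norm hB) (J u)⟫_ℂ := by
  rw [h.fieldOperator_eq, ContinuousLinearMap.comp_apply, ContinuousLinearMap.adjoint_inner_right]
  rfl

theorem IsBirmanSchwinger.S_eq :
    S = (mulL3 (memLp_sqrt_norm hB) ∘L J) ∘L U.toContinuousLinearEquiv.toContinuousLinearMap :=
  ContinuousLinearMap.ext fun f => Lp.ext ((h.factor f).trans (coeFn_mulL3 _ _).symm)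

theorem IsBirmanSchwinger.S_comp_adjoint_eq : S ∘L S† =
    (mulL3 (memLp_sqrt_norm hB) ∘L J) ∘L (mulL3 (memLp_sqrt_norm hB) ∘L J)† := by
  have hU : U.toContinuousLinearEquiv.toContinuousLinearMap ∘L
      (U.toContinuousLinearEquiv.toContinuousLinearMap)† = 1 := by
    refine ContinuousLinearMap.ext fun x => ext_inner_right ℂ fun y => ?_
    have e : U.toContinuousLinearEquiv.toContinuousLinearMap (U.symm y) = y := U.apply_symm_apply y
    have e2 : ∀ z, ⟪U z, y⟫_ℂ = ⟪z, U.symm y⟫_ℂ := fun z => by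
      rw [← U.inner_map_map z, U.apply_symm_apply]
    refine (e2 _).trans ((ContinuousLinearMap.adjoint_inner_left
      U.toContinuousLinearEquiv.toContinuousLinearMap (U.symm y) x).trans ?_)
    rw [e]
    rfl
  rw [h.S_eq, ContinuousLinearMap.adjoint_comp]
  ext1 x
  have := congrArg (fun L : H1 R →L[ℂ] H1 R => L (((mulL3 (memLp_sqrt_norm hB) ∘L J)†) x)) hU
  exact congrArg (mulL3 (memLp_sqrt_norm hB) ∘L J) this

/-- Subtracting the form of 𝓑 from the inner product leaves ⟪v, u⟫ - ⟪v, 𝓑u⟫ = ⟪Dv, Du⟫. -/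
theorem IsBirmanSchwinger.fieldOperator_apply_eq_iff (u : H1 R) :
    𝓑 u = u ↔ weylH1 h.sqrt u = 0 := by
  have key : ∀ v, ⟪v, u⟫_ℂ - ⟪v, 𝓑 u⟫_ℂ = ⟪weylH1 h.sqrt v, weylH1 h.sqrt u⟫_ℂ := fun v => by
    rw [inner_H1_eq h.sqrt h.embed v u, h.inner_fieldOperator, add_sub_cancel_right]
  constructor
  · intro hu
    have := key u
    rw [hu, sub_self] at this
    exact (inner_self_eq_zero (𝕜 := ℂ)).1 this.symm
  · intro hu
    refine ext_inner_left ℂ fun v => ?_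
    have := key v
    rw [hu, inner_zero_right] at this
    exact (sub_eq_zero.1 this).symm

/-- Both spaces have the same image in L², the kernel of the closure of D; the fixed space injects
into L² because its elements are determined as functions. -/
theorem IsBirmanSchwinger.nullity_eq (hcurl : IsWeakCurl A B) :
    nullity (pauliOperator hA) = Module.rank ℂ (fixedSpace J 𝓑) := by
  have hinj : Function.Injective (fixedToL2 J 𝓑) := by
    intro u v huv
    refine Subtype.ext (injective_embedding h.sqrt h.embed (Lp.ext ?_))
    exact (coeFn_fixedToL2 u).symm.trans (huv ▸ coeFn_fixedToL2 v)
  rw [(LinearEquiv.ofInjective (fixedToL2 J 𝓑) hinj).rank_eq]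
  refine nullity_eq_rank fun g => ?_
  rw [mem_pauliOperator_graph_iff]
  constructor
  · rintro ⟨u, rfl⟩
    exact exists_formMap_eq_zero_of_weylH1 h.sqrt h.embed
      ((h.fieldOperator_apply_eq_iff _).1 u.2.1) (coeFn_fixedToL2 u).symm
  · rintro ⟨v, rfl, hv⟩
    obtain ⟨u, hu, hJu⟩ := exists_of_formMap_eq_zero h.sqrt h.embed hcurl hv
    refine ⟨⟨u, (h.fieldOperator_apply_eq_iff u).2 hu, (Lp.memLp _).ae_eq hJu.symm⟩, ?_⟩
    exact Lp.ext ((coeFn_fixedToL2 _).trans hJu)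

/-- M maps solutions of M*Mu = u to solutions of MM*f = f, injectively because Mu = 0 gives u = M*Mu
= 0. -/
theorem IsBirmanSchwinger.rank_fixedSpace_le : Module.rank ℂ (fixedSpace J 𝓑) ≤
    Module.rank ℂ (LinearMap.ker (birmanSchwingerF S : L2Spinor →ₗ[ℂ] L2Spinor)) := by
  obtain ⟨M, hM, hS⟩ : ∃ M : H1 R →L[ℂ] L2Spinor, (∀ x, 𝓑 x = (M†) (M x)) ∧
      S ∘L S† = M ∘L M† :=
    ⟨_, fun x => congrArg (fun L : H1 R →L[ℂ] H1 R => L x) h.fieldOperator_eq,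
      h.S_comp_adjoint_eq⟩
  let f : fixedSpace J 𝓑 →ₗ[ℂ] LinearMap.ker (birmanSchwingerF S : L2Spinor →ₗ[ℂ] L2Spinor) :=
    LinearMap.codRestrict _ (M.toLinearMap ∘ₗ (fixedSpace J 𝓑).subtype) fun u => by
      have hu : (M†) (M u) = u := by
        have := u.2.1
        rwa [hM] at this
      change M u - (S ∘L S†) (M u) = 0
      rw [hS, ContinuousLinearMap.comp_apply, hu, sub_self]
  refine LinearMap.rank_le_of_injective f ((injective_iff_map_eq_zero f).2 fun u hu => ?_)
  have h0 : M u = 0 := congrArg Subtype.val hu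
  have h1 : 𝓑 u = u := u.2.1
  rw [hM, h0, map_zero] at h1
  exact Subtype.ext h1.symm

theorem IsBirmanSchwinger.isCompactOperator (hcurl : IsWeakCurl A B) : IsCompactOperator S := by
  rw [h.S_eq]
  exact (isCompactOperator_mulL3_embedding h.sqrt h.embed hcurl).comp_clm _

end BirmanSchwinger

end ZeroModes
end

/-! ### The main theorem -/

open ZeroModes in
theorem theorem3p1 (A B : R3 → R3) (hA : IsL2Loc A) (hB : IsL32 B) (hcurl : IsWeakCurl A B) :
    (∃ R J 𝓑 U S, IsBirmanSchwinger hA hB R J 𝓑 U S) ∧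
    ∀ R J 𝓑 U S, IsBirmanSchwinger hA hB R J 𝓑 U S →
      Function.Injective J ∧
      IsCompactOperator S ∧
      nullity (pauliOperator hA) = Module.rank ℂ (fixedSpace J 𝓑) ∧
      nullity (pauliOperator hA) ≤
        Module.rank ℂ (LinearMap.ker (birmanSchwingerF S : L2Spinor →ₗ[ℂ] L2Spinor)) :=
  ⟨exists_isBirmanSchwinger hA hB hcurl, fun _ _ _ _ _ h =>
    ⟨injective_embedding h.sqrt h.embed, h.isCompactOperator hcurl, h.nullity_eq hcurl,
      (h.nullity_eq hcurl).trans_le h.rank_fixedSpace_le⟩⟩
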